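/- Let $p$ be a prime, $e=p-1$, $\pi$ a root of $\pi^{e}=-p$, $K=\mathbf{Q}_p(\pi)$, $\Delta=\mathrm{Gal}(K/\mathbf{Q}_p)$, and let $\widetilde\omega:\Delta\to\mathbf{Z}_p^\times$ be the character $g\mapsto g(\pi)/\pi$. Let $E/\mathbf{Q}_p$ be a finite extension with ring of integers $\mathcal{O}_E$. Put $E(u)=u^{e}+p$ and let $S=S_{\mathcal{O}_E}$ be Breuil's ring, i.e. the completion of $S_{\mathbf{Z}_p}\otimes_{\mathbf{Z}_p}\mathcal{O}_E$, where $S_{\mathbf{Z}_p}$ is the $p$-adic completion of the divided power envelope of $\mathbf{Z}_p[u]$ with respect to $(E(u))$; explicitly, $S=\{\sum_{n\ge0}a_n u^n/\lfloor n/e\rfloor! : a_n\in\mathcal{O}_E,\ a_n\to 0\}\subset E[[u]]$. Let $\mathrm{Fil}^iS$ be the $p$-adic closure of the ideal generated by the $E(u)^j/j!$ with $j\ge i$, let $\varphi$ be the $\mathcal{O}_E$-linear Frobenius $u\mapsto u^p$, and let $g\in\Delta$ act $\mathcal{O}_E$-linearly on $S$ by $u\mapsto\widetilde\omega(g)u$.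 A quasi-strongly divisible $\mathcal{O}_E$-module (in weights $[0,2]$, with descent data) is a finite free $S$-module $\mathcal{M}$ with an $S$-submodule $\mathrm{Fil}^2\mathcal{M}$, an additive map $\varphi_2:\mathrm{Fil}^2\mathcal{M}\to\mathcal{M}$ and bijections $\widehat g:\mathcal{M}\to\mathcal{M}$ ($g\in\Delta$), semilinear for the action of $g$ on $S$, such that: $\mathrm{Fil}^2S\cdot\mathcal{M}\subseteq\mathrm{Fil}^2\mathcal{M}$; $\mathrm{Fil}^2\mathcal{M}\cap I\mathcal{M}=I\,\mathrm{Fil}^2\mathcal{M}$ for every ideal $I$ of $\mathcal{O}_E$; $\varphi_2(sx)=\varphi(s)\varphi_2(x)$ for $s\in S$, $x\in\mathrm{Fil}^2\mathcal{M}$; $\varphi_2(\mathrm{Fil}^2\mathcal{M})$ generates $\mathcal{M}$ over $S$; each $\widehat g$ preserves $\mathrm{Fil}^2\mathcal{M}$ and commutes with $\varphi_2$; and $\widehat{gh}=\widehat g\circ\widehat h$. Let $a_0,a_1,a_2\in\mathbf{N}$ be strongly generic: $a_1-a_0>3$, $a_2-a_1>3$ and $a_2-a_0<p-4$. Call a triple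 $(x_0,x_1,x_2)$ in $\mathcal{M}$ framed if $\widehat g(x_i)=\widetilde\omega(g)^{a_i}x_i$ for all $g\in\Delta$ and all $i$. **Theorem.** Let $\mathcal{M}$ be a quasi-strongly divisible $\mathcal{O}_E$-module as above with descent data of type $\tau\cong\widetilde\omega^{a_0}\oplus\widetilde\omega^{a_1}\oplus\widetilde\omega^{a_2}$, and let $(e_0,e_1,e_2)$ be a framed $S$-basis of $\mathcal{M}$ such that $\mathrm{Fil}^2\mathcal{M}/(\mathrm{Fil}^pS\cdot\mathcal{M})$ is generated by $e_0,\ E(u)e_1,\ E(u)^2e_2$. Then there exist a framed $S$-basis $(e_0^{(\infty)},e_1^{(\infty)},e_2^{(\infty)})$ of $\mathcal{M}$, a framed triple $(f_0^{(\infty)},f_1^{(\infty)},f_2^{(\infty)})$ of elements of $\mathrm{Fil}^2\mathcal{M}$ whose classes generate $\mathrm{Fil}^2\mathcal{M}/(\mathrm{Fil}^pS\cdot\mathcal{M})$, elements $v_{1,0},v_{2,1}\in\mathcal{O}_E$ and $v_{2,0}\in\mathcal{O}_E\oplus E(u)\mathcal{O}_E$, and units $\lambda_0,\lambda_1,\lambda_2\in\mathcal{O}_E^\times$,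 such that $$(f_0^{(\infty)},f_1^{(\infty)},f_2^{(\infty)})=(e_0^{(\infty)},e_1^{(\infty)},e_2^{(\infty)})\begin{pmatrix}1&0&0\\ u^{e-(a_1-a_0)}v_{1,0}&E(u)&0\\ u^{e-(a_2-a_0)}v_{2,0}&u^{e-(a_2-a_1)}E(u)v_{2,1}&E(u)^2\end{pmatrix}$$ and $\varphi_2(f_i^{(\infty)})=\lambda_i e_i^{(\infty)}$ for $i=0,1,2$. -/

import Mathlib

open scoped PowerSeries

namespace Breuil

noncomputable section

/-! ## The tame extension `K = ℚ_p(π)`, `π ^ (p - 1) = -p`, and the character of its Galois group -/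

/-- `K = ℚ_p(π)` where `π` is a `(p-1)`-st root of `-p`. -/
structure IsTameUniformizer (p : ℕ) [Fact p.Prime] {K : Type*} [Field K] [Algebra ℚ_[p] K]
    (π : K) : Prop where
  pow_eq : π ^ (p - 1) = -(p : K)
  adjoin_eq_top : IntermediateField.adjoin ℚ_[p] {π} = ⊤

/-- Teichmüller lifts: every unit of `𝔽_p` lifts to a `(p-1)`-st root of unity in `ℤ_p`. -/
theorem exists_root_of_unity (p : ℕ) [hp : Fact p.Prime] (x : (ZMod p)ˣ) :
    ∃ z : ℤ_[p], z ^ (p - 1) = 1 ∧ PadicInt.toZMod z = (x : ZMod p) := by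
  have hp1 : 1 ≤ p - 1 := Nat.le_sub_one_of_lt hp.out.one_lt
  obtain ⟨a, ha⟩ := ZMod.ringHom_surjective (PadicInt.toZMod (p := p)) (x : ZMod p)
  have ha1 : PadicInt.toZMod (a ^ (p - 1) - 1) = (0 : ZMod p) := by
    rw [map_sub, map_pow, ha, map_one, ← Units.val_pow_eq_pow_val, ZMod.units_pow_card_sub_one_eq_one]
    simp
  have haunit : ‖a‖ = 1 := by
    by_contra h
    have : a ∈ RingHom.ker (PadicInt.toZMod (p := p)) := by
      rw [PadicInt.ker_toZMod]
      rw [IsLocalRing.mem_maximalIdeal, mem_nonunits_iff, PadicInt.isUnit_iff]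
      exact h
    rw [RingHom.mem_ker, ha] at this
    exact x.ne_zero this
  have hder : ‖((p - 1 : ℕ) : ℤ_[p])‖ = 1 := by
    rw [← PadicInt.isUnit_iff]
    by_contra h
    rw [← mem_nonunits_iff, ← IsLocalRing.mem_maximalIdeal, ← PadicInt.ker_toZMod,
      RingHom.mem_ker, map_natCast, ZMod.natCast_eq_zero_iff] at h
    have := Nat.le_of_dvd hp1 h
    have := hp.out.one_lt
    omega
  have hlt : ‖a ^ (p - 1) - 1‖ < 1 := by
    rw [← PadicInt.mem_nonunits, ← IsLocalRing.mem_maximalIdeal, ← PadicInt.ker_toZMod]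
    exact ha1
  let F : Polynomial ℤ_[p] := Polynomial.X ^ (p - 1) - 1
  have hF : ∀ z : ℤ_[p], F.aeval z = z ^ (p - 1) - 1 := by intro z; simp [F]
  have hF' : ∀ z : ℤ_[p], F.derivative.aeval z = ((p - 1 : ℕ) : ℤ_[p]) * z ^ (p - 1 - 1) := by
    intro z; simp [F, Polynomial.derivative_X_pow]
  have hn : ‖F.aeval a‖ < ‖F.derivative.aeval a‖ ^ 2 := by
    rw [hF, hF', norm_mul, norm_pow, haunit, hder]; simpa using hlt
  obtain ⟨z, hz, hza, -⟩ := hensels_lemma hn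
  refine ⟨z, by rw [hF] at hz; exact sub_eq_zero.mp hz, ?_⟩
  rw [hF', norm_mul, norm_pow, haunit, hder] at hza
  have : z - a ∈ RingHom.ker (PadicInt.toZMod (p := p)) := by
    rw [PadicInt.ker_toZMod, IsLocalRing.mem_maximalIdeal, PadicInt.mem_nonunits]
    simpa using hza
  rw [RingHom.mem_ker, map_sub, sub_eq_zero] at this
  rw [this, ha]

/-- The `(p-1)`-st roots of unity of a field extension of `ℚ_p` lie in `ℤ_pˣ`. -/
theorem exists_unit_of_pow_eq_one (p : ℕ) [hp : Fact p.Prime] {K : Type*} [Field K]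
    [Algebra ℚ_[p] K] (x : K) (hx : x ^ (p - 1) = 1) :
    ∃ z : ℤ_[p]ˣ, x = algebraMap ℚ_[p] K ((z : ℤ_[p]) : ℚ_[p]) := by
  classical
  have hp1 : 0 < p - 1 := Nat.sub_pos_of_lt hp.out.one_lt
  choose f hf hf' using exists_root_of_unity p
  let g : (ZMod p)ˣ → K := fun a => algebraMap ℚ_[p] K ((f a : ℤ_[p]) : ℚ_[p])
  have hg : Function.Injective g := by
    intro a b hab
    have h1 := (algebraMap ℚ_[p] K).injective hab
    have h2 : f a = f b := Subtype.ext h1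
    exact Units.ext (by rw [← hf' a, ← hf' b, h2])
  have hsub : Finset.univ.image g ⊆ Polynomial.nthRootsFinset (p - 1) (1 : K) := by
    intro y hy
    obtain ⟨a, -, rfl⟩ := Finset.mem_image.mp hy
    rw [Polynomial.mem_nthRootsFinset hp1]
    have := congrArg (fun t : ℤ_[p] => algebraMap ℚ_[p] K (t : ℚ_[p])) (hf a)
    simpa [g] using this
  have hcard : (Polynomial.nthRootsFinset (p - 1) (1 : K)).card ≤ (Finset.univ.image g).card := by
    rw [Finset.card_image_of_injective _ hg, Finset.card_univ, ZMod.card_units]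
    unfold Polynomial.nthRootsFinset
    exact (Multiset.toFinset_card_le _).trans (Polynomial.card_nthRoots _ _)
  have heq := Finset.eq_of_subset_of_card_le hsub hcard
  have hxm : x ∈ Polynomial.nthRootsFinset (p - 1) (1 : K) := by
    rw [Polynomial.mem_nthRootsFinset hp1]; exact hx
  rw [← heq] at hxm
  obtain ⟨a, -, ha⟩ := Finset.mem_image.mp hxm
  have hu : IsUnit (f a) := IsUnit.of_pow_eq_one (hf a) hp1.ne'
  exact ⟨hu.unit, ha.symm⟩

theorem IsTameUniformizer.ne_zero {p : ℕ} [hp : Fact p.Prime] {K : Type*} [Field K]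
    [Algebra ℚ_[p] K] {π : K} (hπ : IsTameUniformizer p π) : π ≠ 0 := by
  rintro rfl
  have h := hπ.pow_eq
  rw [zero_pow (Nat.sub_pos_of_lt hp.out.one_lt).ne'] at h
  have h1 : algebraMap ℚ_[p] K (p : ℚ_[p]) = 0 := by
    rw [map_natCast]; exact (neg_eq_zero.mp h.symm)
  rw [map_eq_zero] at h1
  exact hp.out.ne_zero (by exact_mod_cast h1)

theorem exists_omega {p : ℕ} [hp : Fact p.Prime] {K : Type*} [Field K] [Algebra ℚ_[p] K] {π : K}
    (hπ : IsTameUniformizer p π) (g : K ≃ₐ[ℚ_[p]] K) :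
    ∃ z : ℤ_[p]ˣ, g π = algebraMap ℚ_[p] K ((z : ℤ_[p]) : ℚ_[p]) * π := by
  have h0 := hπ.ne_zero
  have hx : (g π / π) ^ (p - 1) = 1 := by
    rw [div_pow, ← map_pow, hπ.pow_eq, map_neg, map_natCast, ← hπ.pow_eq]
    exact div_self (pow_ne_zero _ h0)
  obtain ⟨z, hz⟩ := exists_unit_of_pow_eq_one p _ hx
  exact ⟨z, by rw [← hz, div_mul_cancel₀ _ h0]⟩

/-- The character `ω̃_π : Gal(K/ℚ_p) → ℤ_pˣ`, `g ↦ g(π)/π`. -/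
def omegaTilde {p : ℕ} [Fact p.Prime] {K : Type*} [Field K] [Algebra ℚ_[p] K] {π : K}
    (hπ : IsTameUniformizer p π) : (K ≃ₐ[ℚ_[p]] K) →* ℤ_[p]ˣ :=
  have key : ∀ z w : ℤ_[p]ˣ, algebraMap ℚ_[p] K ((z : ℤ_[p]) : ℚ_[p]) * π =
      algebraMap ℚ_[p] K ((w : ℤ_[p]) : ℚ_[p]) * π → z = w := fun z w h =>
    Units.ext (Subtype.ext ((algebraMap ℚ_[p] K).injective (mul_right_cancel₀ hπ.ne_zero h)))
  { toFun := fun g => (exists_omega hπ g).choose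
    map_one' := by
      apply key
      rw [← (exists_omega hπ 1).choose_spec]
      simp
    map_mul' := fun g h => by
      apply key
      have h1 := (exists_omega hπ g).choose_spec
      have h2 := (exists_omega hπ h).choose_spec
      generalize (exists_omega hπ g).choose = z at h1 ⊢
      generalize (exists_omega hπ h).choose = w at h2 ⊢
      rw [← (exists_omega hπ (g * h)).choose_spec, AlgEquiv.mul_apply, h2, map_mul,
        AlgEquiv.commutes, h1, Units.val_mul, PadicInt.coe_mul, map_mul]
      ring }

theorem omegaTilde_spec {p : ℕ} [Fact p.Prime] {K : Type*} [Field K] [Algebra ℚ_[p] K] {π : K}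
    (hπ : IsTameUniformizer p π) (g : K ≃ₐ[ℚ_[p]] K) :
    g π = algebraMap ℚ_[p] K ((omegaTilde hπ g : ℤ_[p]) : ℚ_[p]) * π :=
  (exists_omega hπ g).choose_spec

/-! ## The Breuil ring `S_{𝒪_E}` -/

theorem charZero_E (p : ℕ) [Fact p.Prime] (E : Type*) [Field E] [Algebra ℚ_[p] E] : CharZero E :=
  charZero_of_injective_algebraMap (algebraMap ℚ_[p] E).injective

section BreuilRing

set_option linter.unusedSectionVars false

variable (p : ℕ) [hp : Fact p.Prime] (E : Type*) [Field E] [Algebra ℚ_[p] E] [Algebra ℤ_[p] E]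

/-- The ring of integers `𝒪_E` of a finite extension `E` of `ℚ_p`. -/
abbrev OE : Subalgebra ℤ_[p] E := integralClosure ℤ_[p] E


/-- Membership in the Breuil ring: `f = ∑ aₙ uⁿ / ⌊n/e⌋!` with `aₙ ∈ 𝒪_E` and `aₙ → 0`
`p`-adically, where `e = p - 1`. -/
def MemBreuil (f : E⟦X⟧) : Prop :=
  ∃ a : ℕ → OE p E, (∀ k : ℕ, ∀ᶠ n in Filter.atTop, (p : OE p E) ^ k ∣ a n) ∧
    ∀ n, ((n / (p - 1)).factorial : E) * PowerSeries.coeff n f = (a n : E)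

variable {p E}

theorem memBreuil_of_zero {f : E⟦X⟧} (a : ℕ → OE p E) (N : ℕ)
    (h0 : ∀ n, N ≤ n → a n = 0)
    (h : ∀ n, ((n / (p - 1)).factorial : E) * PowerSeries.coeff n f = (a n : E)) :
    MemBreuil p E f :=
  ⟨a, fun k => Filter.eventually_atTop.mpr ⟨N, fun n hn => by rw [h0 n hn]; exact dvd_zero _⟩, h⟩

theorem memBreuil_algebraMap (c : OE p E) :
    MemBreuil p E (algebraMap (OE p E) E⟦X⟧ c) := by
  refine memBreuil_of_zero (fun n => if n = 0 then c else 0) 1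
    (fun n hn => if_neg (by omega)) fun n => ?_
  rw [IsScalarTower.algebraMap_apply (OE p E) E E⟦X⟧, PowerSeries.algebraMap_apply,
    PowerSeries.coeff_C]
  by_cases hn : n = 0
  · subst hn; simp
  · simp [hn]

theorem memBreuil_add {f g : E⟦X⟧} (hf : MemBreuil p E f) (hg : MemBreuil p E g) :
    MemBreuil p E (f + g) := by
  obtain ⟨a, ha, hfa⟩ := hf
  obtain ⟨b, hb, hgb⟩ := hg
  refine ⟨a + b, fun k => ?_, fun n => ?_⟩
  · filter_upwards [ha k, hb k] with n h1 h2 using dvd_add h1 h2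
  · rw [map_add, mul_add, hfa, hgb]; rfl

theorem memBreuil_mul {f g : E⟦X⟧} (hf : MemBreuil p E f) (hg : MemBreuil p E g) :
    MemBreuil p E (f * g) := by
  obtain ⟨a, ha, hfa⟩ := hf
  obtain ⟨b, hb, hgb⟩ := hg
  have hdvd : ∀ i j : ℕ, (i / (p - 1)).factorial * (j / (p - 1)).factorial ∣
      ((i + j) / (p - 1)).factorial := fun i j =>
    (Nat.factorial_mul_factorial_dvd_factorial_add _ _).trans
      (Nat.factorial_dvd_factorial (Nat.div_add_div_le_add_div))
  choose c hc using hdvd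
  refine ⟨fun n => ∑ x ∈ Finset.HasAntidiagonal.antidiagonal n, (c x.1 x.2 : OE p E) * (a x.1 * b x.2),
    fun k => ?_, fun n => ?_⟩
  · obtain ⟨N, hN⟩ := Filter.eventually_atTop.mp (ha k)
    obtain ⟨N', hN'⟩ := Filter.eventually_atTop.mp (hb k)
    refine Filter.eventually_atTop.mpr ⟨N + N', fun n hn => Finset.dvd_sum fun x hx => ?_⟩
    rw [Finset.HasAntidiagonal.mem_antidiagonal] at hx
    apply Dvd.dvd.mul_left
    rcases le_or_gt N x.1 with h | h
    · exact Dvd.dvd.mul_right (hN _ h) _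
    · exact Dvd.dvd.mul_left (hN' _ (by omega)) _
  · rw [PowerSeries.coeff_mul, Finset.mul_sum]
    push_cast
    refine Finset.sum_congr rfl fun x hx => ?_
    rw [Finset.HasAntidiagonal.mem_antidiagonal] at hx
    rw [← hfa, ← hgb, ← hx, hc x.1 x.2]
    push_cast
    ring

variable (p E)

/-- The Breuil ring `S_{𝒪_E}`: the completion of `S_{ℤ_p} ⊗ 𝒪_E`, where `S_{ℤ_p}` is the `p`-adic
completion of the divided power envelope of `ℤ_p[u]` with respect to `E(u) = u^e + p`
(`e = p - 1`). It is realised by its standard description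
`S_{𝒪_E} = {∑ aₙ uⁿ / ⌊n/e⌋! : aₙ ∈ 𝒪_E, aₙ → 0} ⊆ E⟦u⟧`, as an `𝒪_E`-subalgebra. -/
def breuilSubalgebra : Subalgebra (OE p E) E⟦X⟧ where
  carrier := {f | MemBreuil p E f}
  mul_mem' := memBreuil_mul
  add_mem' := memBreuil_add
  algebraMap_mem' := memBreuil_algebraMap

/-- The ring `S_{𝒪_E}` as a type. -/
def BreuilRing : Type _ := breuilSubalgebra p E

instance : CommRing (BreuilRing p E) := inferInstanceAs (CommRing (breuilSubalgebra p E))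

instance : Algebra (OE p E) (BreuilRing p E) :=
  inferInstanceAs (Algebra (OE p E) (breuilSubalgebra p E))

variable {p E}

theorem monomial_mem_breuil (k n : ℕ) (hk : k ≤ n / (p - 1)) :
    PowerSeries.monomial n ((k.factorial : E)⁻¹) ∈ breuilSubalgebra p E := by
  have := charZero_E p E
  refine memBreuil_of_zero
    (fun m => if m = n then (((n / (p - 1)).factorial / k.factorial : ℕ) : OE p E) else 0) (n + 1)
    (fun m hm => if_neg (by omega)) fun m => ?_
  rw [PowerSeries.coeff_monomial]
  by_cases h : m = n
  · subst h
    rw [if_pos rfl, if_pos rfl]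
    rw [SubringClass.coe_natCast, Nat.cast_div (Nat.factorial_dvd_factorial hk)
      (Nat.cast_ne_zero.mpr k.factorial_ne_zero), div_eq_mul_inv]
  · simp [h]

variable (p E) in
/-- The variable `u` of the Breuil ring. -/
def uS : BreuilRing p E :=
  ⟨PowerSeries.X, by
    have := monomial_mem_breuil (p := p) (E := E) 0 1 (Nat.zero_le _)
    simpa [PowerSeries.X_eq] using this⟩

variable (p E) in
/-- The Eisenstein polynomial `E(u) = u^(p-1) + p` as an element of the Breuil ring. -/
def eisS : BreuilRing p E := uS p E ^ (p - 1) + (p : BreuilRing p E)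

/-- `p ^ m / m!` lies in `ℤ_p`. -/
theorem exists_pow_div_factorial (p : ℕ) [Fact p.Prime] (m : ℕ) :
    ∃ c : ℤ_[p], (m.factorial : ℤ_[p]) * c = (p : ℤ_[p]) ^ m :=
  ⟨_, (PadicInt.dividedPowers p).factorial_mul_dpow_eq_pow
    (Ideal.mem_span_singleton_self (p : ℤ_[p]))⟩

theorem dpE_mem (j : ℕ) :
    PowerSeries.C ((j.factorial : E)⁻¹) * (PowerSeries.X ^ (p - 1) + (p : E⟦X⟧)) ^ j ∈
      breuilSubalgebra p E := by
  have := charZero_E p E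
  have he : 0 < p - 1 := Nat.sub_pos_of_lt hp.out.one_lt
  rw [add_pow, Finset.mul_sum]
  refine Subalgebra.sum_mem _ fun k hk => ?_
  have hkj : k ≤ j := Nat.lt_succ_iff.mp (Finset.mem_range.mp hk)
  obtain ⟨c, hc⟩ := exists_pow_div_factorial p (j - k)
  have hc' : ((j - k).factorial : E) * algebraMap ℤ_[p] E c = (p : E) ^ (j - k) := by
    have := congrArg (algebraMap ℤ_[p] E) hc
    simpa using this
  have hm := Subalgebra.smul_mem _ (monomial_mem_breuil (p := p) (E := E) k ((p - 1) * k)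
    (by rw [Nat.mul_div_cancel_left _ he])) (algebraMap ℤ_[p] (OE p E) c)
  convert hm using 1
  have hch : (j.factorial : E) = (j.choose k : E) * k.factorial * (j - k).factorial := by
    exact_mod_cast (Nat.choose_mul_factorial_mul_factorial hkj).symm
  have h1 : (j.choose k : E) ≠ 0 := by exact_mod_cast (Nat.choose_pos hkj).ne'
  have h2 : (k.factorial : E) ≠ 0 := by exact_mod_cast k.factorial_ne_zero
  have h3 : ((j - k).factorial : E) ≠ 0 := by exact_mod_cast (j - k).factorial_ne_zero
  have hcast : ((p : E⟦X⟧) ^ (j - k) * (j.choose k : E⟦X⟧)) =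
      PowerSeries.C ((p : E) ^ (j - k) * (j.choose k : E)) := by simp
  rw [mul_assoc ((PowerSeries.X ^ (p - 1)) ^ k : E⟦X⟧), hcast, ← pow_mul]
  ext n
  rw [PowerSeries.coeff_C_mul, PowerSeries.coeff_mul_C, PowerSeries.coeff_X_pow,
    show (algebraMap ℤ_[p] (OE p E) c • PowerSeries.monomial ((p - 1) * k) ((k.factorial : E)⁻¹))
      = PowerSeries.C (algebraMap ℤ_[p] E c) *
        PowerSeries.monomial ((p - 1) * k) ((k.factorial : E)⁻¹) by
      rw [← PowerSeries.smul_eq_C_mul]; rfl,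
    PowerSeries.coeff_C_mul, PowerSeries.coeff_monomial, ← hc', hch]
  split_ifs
  · field_simp
  · simp

variable (p E) in
/-- The divided power `E(u)^j / j!` in the Breuil ring. -/
def dpE (j : ℕ) : BreuilRing p E :=
  ⟨PowerSeries.C ((j.factorial : E)⁻¹) * (PowerSeries.X ^ (p - 1) + (p : E⟦X⟧)) ^ j, dpE_mem j⟩

variable (p E) in
/-- `Filⁱ S`: the `p`-adic closure of the ideal generated by the `E(u)^j / j!` with `j ≥ i`. -/
def filS (i : ℕ) : Ideal (BreuilRing p E) :=
  ⨅ n : ℕ, Ideal.span {x | ∃ j, i ≤ j ∧ x = dpE p E j} ⊔ Ideal.span {(p : BreuilRing p E) ^ n}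

theorem expand_mem {f : E⟦X⟧} (hf : f ∈ breuilSubalgebra p E) :
    PowerSeries.expand p hp.out.ne_zero f ∈ breuilSubalgebra p E := by
  obtain ⟨a, ha, hfa⟩ : MemBreuil p E f := hf
  have hp0 := hp.out.pos
  refine ⟨fun n => if p ∣ n then
    (((n / (p - 1)).factorial / (n / p / (p - 1)).factorial : ℕ) : OE p E) * a (n / p) else 0,
    fun k => ?_, fun n => ?_⟩
  · obtain ⟨N, hN⟩ := Filter.eventually_atTop.mp (ha k)
    refine Filter.eventually_atTop.mpr ⟨p * N, fun n hn => ?_⟩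
    dsimp only
    split_ifs
    · exact Dvd.dvd.mul_left (hN _ ((Nat.le_div_iff_mul_le hp0).mpr (by rwa [mul_comm]))) _
    · exact dvd_zero _
  · have := charZero_E p E
    rw [PowerSeries.coeff_expand]
    split_ifs with h
    · have hd := Nat.factorial_dvd_factorial
        (Nat.div_le_div_right (c := p - 1) (Nat.div_le_self n p))
      have hne : (((n / p / (p - 1)).factorial : ℕ) : E) ≠ 0 := by
        exact Nat.cast_ne_zero.mpr (Nat.factorial_ne_zero _)
      dsimp only
      rw [if_pos h, MulMemClass.coe_mul, SubringClass.coe_natCast, ← hfa, Nat.cast_div hd hne]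
      field_simp
    · simp [h]

variable (p E) in
/-- The Frobenius `φ` of `S_{𝒪_E}`: `𝒪_E`-linear, `φ(u) = u^p`. -/
def frobS : BreuilRing p E →+* BreuilRing p E :=
  ((PowerSeries.expand p hp.out.ne_zero : E⟦X⟧ →ₐ[E] E⟦X⟧).toRingHom.comp
    (breuilSubalgebra p E).val.toRingHom).codRestrict (breuilSubalgebra p E) fun f => expand_mem f.2

theorem rescale_mem (z : ℤ_[p]ˣ) {f : E⟦X⟧} (hf : f ∈ breuilSubalgebra p E) :
    PowerSeries.rescale (algebraMap ℤ_[p] E z) f ∈ breuilSubalgebra p E := by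
  obtain ⟨a, ha, hfa⟩ : MemBreuil p E f := hf
  refine ⟨fun n => algebraMap ℤ_[p] (OE p E) z ^ n * a n, fun k => ?_, fun n => ?_⟩
  · filter_upwards [ha k] with n hn using Dvd.dvd.mul_left hn _
  · rw [PowerSeries.coeff_rescale, mul_left_comm, hfa]
    rfl

/-- The `𝒪_E`-linear endomorphism `u ↦ z u` of `S_{𝒪_E}`, for `z ∈ ℤ_pˣ`; an element `g` of the
Galois group acts on `S_{𝒪_E}` through `z = ω̃_π(g)`. -/
def scaleS (z : ℤ_[p]ˣ) : BreuilRing p E →+* BreuilRing p E :=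
  ((PowerSeries.rescale (algebraMap ℤ_[p] E z)).comp
    (breuilSubalgebra p E).val.toRingHom).codRestrict (breuilSubalgebra p E) fun f => rescale_mem z f.2

end BreuilRing

/-! ## Quasi-strongly divisible modules with tame descent data -/

/-- A quasi-strongly divisible `𝒪_E`-module in weights `[0, r]` with descent data from
`K = ℚ_p(π)` to `ℚ_p`, with underlying `S_{𝒪_E}`-module `M` (no monodromy operator). -/
structure QuasiStronglyDivisible {p : ℕ} [Fact p.Prime] (E : Type*) [Field E] [Algebra ℚ_[p] E]
    [Algebra ℤ_[p] E] {K : Type*} [Field K] [Algebra ℚ_[p] K] {π : K}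
    (hπ : IsTameUniformizer p π) (r : ℕ) (M : Type*) [AddCommGroup M]
    [Module (BreuilRing p E) M] where
  free : Module.Free (BreuilRing p E) M
  finite : Module.Finite (BreuilRing p E) M
  /-- the submodule `Filʳ M` -/
  fil : Submodule (BreuilRing p E) M
  filS_smul_le : filS p E r • (⊤ : Submodule (BreuilRing p E) M) ≤ fil
  /-- `Filʳ M ∩ I M = I Filʳ M` for all ideals `I` of `𝒪_E` -/
  fil_inf_smul : ∀ I : Ideal (OE p E),
    fil ⊓ I.map (algebraMap (OE p E) (BreuilRing p E)) • (⊤ : Submodule (BreuilRing p E) M) =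
      I.map (algebraMap (OE p E) (BreuilRing p E)) • fil
  /-- the map `φ_r : Filʳ M → M` -/
  phi : fil →+ M
  phi_smul : ∀ (s : BreuilRing p E) (x : fil), phi (s • x) = frobS p E s • phi x
  span_range_phi : Submodule.span (BreuilRing p E) (Set.range phi) = ⊤
  /-- the descent datum `g ↦ ĝ` -/
  desc : (K ≃ₐ[ℚ_[p]] K) → M ≃+ M
  desc_smul : ∀ g (s : BreuilRing p E) (x : M),
    desc g (s • x) = scaleS (omegaTilde hπ g) s • desc g x
  desc_mul : ∀ g h (x : M), desc (g * h) x = desc g (desc h x)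
  desc_mem_fil : ∀ g (x : M), x ∈ fil → desc g x ∈ fil
  phi_desc : ∀ g (x : fil), phi ⟨desc g x, desc_mem_fil g x x.2⟩ = desc g (phi x)

namespace QuasiStronglyDivisible

variable {p : ℕ} [Fact p.Prime] {E : Type*} [Field E] [Algebra ℚ_[p] E]
    [Algebra ℤ_[p] E] {K : Type*} [Field K] [Algebra ℚ_[p] K] {π : K}
    {hπ : IsTameUniformizer p π} {r : ℕ} {M : Type*} [AddCommGroup M]
    [Module (BreuilRing p E) M]

/-- The family `x` in `M` is compatible with the framing `ω̃^{a_0} ⊕ ω̃^{a_1} ⊕ …`: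
`ĝ(x_i) = ω̃(g)^{a_i} x_i` for all `g` and `i`. -/
def IsFramed (𝓜 : QuasiStronglyDivisible E hπ r M) {n : ℕ} (a : Fin n → ℕ) (x : Fin n → M) :
    Prop :=
  ∀ (g : K ≃ₐ[ℚ_[p]] K) (i : Fin n),
    𝓜.desc g (x i) = algebraMap (OE p E) (BreuilRing p E)
      (algebraMap ℤ_[p] (OE p E) ((omegaTilde hπ g ^ a i : ℤ_[p]ˣ) : ℤ_[p])) • x i

/-- The classes of the elements `f_i` generate `Filʳ M / (Fil^p S · M)`. -/
def GeneratesFil (𝓜 : QuasiStronglyDivisible E hπ r M) {n : ℕ} (f : Fin n → M) : Prop :=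
  Submodule.span (BreuilRing p E) (Set.range f) ⊔
    filS p E p • (⊤ : Submodule (BreuilRing p E) M) = 𝓜.fil

end QuasiStronglyDivisible

/-- Strong genericity: `a_1 - a_0 > 3`, `a_2 - a_1 > 3` and `a_2 - a_0 < p - 4`. -/
def StronglyGeneric (p : ℕ) (a : Fin 3 → ℕ) : Prop :=
  (a 1 : ℤ) - a 0 > 3 ∧ (a 2 : ℤ) - a 1 > 3 ∧ (a 2 : ℤ) - a 0 < (p : ℤ) - 4

end

end Breuil

/-! The statement is a fixed point problem for a framed change of basis matrix `X`. Write `H =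
diag(1, E(u), E(u)²)`, and let `N(v)` be the lower unipotent matrix with reduced entries. The new
basis is `e X` and the new generators are `e X N(v) H`. They lie in `Fil² M` and generate it modulo
`Fil^p S · M` as soon as `X N(v) H = H B + R` with `B` invertible and `R` in `Fil^p S`. Applying
`φ₂` to the columns of `H B + R` gives a matrix `Ψ(B, R)`, and the theorem asks for `Ψ(B, R) = X
diag(λ)`. Rescaling the columns by the inverse constant terms of the diagonal of `X` turns this into
a fixed point equation for `X`, with `λ_j` the constant term of `X j j`.

Descent data become a grading: since `ω̃` has order exactly `p - 1`, a matrix between framed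
families has its `(i, j)` entry in exponents congruent to `a j - a i` modulo `p - 1`. In degree zero
an element with unit constant term is invertible, which makes framed matrices with unit diagonal
constant terms invertible. Moreover any `t` of degree zero is `c₀ + c₁ E(u) + E(u)² t' + r` with `r`
in `Fil^p S` (`exists_division`). This lets `v` and `B` be solved for (`exists_params`).

Convergence is measured by the ideals `(p^k, p^(k-1) E(u)³)`. If `X` moves within the `k`-th one,
division by at most `E(u)²` moves the off-diagonal entries of `B` by `p^k t + p^(k-1) E(u) s`. The
lost power of `p` is recovered because `p` divides `φ(E(u))`. A further step is gained because, by
strong genericity, these entries are multiples of `u^b` with `b ≥ 3`, and `φ(u^b)` is a multiple of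
`u^(3(p-1)) = (E(u) - p)³`, which lies in `(p, E(u)³)`. On the diagonal the rescaling fixes the
constant terms, and `φ` is the constant term modulo `p` in degree zero. Finally `φ₂(Fil^p S · M)`
lies in `p M`. So each step improves `k` to `k + 1` (`IsStep.exists_next`), and the limit is the
required `X` (`exists_fixed_reduction`). -/

namespace Breuil

noncomputable section

/-! ## `p`-adically complete rings -/

/-- `R` is separated and complete for the `p`-adic topology. -/
structure IsPComplete (p : ℕ) (R : Type*) [CommRing R] : Prop where
  eq_zero : ∀ x : R, (∀ n, (p : R) ^ n ∣ x) → x = 0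
  exists_lim : ∀ f : ℕ → R, (∀ n, (p : R) ^ n ∣ f (n + 1) - f n) →
    ∃ L, ∀ n, (p : R) ^ n ∣ L - f n

namespace IsPComplete

variable {p : ℕ} {R : Type*} [CommRing R]

theorem eq_of_dvd_sub (h : IsPComplete p R) {x y : R} (hxy : ∀ n, (p : R) ^ n ∣ x - y) : x = y :=
  sub_eq_zero.mp (h.eq_zero _ hxy)

/-- The sum `∑ pⁱ fᵢ` exists. -/
theorem exists_sum (h : IsPComplete p R) (f : ℕ → R) :
    ∃ L, ∀ n, (p : R) ^ n ∣ L - ∑ i ∈ Finset.range n, (p : R) ^ i * f i :=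
  h.exists_lim (fun n => ∑ i ∈ Finset.range n, (p : R) ^ i * f i) fun n => by
    rw [Finset.sum_range_succ, add_sub_cancel_left]
    exact dvd_mul_right _ _

theorem isUnit_one_sub (h : IsPComplete p R) (w : R) : IsUnit (1 - p * w) := by
  obtain ⟨L, hL⟩ := h.exists_sum fun i => w ^ i
  refine IsUnit.of_mul_eq_one L (h.eq_of_dvd_sub fun n => ?_)
  have h1 : (1 - p * w) * ∑ i ∈ Finset.range n, (p : R) ^ i * w ^ i = 1 - (p : R) ^ n * w ^ n := by
    simp_rw [← mul_pow]
    exact mul_neg_geom_sum _ _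
  have h2 : (1 - p * w) * L - 1 = (1 - p * w) * (L - ∑ i ∈ Finset.range n, (p : R) ^ i * w ^ i)
      - (p : R) ^ n * w ^ n := by
    rw [mul_sub, h1]; ring
  rw [h2]
  exact dvd_sub (Dvd.dvd.mul_left (hL n) _) (dvd_mul_right _ _)

theorem isUnit_of_dvd_sub_one (h : IsPComplete p R) {x : R} (hx : (p : R) ∣ x - 1) : IsUnit x := by
  obtain ⟨w, hw⟩ := hx
  have := h.isUnit_one_sub (-w)
  rwa [mul_neg, sub_neg_eq_add, ← hw, add_sub_cancel] at this

theorem isUnit_of_dvd_sub (h : IsPComplete p R) {x y : R} (hx : IsUnit x) (hy : (p : R) ∣ y - x) :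
    IsUnit y := by
  obtain ⟨z, hz⟩ := hx.exists_right_inv
  have : IsUnit (y * z) := h.isUnit_of_dvd_sub_one (by
    rw [← hz, ← sub_mul]; exact Dvd.dvd.mul_right hy _)
  exact isUnit_of_mul_isUnit_left this

end IsPComplete

theorem isPComplete_padicInt (p : ℕ) [Fact p.Prime] : IsPComplete p ℤ_[p] where
  eq_zero x hx := by
    by_contra h
    have h1 := PadicInt.unitCoeff_spec h
    have h2 := hx (x.valuation + 1)
    generalize x.valuation = n at h1 h2
    rw [h1, (Units.isUnit (PadicInt.unitCoeff h)).dvd_mul_left,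
      pow_dvd_pow_iff (PadicInt.prime_p (p := p)).ne_zero
        (PadicInt.prime_p (p := p)).not_isUnit] at h2
    omega
  exists_lim f hf := by
    have hmono : ∀ m n, m ≤ n → (p : ℤ_[p]) ^ m ∣ f n - f m := fun m n hmn => by
      induction n, hmn using Nat.le_induction with
      | base => simp
      | succ n hmn ih =>
        rw [← sub_add_sub_cancel]
        exact dvd_add ((pow_dvd_pow _ hmn).trans (hf n)) ih
    have := (inferInstance : IsAdicComplete (IsLocalRing.maximalIdeal ℤ_[p]) ℤ_[p]).prec' f
      (fun {m n} hmn => by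
        rw [SModEq.sub_mem, smul_eq_mul, Ideal.mul_top, PadicInt.maximalIdeal_eq_span_p,
          Ideal.span_singleton_pow, Ideal.mem_span_singleton, ← neg_sub, dvd_neg]
        exact hmono m n hmn)
    obtain ⟨L, hL⟩ := this
    refine ⟨L, fun n => ?_⟩
    have := hL n
    rwa [SModEq.sub_mem, smul_eq_mul, Ideal.mul_top, PadicInt.maximalIdeal_eq_span_p,
          Ideal.span_singleton_pow, Ideal.mem_span_singleton, ← neg_sub, dvd_neg] at this

/-- Divisibility by `p ^ n` is tested on coordinates, so limits are taken coordinatewise. -/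
theorem IsPComplete.of_basis {p : ℕ} {R A ι : Type*} [CommRing R] [CommRing A] [Algebra R A]
    [Fintype ι] (b : Module.Basis ι R A) (h : IsPComplete p R) : IsPComplete p A := by
  have key : ∀ (n : ℕ) (x : A), (p : A) ^ n ∣ x ↔ ∀ i, (p : R) ^ n ∣ b.repr x i := by
    intro n x
    constructor
    · rintro ⟨y, rfl⟩ i
      have : (p : A) ^ n * y = ((p : R) ^ n) • y := by
        rw [Algebra.smul_def]; simp
      rw [this, map_smul, Finsupp.smul_apply, smul_eq_mul]
      exact dvd_mul_right _ _
    · intro hx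
      choose c hc using hx
      refine ⟨∑ i, c i • b i, ?_⟩
      conv_lhs => rw [← b.sum_repr x]
      rw [Finset.mul_sum]
      refine Finset.sum_congr rfl fun i _ => ?_
      rw [hc i, mul_smul, Algebra.smul_def ((p : R) ^ n)]
      simp
  refine ⟨fun x hx => ?_, fun f hf => ?_⟩
  · refine b.repr.map_eq_zero_iff.mp (Finsupp.ext fun i => ?_)
    exact h.eq_zero _ fun n => (key n x).mp (hx n) i
  · have : ∀ i, ∃ L, ∀ n, (p : R) ^ n ∣ L - b.repr (f n) i := fun i =>
      h.exists_lim (fun n => b.repr (f n) i) fun n => by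
        have := (key n _).mp (hf n) i
        rwa [map_sub, Finsupp.sub_apply] at this
    choose L hL using this
    refine ⟨∑ i, L i • b i, fun n => (key n _).mpr fun i => ?_⟩
    rw [map_sub, Finsupp.sub_apply, b.repr_sum_self]
    exact hL i n

theorem isPComplete_OE (p : ℕ) [Fact p.Prime] (E : Type*) [Field E] [Algebra ℚ_[p] E]
    [FiniteDimensional ℚ_[p] E] [Algebra ℤ_[p] E] [IsScalarTower ℤ_[p] ℚ_[p] E] :
    IsPComplete p (OE p E) := by
  have : Module.IsTorsionFree ℤ_[p] E := .trans_faithfulSMul ℤ_[p] ℚ_[p] E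
  have := IsIntegralClosure.module_free ℤ_[p] ℚ_[p] E (integralClosure ℤ_[p] E)
  have := IsIntegralClosure.finite ℤ_[p] ℚ_[p] E (integralClosure ℤ_[p] E)
  exact .of_basis (Module.Free.chooseBasis ℤ_[p] (OE p E)) (isPComplete_padicInt p)

/-! ## Coefficients in the Breuil ring -/

section Coefficients

variable {p : ℕ} [hp : Fact p.Prime] {E : Type*} [Field E] [Algebra ℚ_[p] E] [Algebra ℤ_[p] E]

theorem one_le_sub_one (p : ℕ) [hp : Fact p.Prime] : 0 < p - 1 :=
  Nat.sub_pos_of_lt hp.out.one_lt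

theorem charZero_OE (p : ℕ) [Fact p.Prime] (E : Type*) [Field E] [Algebra ℚ_[p] E]
    [Algebra ℤ_[p] E] : CharZero (OE p E) :=
  have := charZero_E p E
  ⟨fun m n h => by
    have := congrArg (Subtype.val : OE p E → E) h
    exact_mod_cast this⟩

/-- The inclusion of the Breuil ring into `E⟦u⟧`. -/
def toPS : BreuilRing p E →+* E⟦X⟧ := (breuilSubalgebra p E).val.toRingHom

theorem toPS_injective : Function.Injective (toPS (p := p) (E := E)) := Subtype.val_injective

theorem toPS_mem (s : BreuilRing p E) : MemBreuil p E (toPS s) := s.2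

theorem toPS_uS : toPS (uS p E) = PowerSeries.X := rfl

theorem toPS_algebraMap (c : OE p E) :
    toPS (algebraMap (OE p E) (BreuilRing p E) c) = PowerSeries.C (c : E) := rfl

theorem toPS_frobS (s : BreuilRing p E) :
    toPS (frobS p E s) = PowerSeries.expand p hp.out.ne_zero (toPS s) := rfl

theorem toPS_scaleS (z : ℤ_[p]ˣ) (s : BreuilRing p E) :
    toPS (scaleS z s) = PowerSeries.rescale (algebraMap ℤ_[p] E z) (toPS s) := rfl

theorem toPS_dpE (j : ℕ) : toPS (dpE p E j) =
    PowerSeries.C ((j.factorial : E)⁻¹) * (PowerSeries.X ^ (p - 1) + (p : E⟦X⟧)) ^ j := rfl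

theorem toPS_eisS : toPS (eisS p E) = PowerSeries.X ^ (p - 1) + (p : E⟦X⟧) := by
  rw [eisS, map_add, map_pow, toPS_uS, map_natCast]

instance : IsDomain (BreuilRing p E) := inferInstanceAs (IsDomain (breuilSubalgebra p E))

theorem charZero_breuilRing (p : ℕ) [Fact p.Prime] (E : Type*) [Field E] [Algebra ℚ_[p] E]
    [Algebra ℤ_[p] E] : CharZero (BreuilRing p E) := by
  have := charZero_E p E
  have : CharZero E⟦X⟧ := charZero_of_injective_algebraMap
    (R := E) (A := E⟦X⟧) PowerSeries.C_injective
  refine ⟨fun m n h => ?_⟩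
  have := congrArg toPS h
  rw [map_natCast, map_natCast] at this
  exact_mod_cast this

/-- The numerators `aₙ ∈ 𝒪_E` of `∑ aₙ uⁿ / ⌊n/e⌋!`. -/
def cf (n : ℕ) (s : BreuilRing p E) : OE p E :=
  ⟨((n / (p - 1)).factorial : E) * PowerSeries.coeff n (toPS s), by
    obtain ⟨a, -, h⟩ := toPS_mem s
    rw [h]; exact (a n).2⟩

theorem coe_cf (n : ℕ) (s : BreuilRing p E) :
    (cf n s : E) = ((n / (p - 1)).factorial : E) * PowerSeries.coeff n (toPS s) := rfl

theorem coeff_eq_cf (n : ℕ) (s : BreuilRing p E) :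
    PowerSeries.coeff n (toPS s) = ((n / (p - 1)).factorial : E)⁻¹ * cf n s := by
  have := charZero_E p E
  rw [coe_cf, inv_mul_cancel_left₀ (Nat.cast_ne_zero.mpr (Nat.factorial_ne_zero _))]

theorem ext_cf {s t : BreuilRing p E} (h : ∀ n, cf n s = cf n t) : s = t :=
  toPS_injective (PowerSeries.ext fun n => by rw [coeff_eq_cf, coeff_eq_cf, h])

theorem cf_add (n : ℕ) (s t : BreuilRing p E) : cf n (s + t) = cf n s + cf n t := by
  apply Subtype.ext
  push_cast
  simp only [coe_cf, map_add]; ring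

theorem cf_sub (n : ℕ) (s t : BreuilRing p E) : cf n (s - t) = cf n s - cf n t := by
  apply Subtype.ext
  push_cast
  simp only [coe_cf, map_sub]; ring

theorem cf_zero (n : ℕ) : cf n (0 : BreuilRing p E) = 0 := by
  apply Subtype.ext
  simp [coe_cf]

theorem cf_sum {ι : Type*} (I : Finset ι) (n : ℕ) (s : ι → BreuilRing p E) :
    cf n (∑ i ∈ I, s i) = ∑ i ∈ I, cf n (s i) := by
  classical
  induction I using Finset.induction_on with
  | empty => simp [cf_zero]
  | insert i I hi ih => rw [Finset.sum_insert hi, Finset.sum_insert hi, cf_add, ih]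

theorem cf_algebraMap_mul (n : ℕ) (c : OE p E) (s : BreuilRing p E) :
    cf n (algebraMap (OE p E) (BreuilRing p E) c * s) = c * cf n s := by
  apply Subtype.ext
  push_cast
  simp only [coe_cf, map_mul, toPS_algebraMap, PowerSeries.coeff_C_mul]; ring

theorem cf_p_pow_mul (n k : ℕ) (s : BreuilRing p E) :
    cf n ((p : BreuilRing p E) ^ k * s) = (p : OE p E) ^ k * cf n s := by
  have := cf_algebraMap_mul n ((p : OE p E) ^ k) s
  rwa [map_pow (algebraMap (OE p E) (BreuilRing p E)),
    map_natCast (algebraMap (OE p E) (BreuilRing p E))] at this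

theorem eventually_dvd_cf (s : BreuilRing p E) (k : ℕ) :
    ∀ᶠ n in Filter.atTop, (p : OE p E) ^ k ∣ cf n s := by
  obtain ⟨a, ha, h⟩ := toPS_mem s
  filter_upwards [ha k] with n hn
  rwa [show cf n s = a n from Subtype.ext (h n)]

/-- The element `∑ aₙ uⁿ / ⌊n/e⌋!` of the Breuil ring. -/
def ofCf (a : ℕ → OE p E) (ha : ∀ k : ℕ, ∀ᶠ n in Filter.atTop, (p : OE p E) ^ k ∣ a n) :
    BreuilRing p E :=
  ⟨PowerSeries.mk fun n => ((n / (p - 1)).factorial : E)⁻¹ * a n, a, ha, fun n => by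
    have := charZero_E p E
    rw [PowerSeries.coeff_mk,
      mul_inv_cancel_left₀ (Nat.cast_ne_zero.mpr (Nat.factorial_ne_zero _))]⟩

theorem cf_ofCf (a : ℕ → OE p E) (ha : ∀ k : ℕ, ∀ᶠ n in Filter.atTop, (p : OE p E) ^ k ∣ a n)
    (n : ℕ) : cf n (ofCf a ha) = a n := by
  have := charZero_E p E
  apply Subtype.ext
  rw [coe_cf]
  change ((n / (p - 1)).factorial : E) * PowerSeries.coeff n (PowerSeries.mk
    fun n => ((n / (p - 1)).factorial : E)⁻¹ * (a n : E)) = _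
  rw [PowerSeries.coeff_mk, mul_inv_cancel_left₀ (Nat.cast_ne_zero.mpr (Nat.factorial_ne_zero _))]

theorem exists_cf_eq (a : ℕ → OE p E)
    (ha : ∀ k : ℕ, ∀ᶠ n in Filter.atTop, (p : OE p E) ^ k ∣ a n) :
    ∃ s : BreuilRing p E, ∀ n, cf n s = a n := ⟨ofCf a ha, cf_ofCf a ha⟩

theorem p_pow_ne_zero_OE (p : ℕ) [hp : Fact p.Prime] (E : Type*) [Field E] [Algebra ℚ_[p] E]
    [Algebra ℤ_[p] E] (k : ℕ) : (p : OE p E) ^ k ≠ 0 :=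
  have := charZero_OE p E
  pow_ne_zero _ (Nat.cast_ne_zero.mpr hp.out.ne_zero)

/-- The divided numerators still tend to zero, since those of `s` are eventually divisible by `p ^
(k + m)` for every `m`. This reduces `p`-adic questions in `S` to questions in `𝒪_E`. -/
theorem p_pow_dvd_iff (k : ℕ) (s : BreuilRing p E) :
    (p : BreuilRing p E) ^ k ∣ s ↔ ∀ n, (p : OE p E) ^ k ∣ cf n s := by
  refine ⟨?_, fun h => ?_⟩
  · rintro ⟨t, rfl⟩ n
    rw [cf_p_pow_mul]; exact dvd_mul_right _ _
  · choose c hc using h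
    obtain ⟨t, ht⟩ := exists_cf_eq c fun m => by
      filter_upwards [eventually_dvd_cf s (k + m)] with n hn
      rw [hc, pow_add] at hn
      exact (mul_dvd_mul_iff_left (p_pow_ne_zero_OE p E k)).mp hn
    exact ⟨t, ext_cf fun n => by rw [cf_p_pow_mul, ht, hc]⟩

theorem p_dvd_iff (s : BreuilRing p E) :
    (p : BreuilRing p E) ∣ s ↔ ∀ n, (p : OE p E) ∣ cf n s := by
  have := p_pow_dvd_iff 1 s
  simpa using this

theorem isPComplete_breuilRing (h : IsPComplete p (OE p E)) : IsPComplete p (BreuilRing p E) where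
  eq_zero x hx := ext_cf fun n => by
    rw [cf_zero]
    exact h.eq_zero _ fun k => (p_pow_dvd_iff k x).mp (hx k) n
  exists_lim f hf := by
    have : ∀ m, ∃ L, ∀ n, (p : OE p E) ^ n ∣ L - cf m (f n) := fun m =>
      h.exists_lim (fun n => cf m (f n)) fun n => by
        rw [← cf_sub]; exact (p_pow_dvd_iff n _).mp (hf n) m
    -- The limit numerators tend to zero: modulo `p ^ k` they agree with those of the single element
    -- `f k`.
    choose L hL using this
    obtain ⟨t, ht⟩ := exists_cf_eq L fun k => by
      filter_upwards [eventually_dvd_cf (f k) k] with m hm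
      simpa using dvd_add (hL m k) hm
    exact ⟨t, fun n => (p_pow_dvd_iff n _).mpr fun m => by rw [cf_sub, ht]; exact hL m n⟩

/-- The constant term of an element of the Breuil ring. -/
def ct : BreuilRing p E →+* OE p E where
  toFun := cf 0
  map_one' := Subtype.ext (by simp [coe_cf])
  map_mul' s t := Subtype.ext (by push_cast; simp [coe_cf])
  map_zero' := cf_zero 0
  map_add' := cf_add 0

theorem ct_apply (s : BreuilRing p E) : ct s = cf 0 s := rfl

theorem ct_algebraMap (c : OE p E) : ct (algebraMap _ (BreuilRing p E) c) = c :=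
  Subtype.ext (by simp [ct_apply, coe_cf, toPS_algebraMap])

theorem ct_uS : ct (uS p E) = 0 :=
  Subtype.ext (by simp [ct_apply, coe_cf, toPS_uS])

theorem ct_eisS : ct (eisS p E) = p := by
  rw [eisS, map_add, map_pow, ct_uS, zero_pow (one_le_sub_one p).ne', zero_add, map_natCast]

theorem p_pow_dvd_ct {k : ℕ} {s : BreuilRing p E} (h : (p : BreuilRing p E) ^ k ∣ s) :
    (p : OE p E) ^ k ∣ ct s := (p_pow_dvd_iff k s).mp h 0

/-! ## The grading of the Breuil ring by `ℤ/(p-1)` -/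

/-- The elements with exponents congruent to `k` modulo `p - 1`. -/
def Gr (k : ZMod (p - 1)) : AddSubgroup (BreuilRing p E) where
  carrier := {s | ∀ n : ℕ, (n : ZMod (p - 1)) ≠ k → PowerSeries.coeff n (toPS s) = 0}
  zero_mem' n _ := by simp
  add_mem' hs ht n hn := by rw [map_add, map_add, hs n hn, ht n hn, add_zero]
  neg_mem' hs n hn := by rw [map_neg, map_neg, hs n hn, neg_zero]

theorem mem_Gr_iff_cf {k : ZMod (p - 1)} {s : BreuilRing p E} :
    s ∈ Gr k ↔ ∀ n : ℕ, (n : ZMod (p - 1)) ≠ k → cf n s = 0 := by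
  have := charZero_E p E
  refine forall₂_congr fun n _ => ?_
  rw [← ZeroMemClass.coe_eq_zero, coe_cf, mul_eq_zero,
    or_iff_right (Nat.cast_ne_zero.mpr (Nat.factorial_ne_zero _))]

theorem Gr_mul {k l : ZMod (p - 1)} {s t : BreuilRing p E} (hs : s ∈ Gr k) (ht : t ∈ Gr l) :
    s * t ∈ Gr (k + l) := fun n hn => by
  rw [map_mul, PowerSeries.coeff_mul]
  refine Finset.sum_eq_zero fun x hx => ?_
  rw [Finset.HasAntidiagonal.mem_antidiagonal] at hx
  by_cases h : (x.1 : ZMod (p - 1)) = k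
  · rw [ht x.2 fun h2 => hn (by rw [← hx, Nat.cast_add, h, h2]), mul_zero]
  · rw [hs x.1 h, zero_mul]

theorem Gr_mul_left {k : ZMod (p - 1)} {s t : BreuilRing p E} (hs : s ∈ Gr 0) (ht : t ∈ Gr k) :
    s * t ∈ Gr k := by simpa using Gr_mul hs ht

theorem Gr_mul_right {k : ZMod (p - 1)} {s t : BreuilRing p E} (hs : s ∈ Gr k) (ht : t ∈ Gr 0) :
    s * t ∈ Gr k := by simpa using Gr_mul hs ht

theorem Gr_algebraMap (c : OE p E) : algebraMap _ (BreuilRing p E) c ∈ Gr 0 := fun n hn => by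
  rw [toPS_algebraMap, PowerSeries.coeff_C, if_neg]
  rintro rfl
  exact hn (by simp)

theorem Gr_one : (1 : BreuilRing p E) ∈ Gr 0 := by
  simpa using Gr_algebraMap (p := p) (E := E) 1

theorem Gr_natCast (m : ℕ) : (m : BreuilRing p E) ∈ Gr 0 := by
  simpa using Gr_algebraMap (p := p) (E := E) m

theorem Gr_pow {s : BreuilRing p E} (hs : s ∈ Gr 0) (m : ℕ) : s ^ m ∈ Gr 0 := by
  induction m with
  | zero => simpa using Gr_one
  | succ m ih => rw [pow_succ]; exact Gr_mul_left ih hs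

theorem Gr_uS_pow (m : ℕ) : uS p E ^ m ∈ Gr (m : ZMod (p - 1)) := fun n hn => by
  rw [map_pow, toPS_uS, PowerSeries.coeff_X_pow, if_neg]
  rintro rfl
  exact hn rfl

theorem Gr_eisS : eisS p E ∈ Gr 0 :=
  add_mem (by simpa using Gr_uS_pow (p := p) (E := E) (p - 1)) (Gr_natCast p)

theorem ct_eq_zero_of_mem_Gr {k : ZMod (p - 1)} (hk : k ≠ 0) {s : BreuilRing p E}
    (hs : s ∈ Gr k) : ct s = 0 :=
  mem_Gr_iff_cf.mp hs 0 (by simpa using hk.symm)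

/-- The projection onto a graded piece. -/
def proj (k : ZMod (p - 1)) (s : BreuilRing p E) : BreuilRing p E :=
  ofCf (fun n => if (n : ZMod (p - 1)) = k then cf n s else 0) fun m => by
    filter_upwards [eventually_dvd_cf s m] with n hn
    split_ifs
    exacts [hn, dvd_zero _]

theorem cf_proj (k : ZMod (p - 1)) (s : BreuilRing p E) (n : ℕ) :
    cf n (proj k s) = if (n : ZMod (p - 1)) = k then cf n s else 0 := cf_ofCf _ _ n

theorem proj_mem (k : ZMod (p - 1)) (s : BreuilRing p E) : proj k s ∈ Gr k :=
  mem_Gr_iff_cf.mpr fun n hn => by rw [cf_proj, if_neg hn]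

theorem proj_eq_self {k : ZMod (p - 1)} {s : BreuilRing p E} (hs : s ∈ Gr k) : proj k s = s :=
  ext_cf fun n => by
    rw [cf_proj]
    split_ifs with h
    · rfl
    · exact (mem_Gr_iff_cf.mp hs n h).symm

theorem proj_add (k : ZMod (p - 1)) (s t : BreuilRing p E) :
    proj k (s + t) = proj k s + proj k t :=
  ext_cf fun n => by
    simp only [cf_proj, cf_add]
    split_ifs <;> simp

theorem coeff_proj (k : ZMod (p - 1)) (s : BreuilRing p E) (n : ℕ) :
    PowerSeries.coeff n (toPS (proj k s)) =
      if (n : ZMod (p - 1)) = k then PowerSeries.coeff n (toPS s) else 0 := by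
  rw [coeff_eq_cf, cf_proj, coeff_eq_cf]
  split_ifs <;> simp

/-- Linearity over degree zero allows an identity with coefficients of degree zero to be projected
to one degree, so that cofactors and inverses can be taken homogeneous. -/
theorem proj_mul {t : BreuilRing p E} (ht : t ∈ Gr 0) (k : ZMod (p - 1)) (s : BreuilRing p E) :
    proj k (t * s) = t * proj k s := by
  refine toPS_injective (PowerSeries.ext fun n => ?_)
  rw [coeff_proj, map_mul toPS, map_mul toPS, PowerSeries.coeff_mul, PowerSeries.coeff_mul]
  have : ∀ f : ℕ × ℕ → E, (if (n : ZMod (p - 1)) = k then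
      ∑ x ∈ Finset.HasAntidiagonal.antidiagonal n, f x else 0) =
      ∑ x ∈ Finset.HasAntidiagonal.antidiagonal n, if (n : ZMod (p - 1)) = k then f x else 0 := by
    intro f; split_ifs <;> simp
  rw [this]
  refine Finset.sum_congr rfl fun x hx => ?_
  rw [Finset.HasAntidiagonal.mem_antidiagonal] at hx
  rw [coeff_proj]
  by_cases h : (x.1 : ZMod (p - 1)) = 0
  · rw [← hx, Nat.cast_add, h, zero_add, mul_ite, mul_zero]
  · rw [ht x.1 h, zero_mul, zero_mul, ite_self]

/-- An element of degree `b < p - 1` is `u ^ b` times an element of degree zero. -/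
theorem exists_eq_uS_pow_mul {b : ℕ} (hb : b < p - 1) {s : BreuilRing p E}
    (hs : s ∈ Gr (b : ZMod (p - 1))) : ∃ t ∈ Gr 0, s = uS p E ^ b * t := by
  obtain ⟨t, ht⟩ := exists_cf_eq (fun n => if (n : ZMod (p - 1)) = 0 then cf (n + b) s else 0)
    fun k => by
      filter_upwards [(Filter.tendsto_add_atTop_nat b).eventually (eventually_dvd_cf s k)] with n hn
      split_ifs
      exacts [hn, dvd_zero _]
  refine ⟨t, mem_Gr_iff_cf.mpr fun n hn => by rw [ht, if_neg hn], ?_⟩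
  · refine toPS_injective (PowerSeries.ext fun n => ?_)
    rw [map_mul, map_pow, toPS_uS, PowerSeries.coeff_X_pow_mul']
    by_cases h : (n : ZMod (p - 1)) = b
    · have hbn : b ≤ n := by
        by_contra hlt
        rw [ZMod.natCast_eq_natCast_iff, Nat.ModEq, Nat.mod_eq_of_lt hb,
          Nat.mod_eq_of_lt (by omega)] at h
        omega
      rw [if_pos hbn, coeff_eq_cf, coeff_eq_cf, ht, if_pos, Nat.sub_add_cancel hbn]
      -- Since `n = b + (p - 1) m` with `b < p - 1`, the floors of `n / (p - 1)` and `(n - b) / (p -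
      -- 1)` are both `m`. The factorial denominators are therefore unchanged by dividing by `u ^
      -- b`.
      · have hd : (p - 1) ∣ n - b :=
          (Nat.modEq_iff_dvd' hbn).mp ((ZMod.natCast_eq_natCast_iff _ _ _).mp h.symm)
        obtain ⟨m, hm⟩ := hd
        congr 4
        rw [hm, Nat.mul_div_cancel_left _ (one_le_sub_one p), show n = b + (p - 1) * m by omega,
          Nat.add_mul_div_left _ _ (one_le_sub_one p), Nat.div_eq_of_lt hb, zero_add]
      · rw [Nat.cast_sub hbn, h, sub_self]
    · rw [hs n h]
      split_ifs with hbn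
      · rw [coeff_eq_cf, ht, if_neg, ZeroMemClass.coe_zero, mul_zero]
        rw [Nat.cast_sub hbn, sub_eq_zero]; exact h
      · rfl

end Coefficients

/-! ### Divided powers, units and Frobenius in degree zero -/

section Structure

variable {p : ℕ} [hp : Fact p.Prime] {E : Type*} [Field E] [Algebra ℚ_[p] E] [Algebra ℤ_[p] E]

local notation "κ" => algebraMap (OE p E) (BreuilRing p E)

/-! ## Divisibility of factorials -/

/-- The prime-to-`p` part of `j!` is a unit of `ℤ_p`. -/
theorem exists_factorial_mul_eq_pow {j n : ℕ} (h : padicValNat p j.factorial ≤ n) :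
    ∃ c : ℤ_[p], (j.factorial : ℤ_[p]) * c = (p : ℤ_[p]) ^ n := by
  obtain ⟨m, hm⟩ := pow_padicValNat_dvd (p := p) (n := j.factorial)
  have hpm : ¬ p ∣ m := fun hd => by
    obtain ⟨l, rfl⟩ := hd
    apply pow_succ_padicValNat_not_dvd (p := p) (Nat.factorial_ne_zero j)
    exact ⟨l, by rw [pow_succ, mul_assoc]; exact hm⟩
  have hu : IsUnit (m : ℤ_[p]) := by
    rw [PadicInt.isUnit_iff]
    by_contra hne
    have : (m : ℤ_[p]) ∈ nonunits ℤ_[p] := by rwa [mem_nonunits_iff, PadicInt.isUnit_iff]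
    rw [← IsLocalRing.mem_maximalIdeal, ← PadicInt.ker_toZMod,
      RingHom.mem_ker, map_natCast, ZMod.natCast_eq_zero_iff] at this
    exact hpm this
  obtain ⟨d, hd⟩ := hu.exists_right_inv
  refine ⟨d * p ^ (n - padicValNat p j.factorial), ?_⟩
  calc (j.factorial : ℤ_[p]) * (d * p ^ (n - padicValNat p j.factorial))
      = ((p : ℤ_[p]) ^ padicValNat p j.factorial * m) *
          (d * p ^ (n - padicValNat p j.factorial)) := by
        congr 1; exact_mod_cast hm
    _ = (p : ℤ_[p]) ^ padicValNat p j.factorial * p ^ (n - padicValNat p j.factorial) *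
          (m * d) := by ring
    _ = _ := by rw [hd, mul_one, ← pow_add, Nat.add_sub_cancel' h]

theorem sub_one_mul_padicValNat_factorial_lt {j : ℕ} (hj : j ≠ 0) :
    (p - 1) * padicValNat p j.factorial < j :=
  sub_one_mul_padicValNat_factorial_lt_of_ne_zero p hj

theorem exists_factorial_mul_p_eq_pow {j : ℕ} (hj : j ≠ 0) :
    ∃ c : ℤ_[p], (j.factorial : ℤ_[p]) * (p * c) = (p : ℤ_[p]) ^ j := by
  have h1 := sub_one_mul_padicValNat_factorial_lt (p := p) hj
  have h2 := one_le_sub_one p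
  obtain ⟨c, hc⟩ := exists_factorial_mul_eq_pow (p := p) (j := j) (n := j - 1) (by
    have := Nat.le_mul_of_pos_left (padicValNat p j.factorial) h2
    omega)
  refine ⟨c, ?_⟩
  rw [mul_left_comm, hc, ← pow_succ', Nat.sub_add_cancel (Nat.pos_of_ne_zero hj)]

/-! ## The divided powers of `u ^ (p - 1)` -/

variable (p E) in
/-- The divided power `u ^ ((p - 1) m) / m!`. -/
def dpx (m : ℕ) : BreuilRing p E :=
  ⟨PowerSeries.monomial ((p - 1) * m) ((m.factorial : E)⁻¹),
    monomial_mem_breuil m ((p - 1) * m) (by rw [Nat.mul_div_cancel_left _ (one_le_sub_one p)])⟩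

theorem toPS_dpx (m : ℕ) :
    toPS (dpx p E m) = PowerSeries.monomial ((p - 1) * m) ((m.factorial : E)⁻¹) := rfl

theorem cf_dpx (n m : ℕ) : cf n (dpx p E m) = if n = (p - 1) * m then 1 else 0 := by
  have := charZero_E p E
  apply Subtype.ext
  rw [coe_cf, toPS_dpx, PowerSeries.coeff_monomial]
  split_ifs with h
  · rw [h, Nat.mul_div_cancel_left _ (one_le_sub_one p),
      mul_inv_cancel₀ (Nat.cast_ne_zero.mpr (Nat.factorial_ne_zero _))]
    rfl
  · simp

theorem Gr_dpx (m : ℕ) : dpx p E m ∈ Gr 0 := mem_Gr_iff_cf.mpr fun n hn => by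
  rw [cf_dpx, if_neg]
  rintro rfl
  exact hn (by simp)

theorem factorial_mul_dpx (m : ℕ) :
    (m.factorial : BreuilRing p E) * dpx p E m = (uS p E ^ (p - 1)) ^ m := by
  have := charZero_E p E
  apply toPS_injective
  rw [map_mul, map_natCast, toPS_dpx, ← pow_mul, map_pow, toPS_uS, PowerSeries.X_pow_eq,
    show (m.factorial : E⟦X⟧) = PowerSeries.C (m.factorial : E) by simp,
    ← PowerSeries.smul_eq_C_mul, ← LinearMap.map_smul, smul_eq_mul,
    mul_inv_cancel₀ (Nat.cast_ne_zero.mpr (Nat.factorial_ne_zero _))]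

theorem factorial_mul_dpE (m : ℕ) :
    (m.factorial : BreuilRing p E) * dpE p E m = eisS p E ^ m := by
  have := charZero_E p E
  apply toPS_injective
  rw [map_mul, map_natCast, toPS_dpE, map_pow, toPS_eisS, ← mul_assoc,
    show (m.factorial : E⟦X⟧) = PowerSeries.C (m.factorial : E) by simp, ← map_mul,
    mul_inv_cancel₀ (Nat.cast_ne_zero.mpr (Nat.factorial_ne_zero _)), map_one, one_mul]

theorem uS_pow_sub_one : uS p E ^ (p - 1) = eisS p E - p := by
  rw [eisS, add_sub_cancel_right]

theorem factorial_ne_zero_breuil (m : ℕ) : (m.factorial : BreuilRing p E) ≠ 0 :=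
  have := charZero_breuilRing p E
  Nat.cast_ne_zero.mpr (Nat.factorial_ne_zero _)

variable (p E) in
/-- The structure map `ℤ_p → S`. -/
def ofZp : ℤ_[p] →+* BreuilRing p E :=
  (algebraMap (OE p E) (BreuilRing p E)).comp (algebraMap ℤ_[p] (OE p E))

theorem Gr_ofZp (c : ℤ_[p]) : ofZp p E c ∈ Gr 0 := Gr_algebraMap _

theorem Gr_dpE (m : ℕ) : dpE p E m ∈ Gr 0 := fun n hn => by
  have h := Gr_pow (Gr_eisS (p := p) (E := E)) m n hn
  have := charZero_E p E
  rw [← factorial_mul_dpE, map_mul, map_natCast,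
    show (m.factorial : E⟦X⟧) = PowerSeries.C (m.factorial : E) by simp,
    PowerSeries.coeff_C_mul, mul_eq_zero] at h
  exact h.resolve_left (Nat.cast_ne_zero.mpr (Nat.factorial_ne_zero _))

/-- Expanding `(u^(p-1) + p)^m / m!` gives the sum of `p^(m-k)/(m-k)!` times `u^((p-1)k)/k!`, and
`p` divides `p^i / i!` for every `i > 0`. Only the term `k = m` survives modulo `p`. -/
theorem p_dvd_dpx_sub_dpE (m : ℕ) : (p : BreuilRing p E) ∣ dpx p E m - dpE p E m := by
  have h1 : ∀ i : ℕ, ∃ c : ℤ_[p], (i.factorial : ℤ_[p]) * c = (p : ℤ_[p]) ^ i ∧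
      (i ≠ 0 → (p : ℤ_[p]) ∣ c) ∧ (i = 0 → c = 1) := by
    intro i
    by_cases hi : i = 0
    · exact ⟨1, by simp [hi], fun h => absurd hi h, fun _ => rfl⟩
    · obtain ⟨c, hc⟩ := exists_factorial_mul_p_eq_pow (p := p) hi
      exact ⟨_, hc, fun _ => dvd_mul_right _ _, fun h => absurd h hi⟩
  choose c hc hcd hc0 using h1
  have key : dpE p E m = ∑ k ∈ Finset.range (m + 1), ofZp p E (c (m - k)) * dpx p E k := by
    apply mul_left_cancel₀ (factorial_ne_zero_breuil (p := p) (E := E) m)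
    rw [factorial_mul_dpE, eisS, add_pow, Finset.mul_sum]
    refine Finset.sum_congr rfl fun k hk => ?_
    have hkm : k ≤ m := Nat.lt_succ_iff.mp (Finset.mem_range.mp hk)
    rw [← factorial_mul_dpx, ← Nat.choose_mul_factorial_mul_factorial hkm]
    have := congrArg (ofZp p E) (hc (m - k))
    rw [map_mul, map_pow, map_natCast, map_natCast] at this
    rw [← this]
    push_cast; ring
  rw [key, Finset.sum_range_succ, Nat.sub_self, hc0 0 rfl, map_one, one_mul, add_comm,
    sub_add_cancel_left, dvd_neg]
  refine Finset.dvd_sum fun k hk => Dvd.dvd.mul_right ?_ _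
  have := map_dvd (ofZp p E) (hcd (m - k) (by have := Finset.mem_range.mp hk; omega))
  rwa [map_natCast] at this

theorem mem_Gr_of_p_mul {k : ZMod (p - 1)} {w : BreuilRing p E}
    (h : (p : BreuilRing p E) * w ∈ Gr k) : w ∈ Gr k := fun n hn => by
  have := charZero_E p E
  have h := h n hn
  rw [map_mul, map_natCast, show (p : E⟦X⟧) = PowerSeries.C (p : E) by simp,
    PowerSeries.coeff_C_mul, mul_eq_zero] at h
  exact h.resolve_left (Nat.cast_ne_zero.mpr hp.out.ne_zero)

/-- An element of degree zero is a finite sum of divided powers of `u ^ (p - 1)` modulo `p`. -/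
theorem exists_truncation {t : BreuilRing p E} (ht : t ∈ Gr 0) :
    ∃ (N : ℕ) (w : BreuilRing p E), w ∈ Gr 0 ∧
      t = ∑ m ∈ Finset.range N, κ (cf ((p - 1) * m) t) * dpx p E m + p * w := by
  obtain ⟨N, hN⟩ := Filter.eventually_atTop.mp (eventually_dvd_cf t 1)
  have hd : (p : BreuilRing p E) ∣
      t - ∑ m ∈ Finset.range N, κ (cf ((p - 1) * m) t) * dpx p E m := by
    rw [p_dvd_iff]
    intro n
    rw [cf_sub, cf_sum]
    simp_rw [cf_algebraMap_mul, cf_dpx]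
    by_cases hn : (p - 1) ∣ n
    · obtain ⟨m, rfl⟩ := hn
      simp_rw [Nat.mul_right_inj (one_le_sub_one p).ne']
      simp_rw [mul_ite, mul_one, mul_zero, Finset.sum_ite_eq, Finset.mem_range]
      split_ifs with hm
      · rw [sub_self]; exact dvd_zero _
      · rw [sub_zero, ← pow_one (p : OE p E)]
        exact hN _ ((not_lt.mp hm).trans (Nat.le_mul_of_pos_left _ (one_le_sub_one p)))
    · rw [mem_Gr_iff_cf.mp ht n (by rwa [Ne, ZMod.natCast_eq_zero_iff]), Finset.sum_eq_zero,
        sub_zero]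
      · exact dvd_zero _
      · intro m _
        rw [if_neg, mul_zero]
        rintro rfl
        exact hn (dvd_mul_right _ _)
  obtain ⟨w, hw⟩ := hd
  refine ⟨N, w, mem_Gr_of_p_mul (hw ▸ sub_mem ht (sum_mem fun m _ => ?_)), ?_⟩
  · exact Gr_mul_left (Gr_algebraMap _) (Gr_dpx m)
  · rw [← hw, add_sub_cancel]

/-! ## Units -/

theorem p_dvd_add_pow {x y : BreuilRing p E} (hx : (p : BreuilRing p E) ∣ x ^ p)
    (hy : (p : BreuilRing p E) ∣ y ^ p) : (p : BreuilRing p E) ∣ (x + y) ^ p := by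
  rw [add_pow_prime_eq hp.out]
  exact dvd_add (dvd_add hx hy) (by rw [mul_assoc, mul_assoc]; exact dvd_mul_right _ _)

/-- The `p`-th power of `x^m / m!` is `(pm)! / (m!)^p` times `x^(pm) / (pm)!`. This coefficient is
`p!` times the number of partitions of a set of size `pm` into `p` blocks of size `m`. -/
theorem p_dvd_dpx_pow {m : ℕ} (hm : m ≠ 0) : (p : BreuilRing p E) ∣ dpx p E m ^ p := by
  have h := Nat.uniformBell_mul_eq p hm
  have h2 : dpx p E m ^ p = (p.uniformBell m * p.factorial : ℕ) * dpx p E (p * m) := by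
    apply mul_left_cancel₀ (pow_ne_zero p (factorial_ne_zero_breuil (p := p) (E := E) m))
    rw [← mul_pow, factorial_mul_dpx, ← pow_mul, mul_comm m p, ← factorial_mul_dpx, ← h]
    push_cast; ring
  rw [h2]
  refine Dvd.dvd.mul_right ?_ _
  exact Nat.cast_dvd_cast ((Nat.dvd_factorial hp.out.pos le_rfl).mul_left _)

/-- Modulo `p` the `p`-th power is additive, `t` is a finite sum of divided powers, and each one of
positive index has vanishing `p`-th power. -/
theorem p_dvd_pow_of_ct_eq_zero {t : BreuilRing p E} (ht : t ∈ Gr 0) (h0 : ct t = 0) :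
    (p : BreuilRing p E) ∣ t ^ p := by
  obtain ⟨N, w, -, h⟩ := exists_truncation ht
  rw [h]
  refine p_dvd_add_pow ?_ ?_
  · suffices ∀ M : ℕ, (p : BreuilRing p E) ∣
        (∑ m ∈ Finset.range M, κ (cf ((p - 1) * m) t) * dpx p E m) ^ p from this N
    intro M
    induction M with
    | zero => simp [hp.out.ne_zero]
    | succ M ih =>
      rw [Finset.sum_range_succ]
      refine p_dvd_add_pow ih ?_
      rw [mul_pow]
      by_cases hM : M = 0
      · rw [hM, mul_zero, ← ct_apply, h0, map_zero, zero_pow hp.out.ne_zero, zero_mul]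
        exact dvd_zero _
      · exact Dvd.dvd.mul_left (p_dvd_dpx_pow hM) _
  · rw [mul_pow]
    exact Dvd.dvd.mul_right (dvd_pow_self _ hp.out.ne_zero) _

/-- With `d` the inverse of the constant term, `1 - d t` has `p`-th power divisible by `p`. Hence `1
- (1 - d t)^p` is a unit, and it is a multiple of `d t`. The degree zero part of an inverse is again
an inverse. -/
theorem exists_inverse (hO : IsPComplete p (OE p E)) {t : BreuilRing p E} (ht : t ∈ Gr 0)
    (h0 : IsUnit (ct t)) : ∃ s ∈ Gr 0, t * s = 1 := by
  obtain ⟨d, hd⟩ := h0.exists_right_inv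
  have h1 : 1 - κ d * t ∈ Gr 0 := sub_mem Gr_one (Gr_mul_left (Gr_algebraMap _) ht)
  have h2 : ct (1 - κ d * t) = 0 := by
    rw [map_sub, map_mul, ct_algebraMap, map_one, mul_comm, hd, sub_self]
  obtain ⟨w, hw⟩ := p_dvd_pow_of_ct_eq_zero h1 h2
  have h3 := (isPComplete_breuilRing hO).isUnit_one_sub w
  rw [← hw] at h3
  have h4 : κ d * t ∣ 1 - (1 - κ d * t) ^ p := by
    have := sub_dvd_pow_sub_pow (1 : BreuilRing p E) (1 - κ d * t) p
    rwa [sub_sub_cancel, one_pow] at this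
  obtain ⟨s, hs⟩ := (isUnit_of_mul_isUnit_right (isUnit_of_dvd_unit h4 h3)).exists_right_inv
  refine ⟨proj 0 s, proj_mem _ _, ?_⟩
  rw [← proj_mul ht, hs, proj_eq_self Gr_one]

/-! ## Frobenius -/

theorem frobS_algebraMap (c : OE p E) : frobS p E (κ c) = κ c := by
  apply toPS_injective
  rw [toPS_frobS, toPS_algebraMap, PowerSeries.expand_C]

theorem frobS_uS : frobS p E (uS p E) = uS p E ^ p := by
  apply toPS_injective
  rw [toPS_frobS, map_pow, toPS_uS, PowerSeries.expand_X]

theorem frobS_dpx (m : ℕ) : (m.factorial : BreuilRing p E) * frobS p E (dpx p E m) =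
    ((p * m).factorial : ℕ) * dpx p E (p * m) := by
  rw [factorial_mul_dpx, ← map_natCast (frobS p E), ← map_mul, factorial_mul_dpx, map_pow, map_pow,
    frobS_uS]
  ring

/-- The image is `(pm)! / m!` times a divided power, and `p · m!` divides `(pm)! = pm · (pm - 1)!`
because `m ≤ pm - 1`. -/
theorem p_dvd_frobS_dpx {m : ℕ} (hm : m ≠ 0) : (p : BreuilRing p E) ∣ frobS p E (dpx p E m) := by
  have hd : p * m.factorial ∣ (p * m).factorial := by
    obtain ⟨l, hl⟩ := Nat.exists_eq_succ_of_ne_zero (mul_ne_zero hp.out.ne_zero hm)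
    rw [hl, Nat.factorial_succ, ← Nat.succ_eq_add_one, ← hl, mul_assoc]
    refine Nat.mul_dvd_mul_left _ (Dvd.dvd.mul_left (Nat.factorial_dvd_factorial ?_) _)
    have := Nat.mul_le_mul_right m hp.out.two_le
    omega
  obtain ⟨c, hc⟩ := hd
  refine ⟨c * dpx p E (p * m), ?_⟩
  apply mul_left_cancel₀ (factorial_ne_zero_breuil (p := p) (E := E) m)
  rw [frobS_dpx, hc]
  push_cast; ring

theorem dpx_one : dpx p E 1 = eisS p E - p := by
  rw [← uS_pow_sub_one]
  simpa using factorial_mul_dpx (p := p) (E := E) 1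

theorem dpx_zero : dpx p E 0 = 1 := by
  simpa using factorial_mul_dpx (p := p) (E := E) 0

theorem p_dvd_frobS_sub_ct {t : BreuilRing p E} (ht : t ∈ Gr 0) :
    (p : BreuilRing p E) ∣ frobS p E t - κ (ct t) := by
  obtain ⟨N, w, -, h⟩ := exists_truncation ht
  have h1 : ∀ M : ℕ, (p : BreuilRing p E) ∣
      frobS p E (∑ m ∈ Finset.range M, κ (cf ((p - 1) * m) t) * dpx p E m) -
        κ (ct (∑ m ∈ Finset.range M, κ (cf ((p - 1) * m) t) * dpx p E m)) := by
    intro M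
    induction M with
    | zero => simp
    | succ M ih =>
      rw [Finset.sum_range_succ, map_add, map_add, map_add, add_sub_add_comm]
      refine dvd_add ih ?_
      rw [map_mul, frobS_algebraMap, map_mul ct, map_mul, ct_algebraMap, ← mul_sub]
      refine Dvd.dvd.mul_left ?_ _
      by_cases hM : M = 0
      · simp [hM, dpx_zero]
      · refine dvd_sub (p_dvd_frobS_dpx hM) ?_
        rw [ct_apply, cf_dpx, if_neg, map_zero]
        · exact dvd_zero _
        · exact (Nat.mul_pos (one_le_sub_one p) (Nat.pos_of_ne_zero hM)).ne
  have h2 : frobS p E (p * w) - κ (ct (p * w)) = p * (frobS p E w - κ (ct w)) := by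
    simp only [map_mul, map_natCast]; ring
  rw [h, map_add, map_add, map_add, add_sub_add_comm, h2]
  exact dvd_add (h1 N) (dvd_mul_right _ _)

theorem p_dvd_frobS_eisS : (p : BreuilRing p E) ∣ frobS p E (eisS p E) := by
  have h := p_dvd_frobS_dpx (p := p) (E := E) one_ne_zero
  rw [dpx_one, map_sub, map_natCast] at h
  exact (dvd_sub_self_right).mp h

end Structure

/-! ### Division with remainder and the contraction estimates -/

section Division

variable {p : ℕ} [hp : Fact p.Prime] {E : Type*} [Field E] [Algebra ℚ_[p] E] [Algebra ℤ_[p] E]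

local notation "κ" => algebraMap (OE p E) (BreuilRing p E)

/-! ## The filtration -/

theorem dpE_mem_filS {i j : ℕ} (h : i ≤ j) : dpE p E j ∈ filS p E i := by
  rw [filS, Ideal.mem_iInf]
  exact fun n => Ideal.mem_sup_left (Ideal.subset_span ⟨j, h, rfl⟩)

theorem mem_filS_of_forall {i : ℕ} {x : BreuilRing p E}
    (h : ∀ n, ∃ y ∈ filS p E i, (p : BreuilRing p E) ^ n ∣ x - y) : x ∈ filS p E i := by
  rw [filS, Ideal.mem_iInf]
  intro n
  obtain ⟨y, hy, hxy⟩ := h n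
  rw [filS, Ideal.mem_iInf] at hy
  rw [← sub_add_cancel x y]
  exact add_mem (Ideal.mem_sup_right (Ideal.mem_span_singleton.mpr hxy)) (hy n)

theorem exists_of_mem_filS {i : ℕ} {x : BreuilRing p E} (hx : x ∈ filS p E i) (n : ℕ) :
    ∃ y ∈ Ideal.span {y | ∃ j, i ≤ j ∧ y = dpE p E j}, ∃ z,
      x = y + (p : BreuilRing p E) ^ n * z := by
  rw [filS, Ideal.mem_iInf] at hx
  obtain ⟨y, hy, z, hz, h⟩ := Submodule.mem_sup.mp (hx n)
  obtain ⟨w, rfl⟩ := Ideal.mem_span_singleton.mp hz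
  exact ⟨y, hy, w, h.symm⟩

theorem mem_Gr_of_forall (hO : IsPComplete p (OE p E)) {k : ZMod (p - 1)} {x : BreuilRing p E}
    (h : ∀ n, ∃ y ∈ Gr k, (p : BreuilRing p E) ^ n ∣ x - y) : x ∈ Gr k :=
  mem_Gr_iff_cf.mpr fun m hm => hO.eq_zero _ fun n => by
    obtain ⟨y, hy, hxy⟩ := h n
    have := (p_pow_dvd_iff n _).mp hxy m
    rwa [cf_sub, mem_Gr_iff_cf.mp hy m hm, sub_zero] at this

/-! ## Division by `E(u)²` -/

/-- `t` is of the form `c₀ + c₁ E(u) + E(u)² t' + r` modulo `p`. -/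
def IsDivisibleModP (t : BreuilRing p E) : Prop :=
  ∃ (c₀ c₁ : OE p E) (t' r w : BreuilRing p E), t' ∈ Gr 0 ∧ r ∈ filS p E p ∧ r ∈ Gr 0 ∧
    w ∈ Gr 0 ∧ t = κ c₀ + κ c₁ * eisS p E + eisS p E ^ 2 * t' + r + p * w

theorem IsDivisibleModP.add {s t : BreuilRing p E} (hs : IsDivisibleModP s)
    (ht : IsDivisibleModP t) : IsDivisibleModP (s + t) := by
  obtain ⟨c, d, t', r, w, h1, h2, h3, h4, h5⟩ := hs
  obtain ⟨c', d', t'', r', w', h1', h2', h3', h4', h5'⟩ := ht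
  refine ⟨c + c', d + d', t' + t'', r + r', w + w', add_mem h1 h1', add_mem h2 h2', add_mem h3 h3',
    add_mem h4 h4', ?_⟩
  rw [h5, h5', map_add, map_add]; ring

theorem IsDivisibleModP.algebraMap_mul {t : BreuilRing p E} (c : OE p E)
    (ht : IsDivisibleModP t) : IsDivisibleModP (κ c * t) := by
  obtain ⟨c', d', t', r, w, h1, h2, h3, h4, h5⟩ := ht
  refine ⟨c * c', c * d', κ c * t', κ c * r, κ c * w, Gr_mul_left (Gr_algebraMap c) h1,
    Ideal.mul_mem_left _ _ h2, Gr_mul_left (Gr_algebraMap c) h3,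
    Gr_mul_left (Gr_algebraMap c) h4, ?_⟩
  rw [h5, map_mul, map_mul]; ring

theorem isDivisibleModP_zero : IsDivisibleModP (0 : BreuilRing p E) :=
  ⟨0, 0, 0, 0, 0, zero_mem _, zero_mem _, zero_mem _, zero_mem _, by simp⟩

theorem isDivisibleModP_dpx (m : ℕ) : IsDivisibleModP (dpx p E m) := by
  by_cases hm : p ≤ m
  · obtain ⟨w, hw⟩ := p_dvd_dpx_sub_dpE (p := p) (E := E) m
    refine ⟨0, 0, 0, dpE p E m, w, zero_mem _, dpE_mem_filS hm, Gr_dpE m,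
      mem_Gr_of_p_mul (hw ▸ sub_mem (Gr_dpx m) (Gr_dpE m)), ?_⟩
    rw [← hw]; simp
  · match m with
    | 0 => exact ⟨1, 0, 0, 0, 0, zero_mem _, zero_mem _, zero_mem _, zero_mem _, by simp [dpx_zero]⟩
    | 1 => exact ⟨0, 1, 0, 0, -1, zero_mem _, zero_mem _, zero_mem _, neg_mem Gr_one, by
        simp [dpx_one, sub_eq_add_neg]⟩
    | m + 2 =>
      -- Here `m + 2 < p`, so the factorial is invertible in `ℤ_p` and the divided power is a
      -- constant times `(E(u) - p)^(m+2)`, congruent modulo `p` to that constant times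
      -- `E(u)^(m+2)`.
      obtain ⟨c, hc⟩ := exists_factorial_mul_eq_pow (p := p) (j := m + 2) (n := 0) (by
        rw [padicValNat.eq_zero_of_not_dvd]
        rw [hp.out.dvd_factorial]; exact hm)
      have h1 : dpx p E (m + 2) = ofZp p E c * (eisS p E - p) ^ (m + 2) := by
        apply mul_left_cancel₀ (factorial_ne_zero_breuil (p := p) (E := E) (m + 2))
        have := congrArg (ofZp p E) hc
        rw [map_mul, map_natCast, pow_zero, map_one] at this
        rw [factorial_mul_dpx, uS_pow_sub_one, ← mul_assoc, this, one_mul]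
      obtain ⟨w, hw⟩ : (p : BreuilRing p E) ∣ (eisS p E - p) ^ (m + 2) - eisS p E ^ (m + 2) := by
        have := sub_dvd_pow_sub_pow (eisS p E - p) (eisS p E) (m + 2)
        rwa [sub_sub_cancel_left, neg_dvd] at this
      have hw0 : w ∈ Gr 0 := mem_Gr_of_p_mul (hw ▸ sub_mem
        (Gr_pow (sub_mem Gr_eisS (Gr_natCast p)) _) (Gr_pow Gr_eisS _))
      refine ⟨0, 0, ofZp p E c * eisS p E ^ m, 0, ofZp p E c * w,
        Gr_mul_left (Gr_ofZp c) (Gr_pow Gr_eisS _), zero_mem _, zero_mem _,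
        Gr_mul_left (Gr_ofZp c) hw0, ?_⟩
      rw [h1, sub_eq_iff_eq_add.mp hw, map_zero]; ring

theorem isDivisibleModP_of_mem_Gr {t : BreuilRing p E} (ht : t ∈ Gr 0) : IsDivisibleModP t := by
  obtain ⟨N, w, hw, h⟩ := exists_truncation ht
  rw [h]
  refine IsDivisibleModP.add ?_ ⟨0, 0, 0, 0, w, zero_mem _, zero_mem _, zero_mem _, hw, by simp⟩
  exact Finset.sum_induction _ IsDivisibleModP (fun _ _ => IsDivisibleModP.add)
    isDivisibleModP_zero fun m _ => (isDivisibleModP_dpx m).algebraMap_mul _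

/-- The division modulo `p` is repeated on its error term and the resulting `p`-adic series are
summed. The remainder stays in `Fil^p S` because that ideal is `p`-adically closed. -/
theorem exists_division (hO : IsPComplete p (OE p E)) {t : BreuilRing p E} (ht : t ∈ Gr 0) :
    ∃ (c₀ c₁ : OE p E) (t' r : BreuilRing p E), t' ∈ Gr 0 ∧ r ∈ filS p E p ∧
      t = κ c₀ + κ c₁ * eisS p E + eisS p E ^ 2 * t' + r := by
  have hS := isPComplete_breuilRing hO
  have step : ∀ x : Gr (p := p) (E := E) 0, ∃ (c₀ c₁ : OE p E) (t' r : BreuilRing p E)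
      (w : Gr (p := p) (E := E) 0), t' ∈ Gr 0 ∧ r ∈ filS p E p ∧
      (x : BreuilRing p E) = κ c₀ + κ c₁ * eisS p E + eisS p E ^ 2 * t' + r + p * w := by
    rintro ⟨x, hx⟩
    obtain ⟨c₀, c₁, t', r, w, h1, h2, -, h4, h5⟩ := isDivisibleModP_of_mem_Gr hx
    exact ⟨c₀, c₁, t', r, ⟨w, h4⟩, h1, h2, h5⟩
  choose c₀ c₁ t' r w h1 h2 h3 using step
  let x : ℕ → Gr (p := p) (E := E) 0 := fun n => w^[n] ⟨t, ht⟩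
  have hx : ∀ n, x (n + 1) = w (x n) := fun n => Function.iterate_succ_apply' _ _ _
  have hx0 : (x 0 : BreuilRing p E) = t := rfl
  obtain ⟨C₀, hC₀⟩ := hO.exists_sum fun n => c₀ (x n)
  obtain ⟨C₁, hC₁⟩ := hO.exists_sum fun n => c₁ (x n)
  obtain ⟨T, hT⟩ := hS.exists_sum fun n => t' (x n)
  have hsum : ∀ n, t = κ (∑ i ∈ Finset.range n, (p : OE p E) ^ i * c₀ (x i)) +
      κ (∑ i ∈ Finset.range n, (p : OE p E) ^ i * c₁ (x i)) * eisS p E +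
      eisS p E ^ 2 * ∑ i ∈ Finset.range n, (p : BreuilRing p E) ^ i * t' (x i) +
      ∑ i ∈ Finset.range n, (p : BreuilRing p E) ^ i * r (x i) +
      (p : BreuilRing p E) ^ n * x n := by
    intro n
    induction n with
    | zero => simp [hx0]
    | succ n ih =>
      simp only [Finset.sum_range_succ]
      rw [hx, map_add, map_add, map_mul, map_mul, map_pow, map_natCast]
      conv_lhs => rw [ih, h3 (x n)]
      ring
  refine ⟨C₀, C₁, T, t - (κ C₀ + κ C₁ * eisS p E + eisS p E ^ 2 * T), ?_, ?_, by ring⟩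
  · exact mem_Gr_of_forall hO fun n => ⟨_, sum_mem fun i _ => Gr_mul_left
      (by simpa using Gr_natCast (p := p) (E := E) (p ^ i)) (h1 (x i)), hT n⟩
  · refine mem_filS_of_forall fun n => ⟨∑ i ∈ Finset.range n, (p : BreuilRing p E) ^ i * r (x i),
      sum_mem fun i _ => Ideal.mul_mem_left _ _ (h2 _), ?_⟩
    obtain ⟨d, hd⟩ := hC₀ n
    obtain ⟨d', hd'⟩ := hC₁ n
    obtain ⟨d'', hd''⟩ := hT n
    rw [sub_eq_iff_eq_add] at hd hd' hd''
    refine ⟨x n - κ d - κ d' * eisS p E - eisS p E ^ 2 * d'', ?_⟩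
    conv_lhs => rw [hsum n, hd, hd', hd'']
    simp only [map_add, map_mul, map_pow, map_natCast]
    ring

/-! ## The ideals `(pᵏ, pᵏ⁻¹ E(u)³)` -/

variable (p E) in
/-- The ideal `(pᵏ, pᵏ⁻¹ E(u)³)`; it is the unit ideal for `k = 0`. -/
def nbhd (k : ℕ) : Ideal (BreuilRing p E) :=
  Ideal.span {(p : BreuilRing p E) ^ k, (p : BreuilRing p E) ^ (k - 1) * eisS p E ^ 3}

theorem mem_nbhd {k : ℕ} {x : BreuilRing p E} : x ∈ nbhd p E k ↔ ∃ t s,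
    x = (p : BreuilRing p E) ^ k * t + (p : BreuilRing p E) ^ (k - 1) * eisS p E ^ 3 * s := by
  rw [nbhd, Ideal.mem_span_pair]
  constructor
  · rintro ⟨a, b, rfl⟩; exact ⟨a, b, by ring⟩
  · rintro ⟨a, b, rfl⟩; exact ⟨a, b, by ring⟩

theorem mem_nbhd_zero (x : BreuilRing p E) : x ∈ nbhd p E 0 :=
  mem_nbhd.mpr ⟨x, 0, by simp⟩

theorem p_pow_mem_nbhd (k : ℕ) : (p : BreuilRing p E) ^ k ∈ nbhd p E k :=
  Ideal.subset_span (by simp)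

theorem mem_nbhd_of_dvd {k : ℕ} {x : BreuilRing p E} (h : (p : BreuilRing p E) ^ k ∣ x) :
    x ∈ nbhd p E k := Ideal.mem_of_dvd _ h (p_pow_mem_nbhd k)

theorem dvd_of_mem_nbhd {k : ℕ} {x : BreuilRing p E} (h : x ∈ nbhd p E k) :
    (p : BreuilRing p E) ^ (k - 1) ∣ x := by
  obtain ⟨t, s, rfl⟩ := mem_nbhd.mp h
  refine dvd_add (Dvd.dvd.mul_right (pow_dvd_pow _ (Nat.sub_le k 1)) _) ?_
  rw [mul_assoc]; exact dvd_mul_right _ _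

/-- The constant term of `E(u)` is `p`, so on constant terms `E(u)³` more than makes up for the
missing factor `p`. -/
theorem p_pow_dvd_ct_of_mem_nbhd {k : ℕ} {x : BreuilRing p E} (h : x ∈ nbhd p E k) :
    (p : OE p E) ^ k ∣ ct x := by
  obtain ⟨t, s, rfl⟩ := mem_nbhd.mp h
  rw [map_add, map_mul, map_mul, map_mul, map_pow, map_pow, map_pow, map_natCast, ct_eisS,
    ← pow_add]
  exact dvd_add (dvd_mul_right _ _) (Dvd.dvd.mul_right (pow_dvd_pow _ (by omega)) _)

theorem exists_of_mem_nbhd_Gr {k : ℕ} {l : ZMod (p - 1)} {x : BreuilRing p E}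
    (h : x ∈ nbhd p E k) (hx : x ∈ Gr l) : ∃ t ∈ Gr l, ∃ s ∈ Gr l,
    x = (p : BreuilRing p E) ^ k * t + (p : BreuilRing p E) ^ (k - 1) * eisS p E ^ 3 * s := by
  obtain ⟨t, s, h⟩ := mem_nbhd.mp h
  refine ⟨proj l t, proj_mem _ _, proj l s, proj_mem _ _, ?_⟩
  have hp0 := Gr_natCast (p := p) (E := E) p
  rw [← proj_mul (Gr_pow hp0 k), ← proj_mul (Gr_mul_left (Gr_pow hp0 _) (Gr_pow Gr_eisS 3)),
    ← proj_add, ← h, proj_eq_self hx]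

/-- The homogeneous elements `pᵏ t + pᵏ⁻¹ E(u) s`. -/
def IsSmall (k : ℕ) (l : ZMod (p - 1)) (x : BreuilRing p E) : Prop :=
  ∃ t ∈ Gr l, ∃ s ∈ Gr l,
    x = (p : BreuilRing p E) ^ k * t + (p : BreuilRing p E) ^ (k - 1) * eisS p E * s

namespace IsSmall

variable {k : ℕ} {l : ZMod (p - 1)} {x y : BreuilRing p E}

theorem mem_Gr (hx : IsSmall k l x) : x ∈ Gr l := by
  obtain ⟨t, ht, s, hs, rfl⟩ := hx
  have hp0 := Gr_natCast (p := p) (E := E) p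
  exact add_mem (Gr_mul_left (Gr_pow hp0 k) ht)
    (Gr_mul_left (Gr_mul_left (Gr_pow hp0 _) Gr_eisS) hs)

theorem dvd (hx : IsSmall k l x) : (p : BreuilRing p E) ^ (k - 1) ∣ x := by
  obtain ⟨t, ht, s, hs, rfl⟩ := hx
  refine dvd_add (Dvd.dvd.mul_right (pow_dvd_pow _ (Nat.sub_le k 1)) _) ?_
  rw [mul_assoc]; exact dvd_mul_right _ _

theorem add (hx : IsSmall k l x) (hy : IsSmall k l y) : IsSmall k l (x + y) := by
  obtain ⟨t, ht, s, hs, rfl⟩ := hx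
  obtain ⟨t', ht', s', hs', rfl⟩ := hy
  exact ⟨t + t', add_mem ht ht', s + s', add_mem hs hs', by ring⟩

theorem mul {m : ZMod (p - 1)} (hx : IsSmall k l x) (hy : y ∈ Gr m) :
    IsSmall k (l + m) (x * y) := by
  obtain ⟨t, ht, s, hs, rfl⟩ := hx
  exact ⟨t * y, Gr_mul ht hy, s * y, Gr_mul hs hy, by ring⟩

theorem mul_zero (hx : IsSmall k l x) (hy : y ∈ Gr 0) : IsSmall k l (x * y) := by
  simpa using hx.mul hy

theorem neg (hx : IsSmall k l x) : IsSmall k l (-x) := by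
  obtain ⟨t, ht, s, hs, rfl⟩ := hx
  exact ⟨-t, neg_mem ht, -s, neg_mem hs, by ring⟩

theorem of_mem_nbhd (h : x ∈ nbhd p E k) (hx : x ∈ Gr l) : IsSmall k l x := by
  obtain ⟨t, ht, s, hs, rfl⟩ := exists_of_mem_nbhd_Gr h hx
  exact ⟨t, ht, eisS p E ^ 2 * s, Gr_mul_left (Gr_pow Gr_eisS 2) hs, by ring⟩

theorem p_pow_mul (hx : x ∈ Gr l) : IsSmall k l ((p : BreuilRing p E) ^ k * x) :=
  ⟨x, hx, 0, zero_mem _, by ring⟩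

end IsSmall

/-- Division by `E(u)²` of a homogeneous element of `(pᵏ, pᵏ⁻¹ E(u)³)`. -/
theorem exists_division_sq (hO : IsPComplete p (OE p E)) {b k : ℕ} (hb : b < p - 1)
    {l : ZMod (p - 1)} (hl : (b : ZMod (p - 1)) = l)
    {x : BreuilRing p E} (hx : x ∈ Gr l) (hk : x ∈ nbhd p E k) :
    ∃ (c₀ c₁ : OE p E) (y r : BreuilRing p E), (p : OE p E) ^ k ∣ c₀ ∧ (p : OE p E) ^ k ∣ c₁ ∧
      IsSmall k l y ∧ r ∈ filS p E p ∧
      x = uS p E ^ b * (κ c₀ + eisS p E * κ c₁) + eisS p E ^ 2 * y +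
        (p : BreuilRing p E) ^ k * r := by
  subst hl
  obtain ⟨t, ht, s, hs, rfl⟩ := exists_of_mem_nbhd_Gr hk hx
  obtain ⟨t₀, ht₀, rfl⟩ := exists_eq_uS_pow_mul hb ht
  obtain ⟨c₀, c₁, t', r, ht', hr, rfl⟩ := exists_division hO ht₀
  -- Only the `p ^ k` part needs dividing. The part `p ^ (k - 1) E(u)³ s` is already a multiple of
  -- `E(u)²`; its quotient keeps one factor `E(u)`, whence the shape of `IsSmall`.
  refine ⟨p ^ k * c₀, p ^ k * c₁, p ^ k * (uS p E ^ b * t') + p ^ (k - 1) * eisS p E * s,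
    uS p E ^ b * r, dvd_mul_right _ _, dvd_mul_right _ _,
    ⟨_, Gr_mul_right (Gr_uS_pow b) ht', s, hs, rfl⟩,
    Ideal.mul_mem_left _ _ hr, ?_⟩
  simp only [map_mul, map_pow, map_natCast]
  ring

/-- Division by `E(u)` of a homogeneous element of `(pᵏ, pᵏ⁻¹ E(u)³)`. -/
theorem exists_division_one (hO : IsPComplete p (OE p E)) {b k : ℕ} (hb : b < p - 1)
    {l : ZMod (p - 1)} (hl : (b : ZMod (p - 1)) = l)
    {x : BreuilRing p E} (hx : x ∈ Gr l) (hk : x ∈ nbhd p E k) :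
    ∃ (c : OE p E) (y r : BreuilRing p E), (p : OE p E) ^ k ∣ c ∧
      IsSmall k l y ∧ r ∈ filS p E p ∧
      x = uS p E ^ b * κ c + eisS p E * y + (p : BreuilRing p E) ^ k * r := by
  obtain ⟨c₀, c₁, y, r, h0, ⟨d, rfl⟩, hy, hr, rfl⟩ := exists_division_sq hO hb hl hx hk
  subst hl
  refine ⟨c₀, p ^ k * (uS p E ^ b * κ d) + y * eisS p E, r, h0,
    (IsSmall.p_pow_mul (Gr_mul_right (Gr_uS_pow b) (Gr_algebraMap d))).add (hy.mul_zero Gr_eisS),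
    hr, ?_⟩
  simp only [map_mul, map_pow, map_natCast]
  ring

/-! ## Contraction by Frobenius -/

/-- One has `u^(3(p-1)) = (E(u) - p)³`, congruent to `E(u)³` modulo `p`. -/
theorem uS_pow_mem_nbhd_one {m : ℕ} (hm : 3 * (p - 1) ≤ m) : uS p E ^ m ∈ nbhd p E 1 := by
  obtain ⟨l, rfl⟩ := Nat.exists_eq_add_of_le hm
  rw [pow_add, mul_comm 3, pow_mul, uS_pow_sub_one]
  refine Ideal.mul_mem_right _ _ (mem_nbhd.mpr
    ⟨-(3 * eisS p E ^ 2) + 3 * eisS p E * p - p ^ 2, 1, ?_⟩)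
  simp only [Nat.sub_self, pow_zero, pow_one]
  ring

theorem frobS_mem_nbhd_one {b : ℕ} (hb3 : 3 ≤ b) (hb : b < p - 1) {t : BreuilRing p E}
    (ht : t ∈ Gr (b : ZMod (p - 1))) : frobS p E t ∈ nbhd p E 1 := by
  obtain ⟨s, -, rfl⟩ := exists_eq_uS_pow_mul hb ht
  rw [map_mul, map_pow, frobS_uS, ← pow_mul]
  refine Ideal.mul_mem_right _ _ (uS_pow_mem_nbhd_one ?_)
  rw [mul_comm p]
  exact Nat.mul_le_mul hb3 (Nat.sub_le p 1)

theorem p_pow_mul_mem_nbhd {k : ℕ} {x : BreuilRing p E} (hx : x ∈ nbhd p E 1) :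
    (p : BreuilRing p E) ^ k * x ∈ nbhd p E (k + 1) := by
  obtain ⟨t, s, rfl⟩ := mem_nbhd.mp hx
  exact mem_nbhd.mpr ⟨t, s, by simp only [Nat.add_sub_cancel, Nat.sub_self]; ring⟩

/-- The off-diagonal contraction. The factor `φ(E(u))` supplies the `p` missing from the second
term, and `φ` of any element of degree `b ≥ 3` lies in `(p, E(u)³)`, which raises `k` by one. -/
theorem IsSmall.frobS_mem {k b : ℕ} (hb3 : 3 ≤ b) (hb : b < p - 1)
    {l : ZMod (p - 1)} (hl : (b : ZMod (p - 1)) = l) {x : BreuilRing p E}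
    (hx : IsSmall k l x) : frobS p E x ∈ nbhd p E (k + 1) := by
  subst hl
  obtain ⟨t, ht, s, hs, rfl⟩ := hx
  obtain ⟨c, hc⟩ := p_dvd_frobS_eisS (p := p) (E := E)
  have h1 := p_pow_mul_mem_nbhd (k := k) (frobS_mem_nbhd_one hb3 hb ht)
  have h2 := p_pow_mul_mem_nbhd (k := k) (frobS_mem_nbhd_one hb3 hb hs)
  rw [map_add, map_mul, map_mul, map_mul, map_pow, map_pow, map_natCast, hc]
  refine add_mem h1 ?_
  rcases Nat.eq_zero_or_pos k with rfl | hk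
  -- For `k = 0` the exponent `k - 1` is truncated to `0`, so `φ(E(u))` alone already gives the
  -- factor `p`.
  · have : (p : BreuilRing p E) ^ (0 - 1) * (p * c) * frobS p E s =
        p ^ (0 + 1) * (c * frobS p E s) := by
      simp; ring
    rw [this]
    exact mem_nbhd_of_dvd (dvd_mul_right _ _)
  · obtain ⟨k, rfl⟩ := Nat.exists_eq_succ_of_ne_zero hk.ne'
    have : (p : BreuilRing p E) ^ (k + 1 - 1) * (p * c) * frobS p E s =
        c * (p ^ (k + 1) * frobS p E s) := by
      rw [Nat.add_sub_cancel]; ring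
    rw [Nat.succ_eq_add_one, this]
    exact Ideal.mul_mem_left _ _ h2

/-- The diagonal contraction. For `x = p^k t + p^(k-1) E(u)³ s`, replace `φ(t)` by the constant term
of `t` modulo `p`. Vanishing of the constant term of `x` makes `p^k ct(t)` a multiple of `p^(k-1)
p³`, and `p³` divides `φ(E(u))³`; so `p^(k+1)` divides everything. -/
theorem frobS_mem_nbhd_of_ct_eq_zero {k : ℕ} {x : BreuilRing p E} (hx : x ∈ Gr 0)
    (hk : x ∈ nbhd p E k) (h0 : ct x = 0) : frobS p E x ∈ nbhd p E (k + 1) := by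
  obtain ⟨t, ht, s, hs, rfl⟩ := exists_of_mem_nbhd_Gr hk hx
  obtain ⟨c, hc⟩ := p_dvd_frobS_eisS (p := p) (E := E)
  obtain ⟨d, hd⟩ := p_dvd_frobS_sub_ct ht
  rw [sub_eq_iff_eq_add] at hd
  -- The exponent `k - 1 + 2 - k` is `1` for `k ≥ 1` and `2` for `k = 0`, on account of truncated
  -- subtraction.
  have hpow : (p : BreuilRing p E) ^ (k - 1) * p ^ 3 = p ^ (k + 1) * p ^ (k - 1 + 2 - k) := by
    rw [← pow_add, ← pow_add]; congr 1; omega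
  have hpow' : (p : OE p E) ^ (k - 1) * p ^ 3 = p ^ (k + 1) * p ^ (k - 1 + 2 - k) := by
    rw [← pow_add, ← pow_add]; congr 1; omega
  rw [map_add, map_mul, map_mul, map_mul, map_pow, map_pow, map_pow, map_natCast,
    ct_eisS, hpow'] at h0
  have h1 : κ (p ^ k * ct t) = - κ (p ^ (k + 1) * p ^ (k - 1 + 2 - k) * ct s) := by
    rw [← map_neg]; exact congrArg _ (eq_neg_of_add_eq_zero_left h0)
  refine mem_nbhd_of_dvd ⟨d + p ^ (k - 1 + 2 - k) * (c ^ 3 * frobS p E s - κ (ct s)), ?_⟩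
  simp only [map_mul, map_pow, map_natCast] at h1
  rw [map_add, map_mul, map_mul, map_mul, map_pow, map_pow, map_pow, map_natCast, hc, hd,
    mul_add, h1, mul_pow, ← mul_assoc ((p : BreuilRing p E) ^ (k - 1)), hpow]
  ring

end Division

section Framed

set_option linter.unusedSectionVars false

variable {p : ℕ} [hp : Fact p.Prime] {E : Type*} [Field E] [Algebra ℚ_[p] E] [Algebra ℤ_[p] E]

local notation "κ" => algebraMap (OE p E) (BreuilRing p E)

/-! ## Framed matrices -/

/-- The degree of the `(i, j)` entry of a framed matrix. -/
def dg (p : ℕ) (a : Fin 3 → ℕ) (i j : Fin 3) : ZMod (p - 1) := (a j : ZMod (p - 1)) - a i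

theorem dg_add (a : Fin 3 → ℕ) (i j k : Fin 3) : dg p a i j + dg p a j k = dg p a i k := by
  simp [dg]

theorem dg_self (a : Fin 3 → ℕ) (i : Fin 3) : dg p a i i = 0 := sub_self _

/-- The least positive exponent in degree `a j - a i`, for `a j < a i`. -/
def lowExp (p : ℕ) (a : Fin 3 → ℕ) (i j : Fin 3) : ℕ := (p - 1) - (a i - a j)

/-- The bound `a 2 - a 0 < p - 4` keeps exponents below the diagonal at least `3`; the gaps greater
than `3` do the same above it in `exists_exp`. The value `3` is what `φ(u^b) ∈ (p, E(u)³)` requires.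
-/
theorem lowExp_spec {a : Fin 3 → ℕ} (ha : StronglyGeneric p a) {i j : Fin 3} (hij : j < i) :
    3 ≤ lowExp p a i j ∧ lowExp p a i j < p - 1 ∧
      (lowExp p a i j : ZMod (p - 1)) = dg p a i j := by
  obtain ⟨h1, h2, h3⟩ := ha
  have hlt : a j < a i ∧ 3 + (a i - a j) ≤ p - 1 := by
    have : (j = 0 ∧ i = 1) ∨ (j = 0 ∧ i = 2) ∨ (j = 1 ∧ i = 2) := by revert i j; decide
    rcases this with ⟨rfl, rfl⟩ | ⟨rfl, rfl⟩ | ⟨rfl, rfl⟩ <;> omega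
  refine ⟨by unfold lowExp; omega, by unfold lowExp; omega, ?_⟩
  rw [lowExp, dg, Nat.cast_sub (by omega), Nat.cast_sub hlt.1.le, ZMod.natCast_self]
  ring

theorem exists_exp {a : Fin 3 → ℕ} (ha : StronglyGeneric p a) {i j : Fin 3} (hij : i ≠ j) :
    ∃ b : ℕ, 3 ≤ b ∧ b < p - 1 ∧ (b : ZMod (p - 1)) = dg p a i j := by
  rcases lt_or_gt_of_ne hij with h | h
  · refine ⟨a j - a i, ?_⟩
    obtain ⟨h1, h2, h3⟩ := ha
    have hlt : a i < a j ∧ 3 ≤ a j - a i ∧ a j - a i < p - 1 := by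
      have : (i = 0 ∧ j = 1) ∨ (i = 0 ∧ j = 2) ∨ (i = 1 ∧ j = 2) := by revert i j; decide
      rcases this with ⟨rfl, rfl⟩ | ⟨rfl, rfl⟩ | ⟨rfl, rfl⟩ <;> omega
    exact ⟨hlt.2.1, hlt.2.2, by rw [dg, Nat.cast_sub hlt.1.le]⟩
  · exact ⟨_, lowExp_spec ha h⟩

theorem dg_ne_zero {a : Fin 3 → ℕ} (ha : StronglyGeneric p a) {i j : Fin 3} (hij : i ≠ j) :
    dg p a i j ≠ 0 := by
  obtain ⟨b, hb3, hb, h⟩ := exists_exp ha hij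
  rw [← h, Ne, ZMod.natCast_eq_zero_iff]
  exact fun hd => absurd (Nat.le_of_dvd (by omega) hd) (by omega)

/-- Matrices of base changes between framed families. -/
def IsFr (a : Fin 3 → ℕ) (X : Matrix (Fin 3) (Fin 3) (BreuilRing p E)) : Prop :=
  ∀ i j, X i j ∈ Gr (dg p a i j)

namespace IsFr

variable {a : Fin 3 → ℕ} {X Y : Matrix (Fin 3) (Fin 3) (BreuilRing p E)}

theorem mul (hX : IsFr a X) (hY : IsFr a Y) : IsFr a (X * Y) := fun i j => by
  rw [Matrix.mul_apply]
  exact sum_mem fun k _ => dg_add (p := p) a i k j ▸ Gr_mul (hX i k) (hY k j)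

theorem add (hX : IsFr a X) (hY : IsFr a Y) : IsFr a (X + Y) := fun i j =>
  add_mem (hX i j) (hY i j)

theorem sub (hX : IsFr a X) (hY : IsFr a Y) : IsFr a (X - Y) := fun i j =>
  sub_mem (hX i j) (hY i j)

theorem diagonal {d : Fin 3 → BreuilRing p E} (hd : ∀ i, d i ∈ Gr 0) :
    IsFr a (Matrix.diagonal d) := fun i j => by
  by_cases h : i = j
  · subst h
    rw [Matrix.diagonal_apply_eq, dg_self]; exact hd i
  · rw [Matrix.diagonal_apply_ne _ h]; exact zero_mem _

theorem one : IsFr a (1 : Matrix (Fin 3) (Fin 3) (BreuilRing p E)) := by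
  rw [← Matrix.diagonal_one]
  exact diagonal fun _ => Gr_one

/-- Off-diagonal degrees are nonzero modulo `p - 1`, so a framed matrix is diagonal at `u = 0`. -/
theorem map_ct (ha : StronglyGeneric p a) (hX : IsFr a X) :
    ct.mapMatrix X = Matrix.diagonal fun i => ct (X i i) := by
  ext i j
  by_cases h : i = j
  · subst h; simp
  · rw [Matrix.diagonal_apply_ne _ h, RingHom.mapMatrix_apply, Matrix.map_apply,
      ct_eq_zero_of_mem_Gr (dg_ne_zero ha h) (hX i j)]

/-- The degrees `a j - a (σ j)` sum to zero over any permutation. -/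
theorem det_mem (hX : IsFr a X) : X.det ∈ Gr 0 := by
  rw [Matrix.det_apply]
  refine sum_mem fun σ _ => ?_
  have h : ∏ i, X (σ i) i ∈ Gr (0 : ZMod (p - 1)) := by
    have h2 : ∏ i, X (σ i) i ∈ Gr (∑ i, dg p a (σ i) i) := by
      simp only [Fin.prod_univ_three, Fin.sum_univ_three]
      exact Gr_mul (Gr_mul (hX _ _) (hX _ _)) (hX _ _)
    convert h2 using 2
    simp only [dg, Finset.sum_sub_distrib]
    rw [Equiv.sum_comp σ fun i => (a i : ZMod (p - 1)), sub_self]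
  exact AddSubgroup.zsmul_mem _ h _

theorem isUnit_det (hO : IsPComplete p (OE p E)) (ha : StronglyGeneric p a) (hX : IsFr a X)
    (hu : ∀ i, IsUnit (ct (X i i))) : IsUnit X.det := by
  obtain ⟨s, -, hs⟩ := exists_inverse hO hX.det_mem (by
    rw [RingHom.map_det, hX.map_ct ha, Matrix.det_diagonal]
    exact IsUnit.prod_univ_iff.mpr hu)
  exact IsUnit.of_mul_eq_one _ hs

end IsFr

/-! ## The reduced lower triangular matrices -/

/-- The parameters `v₁₀, v₂₀, w₂₀, v₂₁` of a reduced lower triangular matrix. -/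
structure Params (p : ℕ) [Fact p.Prime] (E : Type*) [Field E] [Algebra ℚ_[p] E]
    [Algebra ℤ_[p] E] where
  v₁₀ : OE p E
  v₂₀ : OE p E
  w₂₀ : OE p E
  v₂₁ : OE p E

/-- The unipotent matrix attached to the parameters `v`. -/
def lowerMat (a : Fin 3 → ℕ) (v : Params p E) : Matrix (Fin 3) (Fin 3) (BreuilRing p E) :=
  !![1, 0, 0;
    uS p E ^ lowExp p a 1 0 * κ v.v₁₀, 1, 0;
    uS p E ^ lowExp p a 2 0 * (κ v.v₂₀ + eisS p E * κ v.w₂₀),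
      uS p E ^ lowExp p a 2 1 * κ v.v₂₁, 1]

variable (p E) in
/-- The matrix `diag(1, E(u), E(u)²)`. -/
def hodgeMat : Matrix (Fin 3) (Fin 3) (BreuilRing p E) :=
  Matrix.diagonal fun i => eisS p E ^ (i : ℕ)

theorem isFr_hodgeMat (a : Fin 3 → ℕ) : IsFr a (hodgeMat p E) :=
  IsFr.diagonal fun _ => Gr_pow Gr_eisS _

theorem isFr_lowerMat {a : Fin 3 → ℕ} (ha : StronglyGeneric p a) (v : Params p E) :
    IsFr a (lowerMat a v) := by
  have hu : ∀ {i j : Fin 3}, j < i → uS p E ^ lowExp p a i j ∈ Gr (dg p a i j) := fun h =>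
    (lowExp_spec ha h).2.2 ▸ Gr_uS_pow _
  intro i j
  fin_cases i <;> fin_cases j
  · exact (dg_self (p := p) a 0).symm ▸ Gr_one
  · exact zero_mem _
  · exact zero_mem _
  · exact Gr_mul_right (hu (by decide)) (Gr_algebraMap _)
  · exact (dg_self (p := p) a 1).symm ▸ Gr_one
  · exact zero_mem _
  · exact Gr_mul_right (hu (by decide))
      (add_mem (Gr_algebraMap _) (Gr_mul_left Gr_eisS (Gr_algebraMap _)))
  · exact Gr_mul_right (hu (by decide)) (Gr_algebraMap _)
  · exact (dg_self (p := p) a 2).symm ▸ Gr_one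

theorem map_ct_lowerMat {a : Fin 3 → ℕ} (ha : StronglyGeneric p a) (v : Params p E) :
    ct.mapMatrix (lowerMat a v) = 1 := by
  rw [(isFr_lowerMat ha v).map_ct ha, ← Matrix.diagonal_one]
  congr 1
  funext i
  fin_cases i <;> simp [lowerMat]

/-- Solving for the perturbation of the parameters. -/
theorem exists_params (hO : IsPComplete p (OE p E)) {a : Fin 3 → ℕ} (ha : StronglyGeneric p a)
    {k : ℕ} {X : Matrix (Fin 3) (Fin 3) (BreuilRing p E)} (hX : IsFr a X)
    (hu1 : IsUnit (ct (X 1 1))) (hu2 : IsUnit (ct (X 2 2))) {y₁ y₂ z : BreuilRing p E}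
    (hy₁ : y₁ ∈ Gr (dg p a 1 0)) (hy₂ : y₂ ∈ Gr (dg p a 2 0)) (hz : z ∈ Gr (dg p a 2 1))
    (hy₁k : y₁ ∈ nbhd p E k) (hy₂k : y₂ ∈ nbhd p E k) (hzk : z ∈ nbhd p E k) :
    ∃ (v : Params p E) (β₁₀ β₂₀ β₂₁ ρ₁₀ ρ₂₀ ρ₂₁ : BreuilRing p E),
      ((p : OE p E) ^ k ∣ v.v₁₀ ∧ (p : OE p E) ^ k ∣ v.v₂₀ ∧ (p : OE p E) ^ k ∣ v.w₂₀ ∧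
        (p : OE p E) ^ k ∣ v.v₂₁) ∧
      (IsSmall k (dg p a 1 0) β₁₀ ∧ IsSmall k (dg p a 2 0) β₂₀ ∧ IsSmall k (dg p a 2 1) β₂₁) ∧
      (ρ₁₀ ∈ filS p E p ∧ ρ₂₀ ∈ filS p E p ∧ ρ₂₁ ∈ filS p E p) ∧
      y₁ + X 1 1 * (uS p E ^ lowExp p a 1 0 * κ v.v₁₀) +
        X 1 2 * (uS p E ^ lowExp p a 2 0 * (κ v.v₂₀ + eisS p E * κ v.w₂₀)) =
          eisS p E * β₁₀ + (p : BreuilRing p E) ^ k * ρ₁₀ ∧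
      y₂ + X 2 1 * (uS p E ^ lowExp p a 1 0 * κ v.v₁₀) +
        X 2 2 * (uS p E ^ lowExp p a 2 0 * (κ v.v₂₀ + eisS p E * κ v.w₂₀)) =
          eisS p E ^ 2 * β₂₀ + (p : BreuilRing p E) ^ k * ρ₂₀ ∧
      z + X 2 2 * (uS p E ^ lowExp p a 2 1 * κ v.v₂₁) =
          eisS p E * β₂₁ + (p : BreuilRing p E) ^ k * ρ₂₁ := by
  have hX11 : X 1 1 ∈ Gr 0 := dg_self (p := p) a 1 ▸ hX 1 1
  have hX22 : X 2 2 ∈ Gr 0 := dg_self (p := p) a 2 ▸ hX 2 2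
  have h12 : X 1 2 * X 2 1 ∈ Gr 0 := by
    have := Gr_mul (hX 1 2) (hX 2 1)
    rwa [dg_add, dg_self] at this
  -- Column `0` is a `2 × 2` system in `n₁ = u^b v₁₀` and `n₂ = u^b' (v₂₀ + E(u) w₂₀)`, modulo
  -- `E(u)` in row `1` and `E(u)²` in row `2`. Eliminating `n₂` by the inverse `α` of `X 2 2` leaves
  -- the coefficient `X 1 1 - X 1 2 X 2 1 α` of `n₁`. It is a unit because the constant term of `X 1
  -- 2` vanishes.
  obtain ⟨α, hα, hα1⟩ := exists_inverse hO hX22 hu2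
  have hD : X 1 1 - X 1 2 * X 2 1 * α ∈ Gr 0 := sub_mem hX11 (Gr_mul_left h12 hα)
  obtain ⟨δ, hδ, hδ1⟩ := exists_inverse hO hD (by
    rw [map_sub, map_mul, map_mul, ct_eq_zero_of_mem_Gr (dg_ne_zero ha (by decide)) (hX 1 2),
      zero_mul, zero_mul, sub_zero]
    exact hu1)
  obtain ⟨-, hb10, hd10⟩ := lowExp_spec ha (i := 1) (j := 0) (by decide)
  obtain ⟨-, hb20, hd20⟩ := lowExp_spec ha (i := 2) (j := 0) (by decide)
  obtain ⟨-, hb21, hd21⟩ := lowExp_spec ha (i := 2) (j := 1) (by decide)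
  obtain ⟨c₂₁, β₂₁, ρ₂₁, hc₂₁, hβ₂₁, hρ₂₁, e21⟩ := exists_division_one hO hb21 hd21
    (x := -(z * α)) (neg_mem (Gr_mul_right hz hα)) (neg_mem (Ideal.mul_mem_right _ _ hzk))
  have hq : y₂ * α * X 1 2 ∈ Gr (dg p a 1 0) := by
    have := Gr_mul (Gr_mul_right hy₂ hα) (hX 1 2)
    rwa [add_comm, dg_add] at this
  obtain ⟨c₁₀, β₁₀, ρ₁₀, hc₁₀, hβ₁₀, hρ₁₀, e10⟩ := exists_division_one hO hb10 hd10
    (x := -((y₁ - y₂ * α * X 1 2) * δ)) (neg_mem (Gr_mul_right (sub_mem hy₁ hq) hδ))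
    (neg_mem (Ideal.mul_mem_right _ _ (sub_mem hy₁k
      (Ideal.mul_mem_right _ _ (Ideal.mul_mem_right _ _ hy₂k)))))
  have hn : uS p E ^ lowExp p a 1 0 * κ c₁₀ ∈ Gr (dg p a 1 0) :=
    Gr_mul_right (hd10 ▸ Gr_uS_pow _) (Gr_algebraMap _)
  have hnk : uS p E ^ lowExp p a 1 0 * κ c₁₀ ∈ nbhd p E k := by
    refine Ideal.mul_mem_left _ _ (mem_nbhd_of_dvd ?_)
    have := map_dvd κ hc₁₀
    rwa [map_pow, map_natCast] at this
  -- With `n₁` fixed, row `2` determines `n₂` modulo `E(u)²`. Its quotient `β₂₀` feeds back into row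
  -- `1` through `X 1 2`, with a spare factor `E(u)`.
  obtain ⟨c₂₀, d₂₀, β₂₀, ρ₂₀, hc₂₀, hd₂₀, hβ₂₀, hρ₂₀, e20⟩ := exists_division_sq hO hb20 hd20
    (x := -((y₂ + X 2 1 * (uS p E ^ lowExp p a 1 0 * κ c₁₀)) * α))
    (neg_mem (Gr_mul_right (add_mem hy₂ (dg_add (p := p) a 2 1 0 ▸ Gr_mul (hX 2 1) hn)) hα))
    (neg_mem (Ideal.mul_mem_right _ _ (add_mem hy₂k (Ideal.mul_mem_left _ _ hnk))))
  refine ⟨⟨c₁₀, c₂₀, d₂₀, c₂₁⟩,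
    -(β₁₀ * (X 1 1 - X 1 2 * X 2 1 * α)) + -((β₂₀ * X 1 2) * eisS p E),
    -(β₂₀ * X 2 2), -(β₂₁ * X 2 2),
    -(ρ₁₀ * (X 1 1 - X 1 2 * X 2 1 * α)) + -(ρ₂₀ * X 1 2), -(ρ₂₀ * X 2 2), -(ρ₂₁ * X 2 2),
    ⟨hc₁₀, hc₂₀, hd₂₀, hc₂₁⟩, ⟨?_, (hβ₂₀.mul_zero hX22).neg, (hβ₂₁.mul_zero hX22).neg⟩,
    ⟨add_mem (neg_mem (Ideal.mul_mem_right _ _ hρ₁₀)) (neg_mem (Ideal.mul_mem_right _ _ hρ₂₀)),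
      neg_mem (Ideal.mul_mem_right _ _ hρ₂₀), neg_mem (Ideal.mul_mem_right _ _ hρ₂₁)⟩,
    ?_, ?_, ?_⟩
  · refine (hβ₁₀.mul_zero hD).neg.add (IsSmall.mul_zero ?_ Gr_eisS).neg
    have := hβ₂₀.mul (hX 1 2)
    rwa [add_comm, dg_add] at this
  · dsimp only
    linear_combination (-(X 1 1 - X 1 2 * X 2 1 * α)) * e10 - X 1 2 * e20
      - (y₁ - y₂ * α * X 1 2) * hδ1
  · dsimp only
    linear_combination (-(X 2 2)) * e20 -
      (y₂ + X 2 1 * (uS p E ^ lowExp p a 1 0 * κ c₁₀)) * hα1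
  · dsimp only
    linear_combination (-(X 2 2)) * e21 - z * hα1

end Framed

section Iteration

set_option linter.unusedSectionVars false

variable {p : ℕ} [hp : Fact p.Prime] {E : Type*} [Field E] [Algebra ℚ_[p] E] [Algebra ℤ_[p] E]

local notation "κ" => algebraMap (OE p E) (BreuilRing p E)

/-! ## Reductions of framed matrices and their perturbations -/

variable (p E) in
/-- A matrix `X`, parameters `v` and matrices `B`, `R` meant to satisfy
`X N(v) diag(1, E(u), E(u)²) = diag(1, E(u), E(u)²) B + R`. -/
structure Reduction where
  X : Matrix (Fin 3) (Fin 3) (BreuilRing p E)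
  v : Params p E
  B : Matrix (Fin 3) (Fin 3) (BreuilRing p E)
  R : Matrix (Fin 3) (Fin 3) (BreuilRing p E)

/-- The defining properties of the reduction of a framed matrix. -/
structure Reduction.IsValid (a : Fin 3 → ℕ) (s : Reduction p E) : Prop where
  X_mem : IsFr a s.X
  isUnit : ∀ j, IsUnit (ct (s.X j j))
  B_mem : IsFr a s.B
  R_mem : ∀ i j, s.R i j ∈ filS p E p
  eq : s.X * lowerMat a s.v * hodgeMat p E = hodgeMat p E * s.B + s.R
  ct_eq : ∀ j, ct (s.B j j) = ct (s.X j j)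

/-- Closeness of two reductions. -/
structure Reduction.IsClose (a : Fin 3 → ℕ) (k : ℕ) (s t : Reduction p E) : Prop where
  X_sub : ∀ i j, t.X i j - s.X i j ∈ nbhd p E k
  v₁₀_sub : (p : OE p E) ^ k ∣ t.v.v₁₀ - s.v.v₁₀
  v₂₀_sub : (p : OE p E) ^ k ∣ t.v.v₂₀ - s.v.v₂₀
  w₂₀_sub : (p : OE p E) ^ k ∣ t.v.w₂₀ - s.v.w₂₀
  v₂₁_sub : (p : OE p E) ^ k ∣ t.v.v₂₁ - s.v.v₂₁
  B_sub : ∀ i j, i ≠ j → IsSmall k (dg p a i j) (t.B i j - s.B i j)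
  B_sub_diag : ∀ j, t.B j j - s.B j j ∈ nbhd p E k
  R_sub : ∀ i j, ∃ ρ ∈ filS p E p, t.R i j - s.R i j = (p : BreuilRing p E) ^ k * ρ

/-- A reduction is carried along a perturbation of `X` by solving only for the increments of `v`,
`B` and `R`, so closeness is built in. For `k = 0` the closeness condition on `X` is empty and this
is an existence statement. -/
theorem Reduction.exists_isClose (hO : IsPComplete p (OE p E)) {a : Fin 3 → ℕ}
    (ha : StronglyGeneric p a) {k : ℕ} {s : Reduction p E} (hs : s.IsValid a)
    {X : Matrix (Fin 3) (Fin 3) (BreuilRing p E)} (hX : IsFr a X)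
    (hu : ∀ j, IsUnit (ct (X j j))) (hk : ∀ i j, X i j - s.X i j ∈ nbhd p E k) :
    ∃ t : Reduction p E, t.X = X ∧ t.IsValid a ∧ s.IsClose a k t := by
  have hN := isFr_lowerMat ha s.v
  have hε : IsFr a ((X - s.X) * lowerMat a s.v) := (hX.sub hs.X_mem).mul hN
  have hεk : ∀ i j, ((X - s.X) * lowerMat a s.v) i j ∈ nbhd p E k := fun i j => by
    rw [Matrix.mul_apply]
    exact sum_mem fun l _ => Ideal.mul_mem_right _ _ (hk i l)
  obtain ⟨w, β₁₀, β₂₀, β₂₁, ρ₁₀, ρ₂₀, ρ₂₁, ⟨hw₁₀, hw₂₀, hx₂₀, hw₂₁⟩, ⟨hβ₁₀, hβ₂₀, hβ₂₁⟩,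
    ⟨hρ₁₀, hρ₂₀, hρ₂₁⟩, e10, e20, e21⟩ := exists_params hO ha hX (hu 1) (hu 2)
      (hε 1 0) (hε 2 0) (hε 2 1) (hεk 1 0) (hεk 2 0) (hεk 2 1)
  let v : Params p E :=
    ⟨s.v.v₁₀ + w.v₁₀, s.v.v₂₀ + w.v₂₀, s.v.w₂₀ + w.w₂₀, s.v.v₂₁ + w.v₂₁⟩
  have hv : lowerMat a v = lowerMat a s.v + (lowerMat a w - 1) := by
    ext i j
    fin_cases i <;> fin_cases j <;> simp [lowerMat, v] <;> ring
  have hwk : ∀ i j, (lowerMat a w - 1) i j ∈ nbhd p E k := by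
    have hκ : ∀ c : OE p E, (p : OE p E) ^ k ∣ c → κ c ∈ nbhd p E k := fun c hc =>
      mem_nbhd_of_dvd (by have := map_dvd κ hc; rwa [map_pow, map_natCast] at this)
    intro i j
    fin_cases i <;> fin_cases j <;>
      simp only [lowerMat, Matrix.sub_apply, Matrix.one_apply, Fin.isValue, Fin.zero_eta,
        Fin.mk_one, Fin.reduceFinMk, Matrix.of_apply, Matrix.cons_val', Matrix.cons_val_zero,
        Matrix.cons_val_one, Matrix.cons_val, Matrix.cons_val_fin_one, if_true, sub_self,
        sub_zero, Fin.reduceEq, if_false, zero_mem, zero_ne_one, one_ne_zero]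
    · exact Ideal.mul_mem_left _ _ (hκ _ hw₁₀)
    · exact Ideal.mul_mem_left _ _ (add_mem (hκ _ hw₂₀) (Ideal.mul_mem_left _ _ (hκ _ hx₂₀)))
    · exact Ideal.mul_mem_left _ _ (hκ _ hw₂₁)
  -- Since `N(v)` is affine in `v`, `Δ` is the effect of changing `X` at fixed parameters plus `X`
  -- times the increment of `N`. The increments were chosen to make the entries below the diagonal
  -- divisible as required.
  set Δ := X * lowerMat a v - s.X * lowerMat a s.v with hΔ
  have hΔ' : Δ = (X - s.X) * lowerMat a s.v + X * (lowerMat a w - 1) := by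
    rw [hΔ, hv]; noncomm_ring
  have hΔfr : IsFr a Δ := (hX.mul (isFr_lowerMat ha v)).sub (hs.X_mem.mul hN)
  have hΔk : ∀ i j, Δ i j ∈ nbhd p E k := fun i j => by
    rw [hΔ', Matrix.add_apply, Matrix.mul_apply (M := X)]
    exact add_mem (hεk i j) (sum_mem fun l _ => Ideal.mul_mem_left _ _ (hwk l j))
  have d10 : Δ 1 0 = eisS p E * β₁₀ + (p : BreuilRing p E) ^ k * ρ₁₀ := by
    rw [← e10, hΔ']
    simp [lowerMat, Matrix.mul_apply, Fin.sum_univ_three]; ring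
  have d20 : Δ 2 0 = eisS p E ^ 2 * β₂₀ + (p : BreuilRing p E) ^ k * ρ₂₀ := by
    rw [← e20, hΔ']
    simp [lowerMat, Matrix.mul_apply, Fin.sum_univ_three]; ring
  have d21 : Δ 2 1 = eisS p E * β₂₁ + (p : BreuilRing p E) ^ k * ρ₂₁ := by
    rw [← e21, hΔ']
    simp [lowerMat, Matrix.mul_apply, Fin.sum_univ_three]
  -- These entries solve `Δ H = H β + p^k ρ`: entry `(i, j)` of `Δ` is multiplied by `E(u)^j` and
  -- divided by `E(u)^i`. Thus `Δ 2 1` needs only one factor `E(u)`, and its remainder acquires one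
  -- in `ρ`.
  let β : Matrix (Fin 3) (Fin 3) (BreuilRing p E) :=
    !![Δ 0 0, eisS p E * Δ 0 1, eisS p E ^ 2 * Δ 0 2; β₁₀, Δ 1 1, eisS p E * Δ 1 2;
      β₂₀, β₂₁, Δ 2 2]
  let ρ : Matrix (Fin 3) (Fin 3) (BreuilRing p E) :=
    !![0, 0, 0; ρ₁₀, 0, 0; ρ₂₀, eisS p E * ρ₂₁, 0]
  have hρ : ∀ i j, ρ i j ∈ filS p E p := by
    intro i j
    fin_cases i <;> fin_cases j
    · exact zero_mem _
    · exact zero_mem _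
    · exact zero_mem _
    · exact hρ₁₀
    · exact zero_mem _
    · exact zero_mem _
    · exact hρ₂₀
    · exact Ideal.mul_mem_left _ _ hρ₂₁
    · exact zero_mem _
  have hβdiag : ∀ j, β j j = Δ j j := by intro j; fin_cases j <;> rfl
  have hβ : ∀ i j, i ≠ j → IsSmall k (dg p a i j) (β i j) := by
    have hsm : ∀ i j, ∀ m : ℕ, IsSmall k (dg p a i j) (eisS p E ^ m * Δ i j) := fun i j m =>
      IsSmall.of_mem_nbhd (Ideal.mul_mem_left _ _ (hΔk i j))
        (Gr_mul_left (Gr_pow Gr_eisS m) (hΔfr i j))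
    intro i j hij
    fin_cases i <;> fin_cases j
    · exact absurd rfl hij
    · simpa [β] using hsm 0 1 1
    · simpa [β] using hsm 0 2 2
    · exact hβ₁₀
    · exact absurd rfl hij
    · simpa [β] using hsm 1 2 1
    · exact hβ₂₀
    · exact hβ₂₁
    · exact absurd rfl hij
  have hβfr : IsFr a β := fun i j => by
    by_cases hij : i = j
    · subst hij; rw [hβdiag]; exact hΔfr i i
    · exact (hβ i j hij).mem_Gr
  have heq : Δ * hodgeMat p E = hodgeMat p E * β + (p : BreuilRing p E) ^ k • ρ := by
    ext i j
    rw [hodgeMat, Matrix.mul_diagonal, Matrix.add_apply, Matrix.diagonal_mul, Matrix.smul_apply,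
      smul_eq_mul]
    fin_cases i <;> fin_cases j <;> simp [β, ρ, d10, d20, d21] <;> ring
  have hct : ∀ j, ct (Δ j j) = ct (X j j) - ct (s.X j j) := fun j => by
    have h1 := congrArg (fun M : Matrix (Fin 3) (Fin 3) (BreuilRing p E) => ct.mapMatrix M j j) hΔ
    simp only [map_sub, map_mul, map_ct_lowerMat ha, mul_one] at h1
    exact h1
  refine ⟨⟨X, v, s.B + β, s.R + (p : BreuilRing p E) ^ k • ρ⟩, rfl,
    ⟨hX, hu, hs.B_mem.add hβfr, fun i j => add_mem (hs.R_mem i j)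
      (Ideal.mul_mem_left _ _ (hρ i j)), ?_, fun j => ?_⟩,
    ⟨hk, ?_, ?_, ?_, ?_, fun i j hij => ?_, fun j => ?_, fun i j => ⟨ρ i j, hρ i j, ?_⟩⟩⟩
  · have : X * lowerMat a v = s.X * lowerMat a s.v + Δ := by rw [hΔ]; abel
    dsimp only
    rw [this, add_mul, hs.eq, heq, mul_add]; abel
  · dsimp only
    rw [Matrix.add_apply, map_add, hs.ct_eq, hβdiag, hct]; ring
  · simpa [v] using hw₁₀
  · simpa [v] using hw₂₀
  · simpa [v] using hx₂₀
  · simpa [v] using hw₂₁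
  · simpa using hβ i j hij
  · simpa [hβdiag] using hΔk j j
  · simp

/-! ## Normalisation of the constant terms -/

namespace Reduction

/-- The diagonal matrix of the inverses of the constant terms of `X`. -/
def scale (s : Reduction p E) : Matrix (Fin 3) (Fin 3) (BreuilRing p E) :=
  Matrix.diagonal fun j => κ (Ring.inverse (ct (s.X j j)))

variable {a : Fin 3 → ℕ} {s t : Reduction p E} {k : ℕ}

theorem mul_scale_apply (s : Reduction p E) (M : Matrix (Fin 3) (Fin 3) (BreuilRing p E))
    (i j : Fin 3) : (M * s.scale) i j = M i j * κ (Ring.inverse (ct (s.X j j))) :=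
  Matrix.mul_diagonal _ _ _ _

theorem isFr_scale (a : Fin 3 → ℕ) (s : Reduction p E) : IsFr a s.scale :=
  IsFr.diagonal fun _ => Gr_algebraMap _

theorem scale_comm_hodgeMat (s : Reduction p E) :
    s.scale * hodgeMat p E = hodgeMat p E * s.scale := by
  rw [scale, hodgeMat, Matrix.diagonal_mul_diagonal, Matrix.diagonal_mul_diagonal]
  simp_rw [mul_comm]

theorem ringInverse_sub_dvd {x y : OE p E} (hx : IsUnit x) (hy : IsUnit y)
    (h : (p : OE p E) ^ k ∣ y - x) :
    (p : OE p E) ^ k ∣ Ring.inverse y - Ring.inverse x := by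
  have : Ring.inverse y - Ring.inverse x = -(Ring.inverse y * Ring.inverse x) * (y - x) := by
    have h1 := Ring.inverse_mul_cancel x hx
    have h2 := Ring.inverse_mul_cancel y hy
    linear_combination (-Ring.inverse y) * h1 + Ring.inverse x * h2
  rw [this]
  exact Dvd.dvd.mul_left h _

theorem IsClose.inverse_sub (hs : s.IsValid a) (ht : t.IsValid a) (h : s.IsClose a k t)
    (j : Fin 3) : (p : OE p E) ^ k ∣ Ring.inverse (ct (t.X j j)) - Ring.inverse (ct (s.X j j)) :=
  ringInverse_sub_dvd (hs.isUnit j) (ht.isUnit j)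
    (by rw [← map_sub]; exact p_pow_dvd_ct_of_mem_nbhd (h.X_sub j j))

/-- The contraction of the iteration. After rescaling, all diagonal entries of `B` have constant
term `1`, so diagonal differences have constant term `0`; off-diagonal differences are small of
degree at least `3`. -/
theorem IsClose.frobS_mem (ha : StronglyGeneric p a) (hs : s.IsValid a) (ht : t.IsValid a)
    (h : s.IsClose a k t) (i j : Fin 3) :
    frobS p E ((t.B * t.scale) i j) - frobS p E ((s.B * s.scale) i j) ∈ nbhd p E (k + 1) := by
  rw [← map_sub, mul_scale_apply, mul_scale_apply]
  obtain ⟨d, hd⟩ := h.inverse_sub hs ht j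
  have hd' : κ (Ring.inverse (ct (t.X j j))) - κ (Ring.inverse (ct (s.X j j))) =
      (p : BreuilRing p E) ^ k * κ d := by
    rw [← map_sub, hd]; simp
  have key : t.B i j * κ (Ring.inverse (ct (t.X j j))) - s.B i j * κ (Ring.inverse (ct (s.X j j)))
      = (t.B i j - s.B i j) * κ (Ring.inverse (ct (t.X j j))) +
        (p : BreuilRing p E) ^ k * (s.B i j * κ d) := by
    linear_combination s.B i j * hd'
  by_cases hij : i = j
  · subst hij
    refine frobS_mem_nbhd_of_ct_eq_zero ?_ ?_ ?_
    · rw [← dg_self (p := p) a i]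
      exact sub_mem (Gr_mul_right (ht.B_mem i i) (Gr_algebraMap _))
        (Gr_mul_right (hs.B_mem i i) (Gr_algebraMap _))
    · rw [key]
      exact add_mem (Ideal.mul_mem_right _ _ (h.B_sub_diag i))
        (Ideal.mul_mem_right _ _ (p_pow_mem_nbhd k))
    · rw [map_sub, map_mul, map_mul, ct_algebraMap, ct_algebraMap, ht.ct_eq, hs.ct_eq,
        Ring.mul_inverse_cancel _ (ht.isUnit i), Ring.mul_inverse_cancel _ (hs.isUnit i), sub_self]
  · obtain ⟨b, hb3, hb, hbd⟩ := exists_exp ha hij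
    rw [key]
    exact (((h.B_sub i j hij).mul_zero (Gr_algebraMap _)).add (IsSmall.p_pow_mul
      (Gr_mul_right (hs.B_mem i j) (Gr_algebraMap d)))).frobS_mem hb3 hb hbd

theorem IsClose.R_scale_sub (hs : s.IsValid a) (ht : t.IsValid a) (h : s.IsClose a k t) :
    ∃ ρ : Matrix (Fin 3) (Fin 3) (BreuilRing p E), (∀ i j, ρ i j ∈ filS p E p) ∧
      t.R * t.scale = s.R * s.scale + (p : BreuilRing p E) ^ k • ρ := by
  have : ∀ i j, ∃ ρ ∈ filS p E p, (t.R * t.scale) i j =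
      (s.R * s.scale) i j + (p : BreuilRing p E) ^ k * ρ := by
    intro i j
    obtain ⟨d, hd⟩ := h.inverse_sub hs ht j
    have hd' : κ (Ring.inverse (ct (t.X j j))) - κ (Ring.inverse (ct (s.X j j))) =
        (p : BreuilRing p E) ^ k * κ d := by
      rw [← map_sub, hd]; simp
    obtain ⟨ρ, hρ, hρ'⟩ := h.R_sub i j
    refine ⟨ρ * κ (Ring.inverse (ct (t.X j j))) + s.R i j * κ d,
      add_mem (Ideal.mul_mem_right _ _ hρ) (Ideal.mul_mem_right _ _ (hs.R_mem i j)), ?_⟩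
    rw [mul_scale_apply, mul_scale_apply]
    linear_combination s.R i j * hd' + κ (Ring.inverse (ct (t.X j j))) * hρ'
  choose ρ hρ hρ' using this
  exact ⟨Matrix.of ρ, hρ, Matrix.ext fun i j => by
    rw [hρ', Matrix.add_apply, Matrix.smul_apply, smul_eq_mul, Matrix.of_apply]⟩

theorem IsValid.scale_eq (hs : s.IsValid a) :
    hodgeMat p E * (s.B * s.scale) + s.R * s.scale =
      s.X * lowerMat a s.v * s.scale * hodgeMat p E := by
  rw [mul_assoc _ s.scale, scale_comm_hodgeMat, ← mul_assoc (s.X * _), hs.eq, add_mul, mul_assoc]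

theorem IsValid.R_scale_mem (hs : s.IsValid a) (i j : Fin 3) :
    (s.R * s.scale) i j ∈ filS p E p := by
  rw [mul_scale_apply]
  exact Ideal.mul_mem_right _ _ (hs.R_mem i j)

end Reduction

/-! ## The limit -/

/-- The properties of the operator `(B, R) ↦ A φ(B) + G(R)` which make it contracting. -/
structure IsContracting (a : Fin 3 → ℕ)
    (Ψ : Matrix (Fin 3) (Fin 3) (BreuilRing p E) → Matrix (Fin 3) (Fin 3) (BreuilRing p E) →
      Matrix (Fin 3) (Fin 3) (BreuilRing p E)) : Prop where
  sub_mem : ∀ (k : ℕ) (B B' R ρ : Matrix (Fin 3) (Fin 3) (BreuilRing p E)),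
    (∀ i j, R i j ∈ filS p E p) → (∀ i j, ρ i j ∈ filS p E p) →
    (∀ i j, frobS p E (B' i j) - frobS p E (B i j) ∈ nbhd p E (k + 1)) →
    ∀ i j, Ψ B' (R + (p : BreuilRing p E) ^ k • ρ) i j - Ψ B R i j ∈ nbhd p E (k + 1)
  isFr : ∀ B R : Matrix (Fin 3) (Fin 3) (BreuilRing p E), (∀ i j, R i j ∈ filS p E p) →
    IsFr a (hodgeMat p E * B + R) → IsFr a (Ψ B R)
  isUnit_ct : ∀ j, IsUnit (ct (Ψ 1 0 j j))
  dvd_sub : ∀ (k : ℕ) (B B' R R' : Matrix (Fin 3) (Fin 3) (BreuilRing p E)),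
    (∀ i j, R i j ∈ filS p E p) → (∀ i j, R' i j ∈ filS p E p) →
    (∀ i j, (p : BreuilRing p E) ^ k ∣ B' i j - B i j) →
    (∀ i j, (p : BreuilRing p E) ^ k ∣ R' i j - R i j) →
    ∀ i j, (p : BreuilRing p E) ^ k ∣ Ψ B' R' i j - Ψ B R i j

variable {a : Fin 3 → ℕ}
    {Ψ : Matrix (Fin 3) (Fin 3) (BreuilRing p E) → Matrix (Fin 3) (Fin 3) (BreuilRing p E) →
      Matrix (Fin 3) (Fin 3) (BreuilRing p E)}

theorem IsContracting.isFr_scale (ha : StronglyGeneric p a) (hΨ : IsContracting a Ψ)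
    {s : Reduction p E} (hs : s.IsValid a) : IsFr a (Ψ (s.B * s.scale) (s.R * s.scale)) := by
  refine hΨ.isFr _ _ hs.R_scale_mem ?_
  rw [hs.scale_eq]
  exact ((hs.X_mem.mul (isFr_lowerMat ha _)).mul (s.isFr_scale a)).mul (isFr_hodgeMat a)

/-- One step of the iteration. -/
def IsStep (a : Fin 3 → ℕ)
    (Ψ : Matrix (Fin 3) (Fin 3) (BreuilRing p E) → Matrix (Fin 3) (Fin 3) (BreuilRing p E) →
      Matrix (Fin 3) (Fin 3) (BreuilRing p E)) (k : ℕ) (s t : Reduction p E) : Prop :=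
  s.IsValid a ∧ t.IsValid a ∧ s.IsClose a k t ∧ t.X = Ψ (s.B * s.scale) (s.R * s.scale)

/-! ### Successive approximation and the fixed point -/

theorem exists_first_step (hO : IsPComplete p (OE p E)) (ha : StronglyGeneric p a)
    (hΨ : IsContracting a Ψ) : ∃ s t, IsStep a Ψ 0 s t := by
  -- The identity is its own reduction with zero parameters. The next term may be arbitrarily far
  -- from it, since the neighbourhood of index `0` is the unit ideal.
  let s : Reduction p E := ⟨1, ⟨0, 0, 0, 0⟩, 1, 0⟩
  have hN : lowerMat a s.v = (1 : Matrix (Fin 3) (Fin 3) (BreuilRing p E)) := by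
    ext i j
    fin_cases i <;> fin_cases j <;> simp [lowerMat, s]
  have hs : s.IsValid a :=
    ⟨IsFr.one, fun j => by simp [s], IsFr.one, fun i j => zero_mem _, by
      rw [hN]; simp [s], fun j => rfl⟩
  have hsc : s.scale = 1 := by
    rw [Reduction.scale, ← Matrix.diagonal_one]
    congr 1; funext j; simp [s]
  have h1 : Ψ (s.B * s.scale) (s.R * s.scale) = Ψ 1 0 := by rw [hsc]; simp [s]
  have hfr := hΨ.isFr_scale ha hs
  rw [h1] at hfr
  obtain ⟨t, ht, htv, hc⟩ := Reduction.exists_isClose hO ha hs hfr hΨ.isUnit_ct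
    (fun i j => mem_nbhd_zero _)
  exact ⟨s, t, hs, htv, hc, by rw [h1, ht]⟩

theorem IsStep.exists_next (hO : IsPComplete p (OE p E)) (ha : StronglyGeneric p a)
    (hΨ : IsContracting a Ψ) {k : ℕ} {s t : Reduction p E} (h : IsStep a Ψ k s t) :
    ∃ r, IsStep a Ψ (k + 1) t r := by
  obtain ⟨hs, ht, hc, hX⟩ := h
  obtain ⟨ρ, hρ, hR⟩ := hc.R_scale_sub hs ht
  have hd : ∀ i j, Ψ (t.B * t.scale) (t.R * t.scale) i j - t.X i j ∈ nbhd p E (k + 1) := by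
    rw [hX, hR]
    exact hΨ.sub_mem k _ _ _ _ hs.R_scale_mem hρ (hc.frobS_mem ha hs ht)
  obtain ⟨r, hr, hrv, hrc⟩ := Reduction.exists_isClose hO ha ht (hΨ.isFr_scale ha ht)
    -- Diagonal constant terms change by multiples of `p`, so they remain units.
    (fun j => hO.isUnit_of_dvd_sub (ht.isUnit j) (by
      rw [← map_sub]
      exact (dvd_pow_self _ k.succ_ne_zero).trans (p_pow_dvd_ct_of_mem_nbhd (hd j j)))) hd
  exact ⟨r, ht, hrv, hrc, hr⟩

theorem exists_iteration (hO : IsPComplete p (OE p E)) (ha : StronglyGeneric p a)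
    (hΨ : IsContracting a Ψ) : ∃ s : ℕ → Reduction p E, ∀ k, IsStep a Ψ k (s k) (s (k + 1)) := by
  obtain ⟨s₀, t₀, h₀⟩ := exists_first_step hO ha hΨ
  have : Nonempty (Reduction p E) := ⟨s₀⟩
  -- Consecutive pairs are iterated because the next term depends on the closeness of the two
  -- preceding ones.
  choose! F hF using fun (k : ℕ) (q : Reduction p E × Reduction p E) =>
    IsStep.exists_next (k := k) (s := q.1) (t := q.2) hO ha hΨ
  let q : ℕ → Reduction p E × Reduction p E := fun n =>
    Nat.rec (s₀, t₀) (fun k q => (q.2, F k q)) n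
  have hq : ∀ k, IsStep a Ψ k (q k).1 (q k).2 := by
    intro k
    induction k with
    | zero => exact h₀
    | succ k ih => exact hF k (q k) ih
  exact ⟨fun k => (q k).1, hq⟩

theorem IsPComplete.exists_lim_matrix {R : Type*} [CommRing R] (h : IsPComplete p R)
    (f : ℕ → Matrix (Fin 3) (Fin 3) R)
    (hf : ∀ n i j, (p : R) ^ n ∣ f (n + 1) i j - f n i j) :
    ∃ L : Matrix (Fin 3) (Fin 3) R, ∀ n i j, (p : R) ^ n ∣ L i j - f n i j := by
  choose L hL using fun i j => h.exists_lim (fun n => f n i j) fun n => hf n i j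
  exact ⟨L, fun n i j => hL i j n⟩

theorem exists_fixed_reduction (hO : IsPComplete p (OE p E)) (ha : StronglyGeneric p a)
    (hΨ : IsContracting a Ψ) :
    ∃ s : Reduction p E, s.IsValid a ∧ s.X = Ψ (s.B * s.scale) (s.R * s.scale) := by
  obtain ⟨s', hs'⟩ := exists_iteration hO ha hΨ
  have hS := isPComplete_breuilRing hO
  -- Index `k` only ensures divisibility by `p ^ (k - 1)`; the shift yields `p ^ n` between terms
  -- `n` and `n + 1`.
  let s : ℕ → Reduction p E := fun n => s' (n + 1)
  have hv : ∀ n, (s n).IsValid a := fun n => (hs' (n + 1)).1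
  have hc : ∀ n, (s n).IsClose a (n + 1) (s (n + 1)) := fun n => (hs' (n + 1)).2.2.1
  have hfix : ∀ n, (s (n + 1)).X = Ψ ((s n).B * (s n).scale) ((s n).R * (s n).scale) :=
    fun n => (hs' (n + 1)).2.2.2
  have hle : ∀ n : ℕ, (p : OE p E) ^ n ∣ (p : OE p E) ^ (n + 1) := fun n => pow_dvd_pow _ n.le_succ
  obtain ⟨X, hX⟩ := hS.exists_lim_matrix (fun n => (s n).X) fun n i j =>
    dvd_of_mem_nbhd ((hc n).X_sub i j)
  obtain ⟨B, hB⟩ := hS.exists_lim_matrix (fun n => (s n).B) fun n i j => by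
    by_cases hij : i = j
    · subst hij; exact dvd_of_mem_nbhd ((hc n).B_sub_diag i)
    · exact ((hc n).B_sub i j hij).dvd
  obtain ⟨R, hR⟩ := hS.exists_lim_matrix (fun n => (s n).R) fun n i j => by
    obtain ⟨ρ, -, h⟩ := (hc n).R_sub i j
    rw [h]; exact Dvd.dvd.mul_right (pow_dvd_pow _ n.le_succ) _
  obtain ⟨v₁₀, hv₁₀⟩ := hO.exists_lim (fun n => (s n).v.v₁₀) fun n => (hle n).trans (hc n).v₁₀_sub
  obtain ⟨v₂₀, hv₂₀⟩ := hO.exists_lim (fun n => (s n).v.v₂₀) fun n => (hle n).trans (hc n).v₂₀_sub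
  obtain ⟨w₂₀, hw₂₀⟩ := hO.exists_lim (fun n => (s n).v.w₂₀) fun n => (hle n).trans (hc n).w₂₀_sub
  obtain ⟨v₂₁, hv₂₁⟩ := hO.exists_lim (fun n => (s n).v.v₂₁) fun n => (hle n).trans (hc n).v₂₁_sub
  let r : Reduction p E := ⟨X, ⟨v₁₀, v₂₀, w₂₀, v₂₁⟩, B, R⟩
  have hctX : ∀ n j, (p : OE p E) ^ n ∣ ct (X j j) - ct ((s n).X j j) := fun n j => by
    rw [← map_sub]; exact p_pow_dvd_ct (hX n j j)
  have hr : r.IsValid a := by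
    refine ⟨fun i j => mem_Gr_of_forall hO fun n => ⟨_, (hv n).X_mem i j, hX n i j⟩, fun j => ?_,
      fun i j => mem_Gr_of_forall hO fun n => ⟨_, (hv n).B_mem i j, hB n i j⟩,
      fun i j => mem_filS_of_forall fun n => ⟨_, (hv n).R_mem i j, hR n i j⟩, ?_, fun j => ?_⟩
    · exact hO.isUnit_of_dvd_sub ((hv 1).isUnit j) (by simpa using hctX 1 j)
    · ext i j
      refine hS.eq_of_dvd_sub fun n => ?_
      -- The defining equation passes to the limit because modulo `p ^ n` the limit agrees with the
      -- `n`-th reduction.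
      let q := Ideal.Quotient.mk (Ideal.span {(p : BreuilRing p E) ^ n})
      have hq : ∀ {x y : BreuilRing p E}, (p : BreuilRing p E) ^ n ∣ x - y ↔ q x = q y :=
        fun {x y} => by rw [Ideal.Quotient.mk_eq_mk_iff_sub_mem, Ideal.mem_span_singleton]
      have hqκ : ∀ {x y : OE p E}, (p : OE p E) ^ n ∣ x - y → q (κ x) = q (κ y) := fun h => by
        have := map_dvd κ h
        rwa [map_pow, map_natCast, map_sub, hq] at this
      have e1 : q.mapMatrix r.X = q.mapMatrix (s n).X := Matrix.ext fun i j => hq.mp (hX n i j)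
      have e2 : q.mapMatrix r.B = q.mapMatrix (s n).B := Matrix.ext fun i j => hq.mp (hB n i j)
      have e3 : q.mapMatrix r.R = q.mapMatrix (s n).R := Matrix.ext fun i j => hq.mp (hR n i j)
      have e4 : q.mapMatrix (lowerMat a r.v) = q.mapMatrix (lowerMat a (s n).v) := by
        ext i j
        fin_cases i <;> fin_cases j <;>
          simp [lowerMat, r, hqκ (hv₁₀ n), hqκ (hv₂₀ n), hqκ (hw₂₀ n), hqκ (hv₂₁ n)]
      rw [hq]
      have h := congrArg (fun M => q.mapMatrix M i j) (hv n).eq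
      simp only [map_mul, map_add, ← e1, ← e2, ← e3, ← e4] at h
      simp only [← map_mul, ← map_add] at h
      exact h
    · refine hO.eq_of_dvd_sub fun n => ?_
      have h1 : (p : OE p E) ^ n ∣ ct (B j j) - ct ((s n).B j j) := by
        rw [← map_sub]; exact p_pow_dvd_ct (hB n j j)
      have := dvd_sub h1 (hctX n j)
      rwa [(hv n).ct_eq, sub_sub_sub_cancel_right] at this
  have hscale : ∀ n (M : ℕ → Matrix (Fin 3) (Fin 3) (BreuilRing p E))
      (L : Matrix (Fin 3) (Fin 3) (BreuilRing p E)),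
      (∀ n i j, (p : BreuilRing p E) ^ n ∣ L i j - M n i j) →
      ∀ i j, (p : BreuilRing p E) ^ n ∣ (L * r.scale) i j - (M n * (s n).scale) i j := by
    intro n M L hM i j
    rw [Reduction.mul_scale_apply, Reduction.mul_scale_apply]
    have h1 := map_dvd κ (Reduction.ringInverse_sub_dvd ((hv n).isUnit j) (hr.isUnit j) (hctX n j))
    rw [map_pow, map_natCast, map_sub] at h1
    have h2 := dvd_add (Dvd.dvd.mul_right (hM n i j) (κ (Ring.inverse (ct (r.X j j)))))
      (Dvd.dvd.mul_left h1 (M n i j))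
    convert h2 using 1
    ring
  refine ⟨r, hr, Matrix.ext fun i j => hS.eq_of_dvd_sub fun n => ?_⟩
  have h1 := hΨ.dvd_sub n _ _ _ _ (hv n).R_scale_mem hr.R_scale_mem
    (hscale n (fun n => (s n).B) B hB) (hscale n (fun n => (s n).R) R hR) i j
  rw [← hfix] at h1
  have h2 := (pow_dvd_pow (p : BreuilRing p E) n.le_succ).trans (hX (n + 1) i j)
  have := dvd_sub h2 h1
  rwa [sub_sub_sub_cancel_right] at this

end Iteration

section Galois

/-! ## The character `ω̃` has full image -/

variable {p : ℕ} [hp : Fact p.Prime] {K : Type*} [Field K] [Algebra ℚ_[p] K] {π : K}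

-- Eisenstein's criterion over `ℤ_p` and Gauss's lemma. This makes every `(p-1)`-st root of `-p` in
-- `K` a conjugate of `π`.
open Polynomial in
theorem irreducible_X_pow_add_p (p : ℕ) [hp : Fact p.Prime] :
    Irreducible (X ^ (p - 1) + C (p : ℚ_[p])) := by
  have hdeg : (X ^ (p - 1) + C (p : ℤ_[p])).natDegree = p - 1 := natDegree_X_pow_add_C
  have hmonic : (X ^ (p - 1) + C (p : ℤ_[p])).Monic :=
    monic_X_pow_add_C _ (one_le_sub_one p).ne'
  have hprime : (Ideal.span {(p : ℤ_[p])}).IsPrime :=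
    (Ideal.span_singleton_prime PadicInt.prime_p.ne_zero).mpr PadicInt.prime_p
  have hirr : Irreducible (X ^ (p - 1) + C (p : ℤ_[p])) := by
    refine irreducible_of_eisenstein_criterion hprime ?_ ?_ ?_ ?_ hmonic.isPrimitive
    · rw [hmonic.leadingCoeff]
      exact (Ideal.ne_top_iff_one _).mp hprime.ne_top
    · intro n hn
      rw [degree_eq_natDegree hmonic.ne_zero, hdeg, Nat.cast_lt] at hn
      rw [coeff_add, coeff_X_pow, if_neg hn.ne, zero_add, coeff_C]
      split_ifs
      exacts [Ideal.mem_span_singleton_self _, zero_mem _]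
    · rw [degree_eq_natDegree hmonic.ne_zero, hdeg]
      exact_mod_cast one_le_sub_one p
    · rw [coeff_add, coeff_X_pow, if_neg (one_le_sub_one p).ne, zero_add, coeff_C_zero,
        Ideal.span_singleton_pow, Ideal.mem_span_singleton]
      intro h
      have := (pow_dvd_pow_iff (PadicInt.prime_p (p := p)).ne_zero
        (PadicInt.prime_p (p := p)).not_isUnit (n := 2) (m := 1)).mp (by simpa using h)
      omega
  rw [hmonic.irreducible_iff_irreducible_map_fraction_map (K := ℚ_[p])] at hirr
  simpa using hirr

theorem IsTameUniformizer.minpoly_eq (hπ : IsTameUniformizer p π) :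
    minpoly ℚ_[p] π = Polynomial.X ^ (p - 1) + Polynomial.C (p : ℚ_[p]) := by
  refine (minpoly.eq_of_irreducible_of_monic (irreducible_X_pow_add_p p) ?_
    (Polynomial.monic_X_pow_add_C _ (one_le_sub_one p).ne')).symm
  simp [hπ.pow_eq]

theorem IsTameUniformizer.exists_algEquiv (hπ : IsTameUniformizer p π) {x : K}
    (hx : x ^ (p - 1) = -(p : K)) : ∃ g : K ≃ₐ[ℚ_[p]] K, g π = x := by
  have hint : IsIntegral ℚ_[p] π := by
    refine ⟨Polynomial.X ^ (p - 1) + Polynomial.C (p : ℚ_[p]),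
      Polynomial.monic_X_pow_add_C _ (one_le_sub_one p).ne', ?_⟩
    simp [hπ.pow_eq]
  have hroot : x ∈ (minpoly ℚ_[p] π).aroots K := by
    rw [Polynomial.mem_aroots]
    refine ⟨minpoly.ne_zero hint, ?_⟩
    rw [hπ.minpoly_eq]
    simp [hx]
  let φ := (IntermediateField.algHomAdjoinIntegralEquiv ℚ_[p] hint).symm ⟨x, hroot⟩
  have hφ : φ (IntermediateField.AdjoinSimple.gen ℚ_[p] π) = x :=
    IntermediateField.algHomAdjoinIntegralEquiv_symm_apply_gen ℚ_[p] hint ⟨x, hroot⟩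
  let ι : K ≃ₐ[ℚ_[p]] IntermediateField.adjoin ℚ_[p] {π} :=
    IntermediateField.topEquiv.symm.trans (IntermediateField.equivOfEq hπ.adjoin_eq_top.symm)
  have : FiniteDimensional ℚ_[p] (IntermediateField.adjoin ℚ_[p] {π}) :=
    IntermediateField.adjoin.finiteDimensional hint
  have : FiniteDimensional ℚ_[p] K := ι.symm.toLinearEquiv.finiteDimensional
  let ψ : K →ₐ[ℚ_[p]] K := φ.comp ι.toAlgHom
  refine ⟨AlgEquiv.ofBijective ψ (Algebra.IsAlgebraic.algHom_bijective ψ), ?_⟩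
  exact hφ

theorem omegaTilde_pow (hπ : IsTameUniformizer p π) (g : K ≃ₐ[ℚ_[p]] K) :
    omegaTilde hπ g ^ (p - 1) = 1 := by
  have h := congrArg (· ^ (p - 1)) (omegaTilde_spec hπ g)
  simp only [mul_pow, ← map_pow, hπ.pow_eq, map_neg, map_natCast] at h
  have hp0 : -(p : K) ≠ 0 := by rw [← hπ.pow_eq]; exact pow_ne_zero _ hπ.ne_zero
  have h1 := (algebraMap ℚ_[p] K).injective
    ((mul_right_cancel₀ hp0 (h.symm.trans (one_mul _).symm)).trans (map_one _).symm)
  exact Units.ext (Subtype.ext (by simpa using h1))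

/-- The Teichmüller lift of a generator of `𝔽_pˣ` times `π` is a conjugate of `π`. Its order is
detected after reduction modulo `p`. -/
theorem exists_orderOf_omegaTilde (hπ : IsTameUniformizer p π) :
    ∃ g, orderOf (omegaTilde hπ g) = p - 1 := by
  obtain ⟨x, hx⟩ := IsCyclic.exists_generator (α := (ZMod p)ˣ)
  obtain ⟨z, hz, hzx⟩ := exists_root_of_unity p x
  have hox : orderOf x = p - 1 := by
    rw [orderOf_eq_card_of_forall_mem_zpowers hx, Nat.card_eq_fintype_card, ZMod.card_units]
  obtain ⟨g, hg⟩ := hπ.exists_algEquiv (x := algebraMap ℚ_[p] K (z : ℚ_[p]) * π) (by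
    rw [mul_pow, ← map_pow, ← PadicInt.coe_pow, hz, hπ.pow_eq]; simp)
  refine ⟨g, Nat.dvd_antisymm (orderOf_dvd_of_pow_eq_one (omegaTilde_pow hπ g)) ?_⟩
  have hgz : ((omegaTilde hπ g : ℤ_[p]ˣ) : ℤ_[p]) = z := by
    rw [omegaTilde_spec hπ g] at hg
    exact Subtype.ext ((algebraMap ℚ_[p] K).injective (mul_right_cancel₀ hπ.ne_zero hg))
  have h1 := pow_orderOf_eq_one (omegaTilde hπ g)
  rw [← hox]
  refine orderOf_dvd_of_pow_eq_one (Units.ext ?_)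
  have h2 := congrArg (fun u : ℤ_[p]ˣ => PadicInt.toZMod (u : ℤ_[p])) h1
  simp only [Units.val_pow_eq_pow_val, map_pow, hgz, hzx, Units.val_one, map_one] at h2
  simpa using h2

/-! ## The Galois action and the grading -/

variable {E : Type*} [Field E] [Algebra ℚ_[p] E] [Algebra ℤ_[p] E]

theorem algebraMap_padicInt_injective (p : ℕ) [hp : Fact p.Prime] (E : Type*) [Field E]
    [Algebra ℚ_[p] E] [FiniteDimensional ℚ_[p] E] [Algebra ℤ_[p] E]
    [IsScalarTower ℤ_[p] ℚ_[p] E] : Function.Injective (algebraMap ℤ_[p] E) := by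
  rw [IsScalarTower.algebraMap_eq ℤ_[p] ℚ_[p] E]
  exact (algebraMap ℚ_[p] E).injective.comp (IsFractionRing.injective ℤ_[p] ℚ_[p])

theorem scaleS_of_mem_Gr {z : ℤ_[p]ˣ} (hz : z ^ (p - 1) = 1) {m n : ℕ}
    {s : BreuilRing p E} (hs : s ∈ Gr ((m : ZMod (p - 1)) - (n : ZMod (p - 1)))) :
    ofZp p E (z ^ n : ℤ_[p]ˣ) * scaleS z s = ofZp p E (z ^ m : ℤ_[p]ˣ) * s := by
  refine toPS_injective (PowerSeries.ext fun l => ?_)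
  rw [map_mul toPS, map_mul toPS, toPS_scaleS, ofZp, RingHom.comp_apply, RingHom.comp_apply,
    toPS_algebraMap, toPS_algebraMap, PowerSeries.coeff_C_mul, PowerSeries.coeff_C_mul,
    PowerSeries.coeff_rescale, ← mul_assoc]
  by_cases hl : (l : ZMod (p - 1)) = (m : ZMod (p - 1)) - (n : ZMod (p - 1))
  · congr 1
    have h1 : n + l ≡ m [MOD p - 1] := by
      rw [← ZMod.natCast_eq_natCast_iff, Nat.cast_add, hl, add_sub_cancel]
    have h2 : z ^ (n + l) = z ^ m := pow_eq_pow_iff_modEq.mpr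
      (h1.of_dvd (orderOf_dvd_of_pow_eq_one hz))
    have h3 := congrArg (fun u : ℤ_[p]ˣ => algebraMap ℤ_[p] E (u : ℤ_[p])) h2
    simp only [pow_add, Units.val_mul, Units.val_pow_eq_pow_val, map_mul, map_pow] at h3 ⊢
    exact h3
  · rw [hs l hl, mul_zero, mul_zero]

/-- A nonzero coefficient of `u^l` forces `z^(n+l) = z^m`. As `z` has order exactly `p - 1`, this
fixes `l` modulo `p - 1`, so a single Galois element detects the degree. -/
theorem mem_Gr_of_scaleS (hinj : Function.Injective (algebraMap ℤ_[p] E)) {z : ℤ_[p]ˣ}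
    (hz : orderOf z = p - 1) {m n : ℕ} {s : BreuilRing p E}
    (h : ofZp p E (z ^ n : ℤ_[p]ˣ) * scaleS z s = ofZp p E (z ^ m : ℤ_[p]ˣ) * s) :
    s ∈ Gr ((m : ZMod (p - 1)) - (n : ZMod (p - 1))) := fun l hl => by
  by_contra hne
  have h := congrArg (fun t => PowerSeries.coeff l (toPS t)) h
  simp only [map_mul, toPS_scaleS, ofZp, RingHom.comp_apply, toPS_algebraMap,
    PowerSeries.coeff_C_mul, PowerSeries.coeff_rescale, ← mul_assoc] at h
  have h2 := mul_right_cancel₀ hne h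
  have h3 : algebraMap ℤ_[p] E ((z ^ (n + l) : ℤ_[p]ˣ) : ℤ_[p]) =
      algebraMap ℤ_[p] E ((z ^ m : ℤ_[p]ˣ) : ℤ_[p]) := by
    rw [pow_add, Units.val_mul, map_mul, Units.val_pow_eq_pow_val z l, map_pow]
    exact h2
  have h4 := pow_eq_pow_iff_modEq.mp (Units.ext (hinj h3))
  rw [hz, ← ZMod.natCast_eq_natCast_iff, Nat.cast_add] at h4
  exact hl (by rw [← h4]; ring)

end Galois

/-! ## Column vectors in a basis -/

section Columns

variable {R M : Type*} [CommRing R] [AddCommGroup M] [Module R M] (e : Module.Basis (Fin 3) R M)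

/-- The vector of `M` whose coordinates are the `j`-th column of `C`. -/
def vcol (C : Matrix (Fin 3) (Fin 3) R) (j : Fin 3) : M := ∑ i, C i j • e i

theorem repr_vcol (C : Matrix (Fin 3) (Fin 3) R) (i j : Fin 3) :
    e.repr (vcol e C j) i = C i j := by
  rw [vcol, e.repr_sum_self]

theorem vcol_add (C D : Matrix (Fin 3) (Fin 3) R) (j : Fin 3) :
    vcol e (C + D) j = vcol e C j + vcol e D j := by
  simp only [vcol, Matrix.add_apply, add_smul, Finset.sum_add_distrib]

theorem vcol_sub (C D : Matrix (Fin 3) (Fin 3) R) (j : Fin 3) :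
    vcol e (C - D) j = vcol e C j - vcol e D j := by
  simp only [vcol, Matrix.sub_apply, sub_smul, Finset.sum_sub_distrib]

theorem vcol_smul (r : R) (C : Matrix (Fin 3) (Fin 3) R) (j : Fin 3) :
    vcol e (r • C) j = r • vcol e C j := by
  simp only [vcol, Matrix.smul_apply, smul_eq_mul, mul_smul, Finset.smul_sum]

theorem vcol_mul (C D : Matrix (Fin 3) (Fin 3) R) (j : Fin 3) :
    vcol e (C * D) j = ∑ l, D l j • vcol e C l := by
  simp only [vcol, Matrix.mul_apply, Finset.sum_smul, Finset.smul_sum, smul_smul]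
  rw [Finset.sum_comm]
  simp only [mul_comm]

theorem ext_repr {x y : M} (h : ∀ i, e.repr x i = e.repr y i) : x = y :=
  e.repr.injective (Finsupp.ext h)

end Columns

namespace QuasiStronglyDivisible

variable {p : ℕ} [hp : Fact p.Prime] {E : Type*} [Field E] [Algebra ℚ_[p] E]
    [Algebra ℤ_[p] E] {K : Type*} [Field K] [Algebra ℚ_[p] K] {π : K}
    {hπ : IsTameUniformizer p π} {M : Type*} [AddCommGroup M]
    [Module (BreuilRing p E) M] (𝓜 : QuasiStronglyDivisible E hπ 2 M)

local notation "κ" => algebraMap (OE p E) (BreuilRing p E)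

/-! ## The map `φ₂` -/

open Classical in
/-- The map `φ₂`, extended by zero. -/
def phiT (x : M) : M := if h : x ∈ 𝓜.fil then 𝓜.phi ⟨x, h⟩ else 0

variable {𝓜}

theorem phiT_eq {x : M} (h : x ∈ 𝓜.fil) : 𝓜.phiT x = 𝓜.phi ⟨x, h⟩ := dif_pos h

theorem phiT_add {x y : M} (hx : x ∈ 𝓜.fil) (hy : y ∈ 𝓜.fil) :
    𝓜.phiT (x + y) = 𝓜.phiT x + 𝓜.phiT y := by
  rw [phiT_eq hx, phiT_eq hy, phiT_eq (add_mem hx hy), ← map_add]; rfl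

theorem phiT_sub {x y : M} (hx : x ∈ 𝓜.fil) (hy : y ∈ 𝓜.fil) :
    𝓜.phiT (x - y) = 𝓜.phiT x - 𝓜.phiT y := by
  rw [phiT_eq hx, phiT_eq hy, phiT_eq (sub_mem hx hy), ← map_sub]; rfl

theorem phiT_smul (s : BreuilRing p E) {x : M} (hx : x ∈ 𝓜.fil) :
    𝓜.phiT (s • x) = frobS p E s • 𝓜.phiT x := by
  rw [phiT_eq hx, phiT_eq (𝓜.fil.smul_mem s hx), ← 𝓜.phi_smul]; rfl

theorem phiT_sum {ι : Type*} (I : Finset ι) {x : ι → M} (hx : ∀ i, x i ∈ 𝓜.fil) :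
    𝓜.phiT (∑ i ∈ I, x i) = ∑ i ∈ I, 𝓜.phiT (x i) := by
  classical
  induction I using Finset.induction_on with
  | empty =>
    rw [Finset.sum_empty, Finset.sum_empty, phiT_eq (zero_mem _)]
    exact map_zero 𝓜.phi
  | insert i I hi ih =>
    rw [Finset.sum_insert hi, Finset.sum_insert hi, phiT_add (hx i) (sum_mem fun i _ => hx i), ih]

theorem phiT_desc (g : K ≃ₐ[ℚ_[p]] K) {x : M} (hx : x ∈ 𝓜.fil) :
    𝓜.phiT (𝓜.desc g x) = 𝓜.desc g (𝓜.phiT x) := by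
  rw [phiT_eq hx, phiT_eq (𝓜.desc_mem_fil g x hx), ← 𝓜.phi_desc]

/-- This is the saturation axiom for the ideal `(p^k)`. It makes `φ₂` continuous for the `p`-adic
topology. -/
theorem exists_mem_fil_of_p_pow_smul_mem {k : ℕ} {z : M}
    (h : (p : BreuilRing p E) ^ k • z ∈ 𝓜.fil) :
    ∃ w ∈ 𝓜.fil, (p : BreuilRing p E) ^ k • z = (p : BreuilRing p E) ^ k • w := by
  have h1 := 𝓜.fil_inf_smul (Ideal.span {(p : OE p E) ^ k})
  rw [Ideal.map_span, Set.image_singleton, map_pow, map_natCast] at h1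
  have h2 : (p : BreuilRing p E) ^ k • z ∈ 𝓜.fil ⊓
      Ideal.span {(p : BreuilRing p E) ^ k} • (⊤ : Submodule (BreuilRing p E) M) :=
    ⟨h, Submodule.smul_mem_smul (Ideal.mem_span_singleton_self _) trivial⟩
  rw [h1, Submodule.ideal_span_singleton_smul, Submodule.mem_smul_pointwise_iff_exists] at h2
  obtain ⟨w, hw, h3⟩ := h2
  exact ⟨w, hw, h3.symm⟩

theorem exists_phiT_p_pow_smul {k : ℕ} {z : M} (h : (p : BreuilRing p E) ^ k • z ∈ 𝓜.fil) :
    ∃ w, 𝓜.phiT ((p : BreuilRing p E) ^ k • z) = (p : BreuilRing p E) ^ k • w := by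
  obtain ⟨w, hw, h2⟩ := exists_mem_fil_of_p_pow_smul_mem h
  exact ⟨𝓜.phiT w, by rw [h2, phiT_smul _ hw, map_pow, map_natCast]⟩

theorem filS_smul_mem {s : BreuilRing p E} (hs : s ∈ filS p E 2) (x : M) : s • x ∈ 𝓜.fil :=
  𝓜.filS_smul_le (Submodule.smul_mem_smul hs trivial)

theorem eisS_sq_smul_mem (x : M) : eisS p E ^ 2 • x ∈ 𝓜.fil := by
  refine filS_smul_mem ?_ x
  rw [← factorial_mul_dpE]
  exact Ideal.mul_mem_left _ _ (dpE_mem_filS le_rfl)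

/-- Multiplying by `j!` gives `φ(E(u))^(j-2) φ₂(E(u)² x)`, which carries a factor `p^(j-2)`. For `j
≥ p ≥ 13` the valuation of `j!` is at most `j - 4`, which leaves `p²` after cancelling `j!` in the
free module. -/
theorem exists_phiT_dpE_smul (hp13 : 13 ≤ p) {j : ℕ} (hj : p ≤ j) (x : M) :
    ∃ w, 𝓜.phiT (dpE p E j • x) = (p : BreuilRing p E) ^ 2 • w := by
  have := 𝓜.free
  have hv := sub_one_mul_padicValNat_factorial_lt (p := p) (j := j) (by omega)
  have hv2 : 12 * padicValNat p j.factorial ≤ (p - 1) * padicValNat p j.factorial :=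
    Nat.mul_le_mul_right _ (by omega)
  obtain ⟨c, hc⟩ := exists_factorial_mul_eq_pow (p := p) (j := j) (n := j - 4) (by omega)
  obtain ⟨d, hd⟩ := p_dvd_frobS_eisS (p := p) (E := E)
  have hc' := congrArg (ofZp p E) hc
  rw [map_mul, map_pow, map_natCast, map_natCast] at hc'
  refine ⟨(ofZp p E c * d ^ (j - 2)) • 𝓜.phiT (eisS p E ^ 2 • x), ?_⟩
  have hj2 : (j.factorial : BreuilRing p E) • dpE p E j • x =
      eisS p E ^ (j - 2) • eisS p E ^ 2 • x := by
    rw [smul_smul, smul_smul, factorial_mul_dpE, ← pow_add, Nat.sub_add_cancel (by omega)]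
  have h1 := congrArg 𝓜.phiT hj2
  rw [phiT_smul _ (filS_smul_mem (dpE_mem_filS (by omega)) x), map_natCast,
    phiT_smul _ (eisS_sq_smul_mem x), map_pow, hd] at h1
  have hinj := smul_right_injective M (factorial_ne_zero_breuil (p := p) (E := E) j)
  refine hinj ?_
  dsimp only
  rw [h1, smul_smul, smul_smul, mul_pow]
  congr 1
  have : (p : BreuilRing p E) ^ (j - 2) = p ^ 2 * p ^ (j - 4) := by
    rw [← pow_add]; congr 1; omega
  rw [this, ← hc']; ring

theorem filS_mono {i j : ℕ} (h : i ≤ j) : filS p E j ≤ filS p E i :=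
  iInf_mono fun _ => sup_le_sup_right (Ideal.span_mono (by
    rintro _ ⟨l, hl, rfl⟩
    exact ⟨l, h.trans hl, rfl⟩)) _

/-- Modulo `p²`, `s` is a combination of divided powers `E(u)^j / j!` with `j ≥ p`. The remaining
multiple of `p²` lies in `Fil² M` as a difference, so saturation bounds its image. -/
theorem exists_phiT_filS_smul (hp13 : 13 ≤ p) {s : BreuilRing p E} (hs : s ∈ filS p E p) (x : M) :
    ∃ w, 𝓜.phiT (s • x) = (p : BreuilRing p E) ^ 2 • w := by
  obtain ⟨y, hy, z, rfl⟩ := exists_of_mem_filS hs 2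
  have key : ∀ x : M, y • x ∈ 𝓜.fil ∧ ∃ w, 𝓜.phiT (y • x) = (p : BreuilRing p E) ^ 2 • w := by
    refine Submodule.span_induction (p := fun y _ => ∀ x : M, y • x ∈ 𝓜.fil ∧
      ∃ w, 𝓜.phiT (y • x) = (p : BreuilRing p E) ^ 2 • w) ?_ ?_ ?_ ?_ hy
    · rintro _ ⟨j, hj, rfl⟩ x
      exact ⟨filS_smul_mem (dpE_mem_filS (by omega)) x, exists_phiT_dpE_smul hp13 hj x⟩
    · intro x
      rw [zero_smul]
      refine ⟨zero_mem _, 0, ?_⟩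
      rw [phiT_eq (zero_mem _), smul_zero]
      exact map_zero 𝓜.phi
    · intro y y' _ _ h h' x
      obtain ⟨h1, w, hw⟩ := h x
      obtain ⟨h1', w', hw'⟩ := h' x
      rw [add_smul]
      exact ⟨add_mem h1 h1', w + w', by rw [phiT_add h1 h1', hw, hw', smul_add]⟩
    · intro a y _ h x
      rw [smul_eq_mul, mul_comm, mul_smul]
      exact h (a • x)
  obtain ⟨h1, w, hw⟩ := key x
  have h2 : ((p : BreuilRing p E) ^ 2 * z) • x ∈ 𝓜.fil := by
    have := sub_mem (filS_smul_mem (𝓜 := 𝓜) (filS_mono (by omega) hs) x) h1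
    rwa [← sub_smul, add_sub_cancel_left] at this
  rw [mul_smul] at h2
  obtain ⟨w', hw'⟩ := exists_phiT_p_pow_smul h2
  exact ⟨w + w', by rw [add_smul, mul_smul, phiT_add h1 h2, hw, hw', smul_add]⟩

/-! ## The operator on matrices -/

variable (e : Module.Basis (Fin 3) (BreuilRing p E) M)

variable (𝓜) in
/-- The matrix of `φ₂` on the columns of `diag(1, E(u), E(u)²) B + R`. -/
def phiMat (B R : Matrix (Fin 3) (Fin 3) (BreuilRing p E)) :
    Matrix (Fin 3) (Fin 3) (BreuilRing p E) :=
  Matrix.of fun i j => e.repr (𝓜.phiT (vcol e (hodgeMat p E * B + R) j)) i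

theorem vcol_phiMat (B R : Matrix (Fin 3) (Fin 3) (BreuilRing p E)) (j : Fin 3) :
    vcol e (𝓜.phiMat e B R) j = 𝓜.phiT (vcol e (hodgeMat p E * B + R) j) :=
  ext_repr e fun i => by rw [repr_vcol]; rfl

theorem vcol_hodgeMat (j : Fin 3) : vcol e (hodgeMat p E) j =
    (![e 0, eisS p E • e 1, eisS p E ^ 2 • e 2] : Fin 3 → M) j := by
  fin_cases j <;> simp [vcol, hodgeMat, Matrix.diagonal_apply, ite_smul]

theorem vcol_hodgeMat_mem (hfil : 𝓜.GeneratesFil ![e 0, eisS p E • e 1, eisS p E ^ 2 • e 2])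
    (j : Fin 3) : vcol e (hodgeMat p E) j ∈ 𝓜.fil := by
  rw [vcol_hodgeMat]
  have h : Submodule.span (BreuilRing p E)
    (Set.range (![e 0, eisS p E • e 1, eisS p E ^ 2 • e 2] : Fin 3 → M)) ≤ 𝓜.fil :=
    hfil ▸ le_sup_left
  exact h (Submodule.subset_span ⟨j, rfl⟩)

end QuasiStronglyDivisible

/-! ### The contracting operator attached to `φ₂` -/

namespace QuasiStronglyDivisible

variable {p : ℕ} [hp : Fact p.Prime] {E : Type*} [Field E] [Algebra ℚ_[p] E]
    [Algebra ℤ_[p] E] {K : Type*} [Field K] [Algebra ℚ_[p] K] {π : K}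
    {hπ : IsTameUniformizer p π} {M : Type*} [AddCommGroup M]
    [Module (BreuilRing p E) M] {𝓜 : QuasiStronglyDivisible E hπ 2 M}
    (e : Module.Basis (Fin 3) (BreuilRing p E) M)

local notation "κ" => algebraMap (OE p E) (BreuilRing p E)

theorem filS_smul_top_le_fil (hp13 : 13 ≤ p) :
    filS p E p • (⊤ : Submodule (BreuilRing p E) M) ≤ 𝓜.fil :=
  (Submodule.smul_mono_left (filS_mono (by omega))).trans 𝓜.filS_smul_le

theorem vcol_mem_filS_smul_top {R : Matrix (Fin 3) (Fin 3) (BreuilRing p E)}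
    (hR : ∀ i j, R i j ∈ filS p E p) (j : Fin 3) :
    vcol e R j ∈ filS p E p • (⊤ : Submodule (BreuilRing p E) M) :=
  sum_mem fun i _ => Submodule.smul_mem_smul (hR i j) trivial

theorem p_sq_dvd_repr_phiT (hp13 : 13 ≤ p) {x : M}
    (hx : x ∈ filS p E p • (⊤ : Submodule (BreuilRing p E) M)) (i : Fin 3) :
    (p : BreuilRing p E) ^ 2 ∣ e.repr (𝓜.phiT x) i := by
  refine Submodule.smul_induction_on' (p := fun x _ => (p : BreuilRing p E) ^ 2 ∣
    e.repr (𝓜.phiT x) i) hx ?_ ?_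
  · intro s hs m _
    obtain ⟨w, hw⟩ := exists_phiT_filS_smul (𝓜 := 𝓜) hp13 hs m
    rw [hw, map_smul, Finsupp.smul_apply, smul_eq_mul]
    exact dvd_mul_right _ _
  · intro x hx y hy h1 h2
    rw [phiT_add (filS_smul_top_le_fil hp13 hx) (filS_smul_top_le_fil hp13 hy), map_add,
      Finsupp.add_apply]
    exact dvd_add h1 h2

variable {a : Fin 3 → ℕ}

theorem vcol_hodgeMat_mul_mem
    (hfil : 𝓜.GeneratesFil ![e 0, eisS p E • e 1, eisS p E ^ 2 • e 2])
    (B : Matrix (Fin 3) (Fin 3) (BreuilRing p E)) (j : Fin 3) :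
    vcol e (hodgeMat p E * B) j ∈ 𝓜.fil := by
  rw [vcol_mul]
  exact sum_mem fun l _ => 𝓜.fil.smul_mem _ (vcol_hodgeMat_mem e hfil l)

theorem vcol_hodgeMat_add_mem (hp13 : 13 ≤ p)
    (hfil : 𝓜.GeneratesFil ![e 0, eisS p E • e 1, eisS p E ^ 2 • e 2])
    (B : Matrix (Fin 3) (Fin 3) (BreuilRing p E))
    {R : Matrix (Fin 3) (Fin 3) (BreuilRing p E)} (hR : ∀ i j, R i j ∈ filS p E p) (j : Fin 3) :
    vcol e (hodgeMat p E * B + R) j ∈ 𝓜.fil := by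
  rw [vcol_add]
  exact add_mem (vcol_hodgeMat_mul_mem e hfil B j)
    (filS_smul_top_le_fil hp13 (vcol_mem_filS_smul_top e hR j))

theorem phiMat_eq (B R : Matrix (Fin 3) (Fin 3) (BreuilRing p E)) (i j : Fin 3) :
    𝓜.phiMat e B R i j = e.repr (𝓜.phiT (vcol e (hodgeMat p E * B + R) j)) i := rfl

theorem phiMat_apply (hp13 : 13 ≤ p)
    (hfil : 𝓜.GeneratesFil ![e 0, eisS p E • e 1, eisS p E ^ 2 • e 2])
    (B : Matrix (Fin 3) (Fin 3) (BreuilRing p E))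
    {R : Matrix (Fin 3) (Fin 3) (BreuilRing p E)} (hR : ∀ i j, R i j ∈ filS p E p) (i j : Fin 3) :
    𝓜.phiMat e B R i j = ∑ l, frobS p E (B l j) * e.repr (𝓜.phiT (vcol e (hodgeMat p E) l)) i +
      e.repr (𝓜.phiT (vcol e R j)) i := by
  rw [phiMat_eq, vcol_add, phiT_add (vcol_hodgeMat_mul_mem e hfil B j)
    (filS_smul_top_le_fil hp13 (vcol_mem_filS_smul_top e hR j)), map_add, Finsupp.add_apply,
    vcol_mul, phiT_sum _ fun l => 𝓜.fil.smul_mem _ (vcol_hodgeMat_mem e hfil l), map_sum,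
    Finsupp.finsetSum_apply]
  congr 1
  refine Finset.sum_congr rfl fun l _ => ?_
  rw [phiT_smul _ (vcol_hodgeMat_mem e hfil l), map_smul, Finsupp.smul_apply, smul_eq_mul]

/-! ## Framed vectors -/

theorem isFramed_iff (x : Fin 3 → M) : 𝓜.IsFramed a x ↔ ∀ j (g : K ≃ₐ[ℚ_[p]] K),
    𝓜.desc g (x j) = ofZp p E (omegaTilde hπ g ^ a j : ℤ_[p]ˣ) • x j := forall_comm

theorem desc_vcol (he : 𝓜.IsFramed a e) (C : Matrix (Fin 3) (Fin 3) (BreuilRing p E))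
    (j : Fin 3) (g : K ≃ₐ[ℚ_[p]] K) : 𝓜.desc g (vcol e C j) =
      ∑ i, (ofZp p E (omegaTilde hπ g ^ a i : ℤ_[p]ˣ) *
        scaleS (omegaTilde hπ g) (C i j)) • e i := by
  rw [vcol, map_sum]
  refine Finset.sum_congr rfl fun i _ => ?_
  rw [𝓜.desc_smul, (isFramed_iff _).mp he i g, smul_smul, mul_comm]

theorem isFramed_vcol (he : 𝓜.IsFramed a e) {C : Matrix (Fin 3) (Fin 3) (BreuilRing p E)}
    (hC : IsFr a C) : 𝓜.IsFramed a (vcol e C) := by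
  rw [isFramed_iff]
  intro j g
  rw [desc_vcol e he, vcol, Finset.smul_sum]
  refine Finset.sum_congr rfl fun i _ => ?_
  rw [smul_smul, scaleS_of_mem_Gr (omegaTilde_pow hπ g) (hC i j)]

theorem isFr_of_isFramed (hinj : Function.Injective (algebraMap ℤ_[p] E))
    (he : 𝓜.IsFramed a e) {C : Matrix (Fin 3) (Fin 3) (BreuilRing p E)}
    (hC : 𝓜.IsFramed a (vcol e C)) : IsFr a C := by
  obtain ⟨g, hg⟩ := exists_orderOf_omegaTilde hπ
  intro i j
  refine mem_Gr_of_scaleS hinj hg ?_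
  have h := congrArg (fun x => e.repr x i) ((isFramed_iff _).mp hC j g)
  rw [desc_vcol e he] at h
  simp only [map_smul, Finsupp.smul_apply, repr_vcol, smul_eq_mul, e.repr_sum_self] at h
  exact h

theorem isFr_phiMat (hinj : Function.Injective (algebraMap ℤ_[p] E)) (he : 𝓜.IsFramed a e)
    (hp13 : 13 ≤ p) (hfil : 𝓜.GeneratesFil ![e 0, eisS p E • e 1, eisS p E ^ 2 • e 2])
    (B : Matrix (Fin 3) (Fin 3) (BreuilRing p E))
    {R : Matrix (Fin 3) (Fin 3) (BreuilRing p E)} (hR : ∀ i j, R i j ∈ filS p E p)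
    (h : IsFr a (hodgeMat p E * B + R)) : IsFr a (𝓜.phiMat e B R) := by
  refine isFr_of_isFramed e hinj he ((isFramed_iff _).mpr fun j g => ?_)
  have hm := vcol_hodgeMat_add_mem e hp13 hfil B hR j
  rw [vcol_phiMat, ← phiT_desc g hm, (isFramed_iff _).mp (isFramed_vcol e he h) j g,
    phiT_smul _ hm, ofZp, RingHom.comp_apply, frobS_algebraMap]

/-- Modulo `u` and `p`, the contribution of `Fil^p S · M` disappears and the matrix of `φ₂` is
diagonal by framing. As the image of `φ₂` generates `M`, the `j`-th diagonal constant term and `p`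
generate the unit ideal; completeness makes that term a unit. -/
theorem isUnit_ct_phiMat (hO : IsPComplete p (OE p E)) (ha : StronglyGeneric p a)
    (hp13 : 13 ≤ p) (hfil : 𝓜.GeneratesFil ![e 0, eisS p E • e 1, eisS p E ^ 2 • e 2])
    (hfr : IsFr a (𝓜.phiMat e 1 0)) (j : Fin 3) : IsUnit (ct (𝓜.phiMat e 1 0 j j)) := by
  have hA : ∀ i l, e.repr (𝓜.phiT (vcol e (hodgeMat p E) l)) i = 𝓜.phiMat e 1 0 i l :=
    fun i l => by rw [phiMat_eq, mul_one, add_zero]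
  have key : ∀ x : M, ct (e.repr x j) ∈
      Ideal.span {ct (𝓜.phiMat e 1 0 j j), (p : OE p E)} := by
    intro x
    have hx : x ∈ Submodule.span (BreuilRing p E) (Set.range 𝓜.phi) := by
      rw [𝓜.span_range_phi]; trivial
    refine Submodule.span_induction (p := fun x _ => ct (e.repr x j) ∈
      Ideal.span {ct (𝓜.phiMat e 1 0 j j), (p : OE p E)}) ?_ ?_ ?_ ?_ hx
    · rintro _ ⟨⟨x, hx⟩, rfl⟩
      rw [← phiT_eq hx]
      have hx' := hx
      rw [← hfil] at hx'
      obtain ⟨y, hy, z, hz, rfl⟩ := Submodule.mem_sup.mp hx'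
      obtain ⟨c, rfl⟩ := (Submodule.mem_span_range_iff_exists_fun _).mp hy
      simp_rw [← vcol_hodgeMat e]
      have hm : ∀ l, c l • vcol e (hodgeMat p E) l ∈ 𝓜.fil := fun l =>
        𝓜.fil.smul_mem _ (vcol_hodgeMat_mem e hfil l)
      rw [phiT_add (sum_mem fun l _ => hm l) (filS_smul_top_le_fil hp13 hz), phiT_sum _ hm, map_add,
        Finsupp.add_apply, map_add, map_sum, Finsupp.finsetSum_apply, map_sum]
      refine add_mem (sum_mem fun l _ => ?_) ?_
      · rw [phiT_smul _ (vcol_hodgeMat_mem e hfil l), map_smul, Finsupp.smul_apply, smul_eq_mul,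
          map_mul, hA]
        by_cases hl : j = l
        · subst hl
          exact Ideal.mul_mem_left _ _ (Ideal.subset_span (by simp))
        · rw [ct_eq_zero_of_mem_Gr (dg_ne_zero ha hl) (hfr j l), mul_zero]
          exact zero_mem _
      · have h2 := p_pow_dvd_ct (p_sq_dvd_repr_phiT e (𝓜 := 𝓜) hp13 hz j)
        exact Ideal.mem_of_dvd _ ((dvd_pow_self _ two_ne_zero).trans h2)
          (Ideal.subset_span (by simp))
    · simp
    · intro x y _ _ h1 h2
      rw [map_add, Finsupp.add_apply, map_add]
      exact add_mem h1 h2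
    · intro s x _ h
      rw [map_smul, Finsupp.smul_apply, smul_eq_mul, map_mul]
      exact Ideal.mul_mem_left _ _ h
  have h1 := key (e j)
  rw [e.repr_self, Finsupp.single_eq_same, map_one, Ideal.mem_span_pair] at h1
  obtain ⟨α, β, h⟩ := h1
  refine isUnit_of_mul_isUnit_right (x := α) (hO.isUnit_of_dvd_sub_one ⟨-β, ?_⟩)
  linear_combination h

theorem isContracting_phiMat (hO : IsPComplete p (OE p E))
    (hinj : Function.Injective (algebraMap ℤ_[p] E)) (he : 𝓜.IsFramed a e)
    (ha : StronglyGeneric p a) (hp13 : 13 ≤ p)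
    (hfil : 𝓜.GeneratesFil ![e 0, eisS p E • e 1, eisS p E ^ 2 • e 2]) :
    IsContracting a (𝓜.phiMat e) where
  sub_mem k B B' R ρ hR hρ hB i j := by
    have hR' : ∀ i j, (R + (p : BreuilRing p E) ^ k • ρ) i j ∈ filS p E p := fun i j =>
      add_mem (hR i j) (Ideal.mul_mem_left _ _ (hρ i j))
    have hρm := vcol_mem_filS_smul_top e hρ j
    have h1 := filS_smul_top_le_fil (𝓜 := 𝓜) hp13 hρm
    have h2 := filS_smul_top_le_fil (𝓜 := 𝓜) hp13 (vcol_mem_filS_smul_top e hR j)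
    rw [phiMat_apply e hp13 hfil _ hR', phiMat_apply e hp13 hfil _ hR, vcol_add, vcol_smul,
      phiT_add h2 (𝓜.fil.smul_mem _ h1), phiT_smul _ h1, map_add, Finsupp.add_apply, map_smul,
      Finsupp.smul_apply, smul_eq_mul, map_pow, map_natCast, add_sub_add_comm, add_sub_cancel_left,
      ← Finset.sum_sub_distrib]
    -- The `B` part improves by hypothesis on `φ(B)`. The `R` part gains a factor `p` because `φ₂`
    -- sends `Fil^p S · M` into `p M`.
    refine add_mem (sum_mem fun l _ => ?_) (mem_nbhd_of_dvd ?_)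
    · rw [← sub_mul]
      exact Ideal.mul_mem_right _ _ (hB l j)
    · rw [pow_succ]
      exact mul_dvd_mul_left _ ((dvd_pow_self _ two_ne_zero).trans
        (p_sq_dvd_repr_phiT e hp13 hρm i))
  isFr B R hR h := isFr_phiMat e hinj he hp13 hfil B hR h
  isUnit_ct := isUnit_ct_phiMat e hO ha hp13 hfil
    (isFr_phiMat e hinj he hp13 hfil 1 (fun _ _ => zero_mem _) (by
      rw [mul_one, add_zero]; exact isFr_hodgeMat a))
  dvd_sub k B B' R R' hR hR' hB hRR i j := by
    choose b hb using hB
    choose r hr using hRR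
    have h1 := vcol_hodgeMat_add_mem e hp13 hfil B hR j
    have h2 := vcol_hodgeMat_add_mem e hp13 hfil B' hR' j
    have hmat : hodgeMat p E * B' + R' - (hodgeMat p E * B + R) =
        (p : BreuilRing p E) ^ k • (hodgeMat p E * Matrix.of b + Matrix.of r) := by
      have hb' : B' = B + (p : BreuilRing p E) ^ k • Matrix.of b := by
        ext i j; simp [← hb]
      have hr' : R' = R + (p : BreuilRing p E) ^ k • Matrix.of r := by
        ext i j; simp [← hr]
      rw [hb', hr', mul_add, Matrix.mul_smul, smul_add]; abel
    -- The quotient `r` need not lie in `Fil^p S`, so `φ₂` may not apply to it. Only `p^k` times the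
    -- combined vector is known to be in `Fil² M`, and saturation is what yields the factor `p^k`.
    have h3 := sub_mem h2 h1
    rw [← vcol_sub, hmat, vcol_smul] at h3
    obtain ⟨w, hw⟩ := exists_phiT_p_pow_smul h3
    rw [phiMat_eq, phiMat_eq, ← Finsupp.sub_apply, ← map_sub,
      ← phiT_sub h2 h1, ← vcol_sub, hmat, vcol_smul, hw, map_smul, Finsupp.smul_apply, smul_eq_mul]
    exact dvd_mul_right _ _

/-! ## Conclusion -/

theorem lowerMat_mul_hodgeMat (v : Params p E) : lowerMat a v * hodgeMat p E =
    !![1, 0, 0;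
      uS p E ^ ((p - 1) - (a 1 - a 0)) * κ v.v₁₀, eisS p E, 0;
      uS p E ^ ((p - 1) - (a 2 - a 0)) * (κ v.v₂₀ + eisS p E * κ v.w₂₀),
        uS p E ^ ((p - 1) - (a 2 - a 1)) * eisS p E * κ v.v₂₁, eisS p E ^ 2] := by
  ext i j
  rw [hodgeMat, Matrix.mul_diagonal]
  fin_cases i <;> fin_cases j <;> simp [lowerMat, lowExp]
  ring

/-- Modulo `Fil^p S · M` the columns of `H B + R` are those of `H B`, and `B` is invertible as a
framed matrix with unit diagonal constant terms. -/
theorem generatesFil_of_isValid (hO : IsPComplete p (OE p E)) (ha : StronglyGeneric p a)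
    (hp13 : 13 ≤ p) (hfil : 𝓜.GeneratesFil ![e 0, eisS p E • e 1, eisS p E ^ 2 • e 2])
    {s : Reduction p E} (hs : s.IsValid a) :
    𝓜.GeneratesFil (vcol e (hodgeMat p E * s.B + s.R)) := by
  have hle := filS_smul_top_le_fil (𝓜 := 𝓜) hp13
  refine le_antisymm (sup_le ?_ hle) ?_
  · rw [Submodule.span_le]
    rintro _ ⟨j, rfl⟩
    exact vcol_hodgeMat_add_mem e hp13 hfil s.B hs.R_mem j
  · have hu := hs.B_mem.isUnit_det hO ha fun j => by rw [hs.ct_eq]; exact hs.isUnit j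
    have hmem : ∀ l, vcol e (hodgeMat p E) l ∈ Submodule.span (BreuilRing p E)
        (Set.range (vcol e (hodgeMat p E * s.B + s.R))) ⊔
          filS p E p • (⊤ : Submodule (BreuilRing p E) M) := by
      intro l
      have heq : hodgeMat p E = (hodgeMat p E * s.B + s.R - s.R) * s.B⁻¹ := by
        rw [add_sub_cancel_right, Matrix.mul_nonsing_inv_cancel_right _ _ hu]
      rw [congrArg (vcol e · l) heq, vcol_mul]
      refine sum_mem fun j _ => Submodule.smul_mem _ _ ?_
      rw [vcol_sub]
      exact sub_mem (Submodule.mem_sup_left (Submodule.subset_span ⟨j, rfl⟩))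
        (Submodule.mem_sup_right (vcol_mem_filS_smul_top e hs.R_mem j))
    conv_lhs => rw [← hfil]
    refine sup_le ?_ le_sup_right
    rw [Submodule.span_le]
    rintro _ ⟨l, rfl⟩
    rw [← vcol_hodgeMat]
    exact hmem l

/-- The `j`-th column is `ct (X j j)` times its rescaled version, whose image under `φ₂` is the
`j`-th column of `X` by the fixed point equation. Frobenius fixes constants, so the scalar comes out
unchanged. -/
theorem phiT_vcol_of_fixed (hp13 : 13 ≤ p)
    (hfil : 𝓜.GeneratesFil ![e 0, eisS p E • e 1, eisS p E ^ 2 • e 2])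
    {s : Reduction p E} (hs : s.IsValid a)
    (hX : s.X = 𝓜.phiMat e (s.B * s.scale) (s.R * s.scale)) (j : Fin 3) :
    𝓜.phiT (vcol e (hodgeMat p E * s.B + s.R) j) = κ (ct (s.X j j)) • vcol e s.X j := by
  have h1 : vcol e (hodgeMat p E * s.B + s.R) j = κ (ct (s.X j j)) •
      vcol e (hodgeMat p E * (s.B * s.scale) + s.R * s.scale) j := by
    refine ext_repr e fun i => ?_
    rw [map_smul, Finsupp.smul_apply, repr_vcol, repr_vcol, ← mul_assoc, ← add_mul,
      Reduction.mul_scale_apply, smul_eq_mul, mul_left_comm, ← map_mul,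
      Ring.mul_inverse_cancel _ (hs.isUnit j), map_one, mul_one]
  rw [h1, phiT_smul _ (vcol_hodgeMat_add_mem e hp13 hfil _ hs.R_scale_mem j), frobS_algebraMap,
    ← vcol_phiMat, ← hX]

end QuasiStronglyDivisible

end

end Breuil

/-! ### The main theorem -/

theorem mainTheorem4 (p : ℕ) [Fact p.Prime]
    (E : Type*) [Field E] [Algebra ℚ_[p] E] [FiniteDimensional ℚ_[p] E]
    [Algebra ℤ_[p] E] [IsScalarTower ℤ_[p] ℚ_[p] E]
    (K : Type*) [Field K] [Algebra ℚ_[p] K] (π : K) (hπ : Breuil.IsTameUniformizer p π)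
    (M : Type*) [AddCommGroup M] [Module (Breuil.BreuilRing p E) M]
    (𝓜 : Breuil.QuasiStronglyDivisible E hπ 2 M)
    (a : Fin 3 → ℕ) (ha : Breuil.StronglyGeneric p a)
    (e : Module.Basis (Fin 3) (Breuil.BreuilRing p E) M) (he : 𝓜.IsFramed a e)
    (hfil : 𝓜.GeneratesFil
      ![e 0, Breuil.eisS p E • e 1, Breuil.eisS p E ^ 2 • e 2]) :
    ∃ (e' : Module.Basis (Fin 3) (Breuil.BreuilRing p E) M) (f' : Fin 3 → 𝓜.fil)
      (v₁₀ v₂₀ w₂₀ v₂₁ : Breuil.OE p E) (l : Fin 3 → (Breuil.OE p E)ˣ),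
      𝓜.IsFramed a e' ∧
      𝓜.IsFramed a (fun j => (f' j : M)) ∧
      𝓜.GeneratesFil (fun j => (f' j : M)) ∧
      (∀ j, (f' j : M) = ∑ i,
        (!![1, 0, 0;
            Breuil.uS p E ^ ((p - 1) - (a 1 - a 0)) *
              algebraMap (Breuil.OE p E) (Breuil.BreuilRing p E) v₁₀, Breuil.eisS p E, 0;
            Breuil.uS p E ^ ((p - 1) - (a 2 - a 0)) *
              (algebraMap (Breuil.OE p E) (Breuil.BreuilRing p E) v₂₀ +
                Breuil.eisS p E * algebraMap (Breuil.OE p E) (Breuil.BreuilRing p E) w₂₀),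
            Breuil.uS p E ^ ((p - 1) - (a 2 - a 1)) * Breuil.eisS p E *
              algebraMap (Breuil.OE p E) (Breuil.BreuilRing p E) v₂₁,
            Breuil.eisS p E ^ 2] : Matrix (Fin 3) (Fin 3) (Breuil.BreuilRing p E)) i j • e' i) ∧
      (∀ j, 𝓜.phi (f' j) = ∑ i,
        Matrix.diagonal (fun k => algebraMap (Breuil.OE p E) (Breuil.BreuilRing p E) (l k))
          i j • e' i) := by
  open Breuil QuasiStronglyDivisible in
  have hO := isPComplete_OE p E
  have hinj := algebraMap_padicInt_injective p E
  -- The two gaps are at least `4`, so `8 ≤ a 2 - a 0 < p - 4`.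
  have hp13 : 13 ≤ p := by
    obtain ⟨h1, h2, h3⟩ := ha
    omega
  obtain ⟨s, hs, hX⟩ := exists_fixed_reduction hO ha
    (isContracting_phiMat e hO hinj he ha hp13 hfil)
  have hdet := hs.X_mem.isUnit_det hO ha hs.isUnit
  have hmem := vcol_hodgeMat_add_mem e hp13 hfil s.B hs.R_mem
  let e' := e.map (Matrix.toLinearEquiv e s.X hdet)
  have he' : ∀ j, e' j = vcol e s.X j := fun j => Matrix.toLin_self e e s.X j
  have hcol : ∀ (C : Matrix (Fin 3) (Fin 3) (BreuilRing p E)) j,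
      ∑ i, C i j • e' i = vcol e (s.X * C) j := fun C j => by
    simp_rw [he', vcol_mul]
  have hfr : IsFr a (hodgeMat p E * s.B + s.R) := by
    rw [← hs.eq]
    exact (hs.X_mem.mul (isFr_lowerMat ha _)).mul (isFr_hodgeMat a)
  -- The generators are written as `e (H B + R)` to see that they lie in `Fil² M`; the reduction
  -- identity rewrites them as `e' N(v) H`, the required form.
  refine ⟨e', fun j => ⟨_, hmem j⟩, s.v.v₁₀, s.v.v₂₀, s.v.w₂₀, s.v.v₂₁,
    fun j => (hs.isUnit j).unit, ?_, isFramed_vcol e he hfr,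
    generatesFil_of_isValid e hO ha hp13 hfil hs, fun j => ?_, fun j => ?_⟩
  · have := isFramed_vcol e he hs.X_mem
    rwa [show vcol e s.X = e' from funext fun j => (he' j).symm] at this
  · rw [← lowerMat_mul_hodgeMat, hcol, ← mul_assoc, hs.eq]
  · rw [← phiT_eq (hmem j), phiT_vcol_of_fixed e hp13 hfil hs hX, Finset.sum_eq_single j]
    · rw [Matrix.diagonal_apply_eq, he', IsUnit.unit_spec]
    · intro i _ hij
      rw [Matrix.diagonal_apply_ne _ hij, zero_smul]
    · exact fun h => absurd (Finset.mem_univ j) h
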